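/- **Setting.** Write $w(x)=1+|x|$, and for $1\le p\le\infty$, $\sigma\in\mathbb R$ let $L^p_\sigma(\mathbb R)=\{f : w^\sigma f\in L^p(\mathbb R)\}$ with norm $\|f\|_{L^p_\sigma}=\|w^\sigma f\|_{L^p}$. Let $H^+$ be the Hardy space of all $f\in L^2(\mathbb R)$ whose Fourier transform $\hat f(\xi)=\int e^{-i\xi x}f(x)\,dx$ vanishes for $\xi<0$, and let $C_+:L^2(\mathbb R)\to H^+$ be the Cauchy projection, $\widehat{C_+f}=\chi_{[0,\infty)}\hat f$. For real-valued $u$ let $L_u\varphi=\frac1i\partial_x\varphi-C_+(uC_+\varphi)$, regarded as an unbounded operator on $H^+$ with domain $\{\varphi\in H^+ : \partial_x\varphi\in L^2,\ u\varphi\in L^2\}$ (for $u\in L^2$ this is $H^+\cap H^1(\mathbb R)$), and let $\rho(L_u)\subset\mathbb C$ be its resolvent set. For $k\in\mathbb C\setminus[0,\infty)$, $\lambda>0$ and $x\ne0$ put $$G_k(x)=\frac1{2\pi}\int_0^{\infty}\frac{e^{ix\xi}}{\xi-k}\,d\xi,\qquad G_{\lambda\pm0i}(x)=\lim_{\varepsilon\searrow0}G_{\lambda\pm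 i\varepsilon}(x),$$ the first integral being an improper one. Let $\mathbb R^+=(0,\infty)$, and let $\rho(L_u)\cup(\mathbb R^+\pm0i)$ be the resolvent set glued with two copies of $\mathbb R^+$: neighbourhoods of $\lambda+0i$ (of $\lambda-0i$) consist of the points of $\rho(L_u)$ near $\lambda$ in the open upper (lower) half plane together with the points $\mu+0i$ ($\mu-0i$) with $\mu$ near $\lambda$. **Theorem 3.5.** Let $s>s_1>\frac12$ and let $u\in L^2_s(\mathbb R)$ be real-valued. Then: 1. For every $k\in\rho(L_u)\cup(\mathbb R^+\pm0i)$ there is a unique $m_1(\cdot,k)\in L^\infty_{-(s-s_1)}(\mathbb R)$ with $$m_1(\cdot,k)=1+G_k*(u\,m_1(\cdot,k)),$$ and for every $\lambda>0$ and each choice of sign there is a unique $m_e(\cdot,\lambda\pm0i)\in L^\infty_{-(s-s_1)}(\mathbb R)$ with $$m_e(x,\lambda\pm0i)=e^{i\lambda x}+\bigl(G_{\lambda\pm0i}*(u\,m_e(\cdot,\lambda\pm0i))\bigr)(x);$$ in both equations the convolution integral converges absolutely at every point, and the equality holds for almost every $x$. 2. All these solutions belong to $L^\infty(\mathbb R)$.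 3. The map $k\mapsto m_1(\cdot,k)$ is analytic from $\rho(L_u)$ to $L^\infty_{-(s-s_1)}(\mathbb R)$. 4. There is $\gamma\in(0,1)$ such that $k\mapsto m_1(\cdot,k)$ is locally Hölder continuous with exponent $\gamma$ from $\rho(L_u)\cup(\mathbb R^+\pm0i)$ to $L^\infty_{-(s-s_1)}(\mathbb R)$, and, for each sign, $\lambda\mapsto m_e(\cdot,\lambda\pm0i)$ is locally Hölder continuous with exponent $\gamma$ from $(0,\infty)$ to $L^\infty_{-(s-s_1)}(\mathbb R)$. Here locally means that every point of the domain has a neighbourhood in which any two points $z,z'$ satisfy $\|m(z)-m(z')\|_{L^\infty_{-(s-s_1)}}\le C|z-z'|^\gamma$ with a constant $C$ depending on the neighbourhood. -/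

import Mathlib

open MeasureTheory Filter Topology Set
open scoped ENNReal FourierTransform SchwartzMap

noncomputable section

namespace BenjaminOno

/-! ### Weighted Lebesgue spaces -/

/-- The weight `w(x) = 1 + |x|`. -/
def weight (x : ℝ) : ℝ := 1 + |x|

theorem weight_pos (x : ℝ) : 0 < weight x := by unfold weight; positivity

theorem measurable_weight_rpow (σ : ℝ) : Measurable fun x : ℝ => weight x ^ σ := by
  unfold weight; fun_prop

/-- `f` belongs to `L^p_σ(ℝ)`, that is, `w^σ f ∈ L^p(ℝ)`. -/
def MemWeightedLp {E : Type*} [NormedAddCommGroup E] [NormedSpace ℝ E]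
    (p : ℝ≥0∞) (σ : ℝ) (f : ℝ → E) : Prop :=
  MemLp (fun x => weight x ^ σ • f x) p volume

theorem MemWeightedLp.congr_ae {p : ℝ≥0∞} {σ : ℝ} {f g : ℝ → ℂ} (h : f =ᵐ[volume] g)
    (hf : MemWeightedLp p σ f) : MemWeightedLp p σ g := by
  refine (memLp_congr_ae ?_).1 hf
  filter_upwards [h] with x hx
  rw [hx]

/-- The complex space `L^p_σ(ℝ)` of almost-everywhere classes of functions. -/
def WeightedLp (p : ℝ≥0∞) (σ : ℝ) : Submodule ℂ (ℝ →ₘ[volume] ℂ) where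
  carrier := {f | MemWeightedLp p σ f}
  zero_mem' := by
    refine MemWeightedLp.congr_ae (f := fun _ => 0) AEEqFun.coeFn_zero.symm ?_
    simp [MemWeightedLp]
  add_mem' := by
    intro f g hf hg
    refine MemWeightedLp.congr_ae (AEEqFun.coeFn_add f g).symm ?_
    have h := MemLp.add (show MemLp (fun x => weight x ^ σ • f x) p volume from hf)
      (show MemLp (fun x => weight x ^ σ • g x) p volume from hg)
    refine (memLp_congr_ae ?_).1 h
    filter_upwards with x
    simp only [Pi.add_apply, smul_add]
  smul_mem' := by
    intro c f hf
    refine MemWeightedLp.congr_ae (AEEqFun.coeFn_smul c f).symm ?_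
    have h := MemLp.const_smul hf c
    refine (memLp_congr_ae ?_).1 h
    filter_upwards with x
    simp only [Pi.smul_apply]
    rw [smul_comm]

theorem WeightedLp.memLp {p : ℝ≥0∞} {σ : ℝ} (f : WeightedLp p σ) :
    MemLp (fun x => weight x ^ σ • (f : ℝ →ₘ[volume] ℂ) x) p volume := f.2

/-- Multiplication by the weight, `f ↦ w^σ f`, from `L^p_σ(ℝ)` to `L^p(ℝ)`. -/
def WeightedLp.mulWeight (p : ℝ≥0∞) (σ : ℝ) :
    WeightedLp p σ →ₗ[ℂ] Lp ℂ p (volume : Measure ℝ) where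
  toFun f := MemLp.toLp _ (WeightedLp.memLp f)
  map_add' f g := by
    refine Lp.ext ?_
    filter_upwards [AEEqFun.coeFn_add (f : ℝ →ₘ[volume] ℂ) (g : ℝ →ₘ[volume] ℂ),
      (WeightedLp.memLp (f + g)).coeFn_toLp, (WeightedLp.memLp f).coeFn_toLp, (WeightedLp.memLp g).coeFn_toLp,
      Lp.coeFn_add (MemLp.toLp _ (WeightedLp.memLp f)) (MemLp.toLp _ (WeightedLp.memLp g))] with x h h1 h2 h3 h4
    rw [h1, h4, Pi.add_apply, h2, h3, Submodule.coe_add, h, Pi.add_apply, smul_add]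
  map_smul' c f := by
    refine Lp.ext ?_
    filter_upwards [AEEqFun.coeFn_smul c (f : ℝ →ₘ[volume] ℂ),
      (WeightedLp.memLp (c • f)).coeFn_toLp, (WeightedLp.memLp f).coeFn_toLp,
      Lp.coeFn_smul c (MemLp.toLp _ (WeightedLp.memLp f))] with x h h1 h2 h3
    rw [h1, RingHom.id_apply, h3, Pi.smul_apply, h2, Submodule.coe_smul, h, Pi.smul_apply,
      smul_comm]

theorem WeightedLp.mulWeight_injective (p : ℝ≥0∞) (σ : ℝ) :
    Function.Injective (WeightedLp.mulWeight p σ) := by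
  intro f g h
  have h' := (MemLp.toLp_eq_toLp_iff (WeightedLp.memLp f) (WeightedLp.memLp g)).1 h
  refine Subtype.ext (AEEqFun.ext ?_)
  filter_upwards [h'] with x hx
  exact smul_right_injective ℂ (Real.rpow_pos_of_pos (weight_pos x) σ).ne' hx

/-- The norm of `L^p_σ(ℝ)` is `‖f‖ = ‖w^σ f‖_p`. -/
instance (p : ℝ≥0∞) [Fact (1 ≤ p)] (σ : ℝ) : NormedAddCommGroup (WeightedLp p σ) :=
  NormedAddCommGroup.induced _ _ (WeightedLp.mulWeight p σ) (WeightedLp.mulWeight_injective p σ)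

instance (p : ℝ≥0∞) [Fact (1 ≤ p)] (σ : ℝ) : NormedSpace ℂ (WeightedLp p σ) :=
  NormedSpace.induced ℂ _ _ (WeightedLp.mulWeight p σ)

/-! ### The Hardy space, the Cauchy projection and the operator `L_u` -/

/-- Multiplication of an `L²` function by the indicator function of `[0, ∞)`. -/
def cutoffNonneg (f : Lp ℂ 2 (volume : Measure ℝ)) : Lp ℂ 2 (volume : Measure ℝ) :=
  MemLp.toLp ((Ici (0 : ℝ)).indicator f) ((Lp.memLp f).indicator measurableSet_Ici)

/-- The Cauchy projection `C_+` on `L²(ℝ)`: the Fourier multiplier with symbol `χ_{[0,∞)}`. -/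
def cauchyPlus (f : Lp ℂ 2 (volume : Measure ℝ)) : Lp ℂ 2 (volume : Measure ℝ) :=
  𝓕⁻ (cutoffNonneg (𝓕 f))

/-- The Hardy space `H⁺` of the upper half plane, as the space of all `f ∈ L²(ℝ)` whose
Fourier transform vanishes on the negative half line. -/
def hardy : Submodule ℂ (Lp ℂ 2 (volume : Measure ℝ)) where
  carrier := {f | ∀ᵐ ξ : ℝ, ξ < 0 → (𝓕 f : Lp ℂ 2 (volume : Measure ℝ)) ξ = 0}
  zero_mem' := by
    have h : (𝓕 (0 : Lp ℂ 2 (volume : Measure ℝ))) = 0 :=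
      (Lp.fourierTransformₗᵢ ℝ ℂ).map_zero
    change ∀ᵐ ξ : ℝ, ξ < 0 → (𝓕 (0 : Lp ℂ 2 (volume : Measure ℝ)) : Lp ℂ 2 _) ξ = 0
    rw [h]
    filter_upwards [Lp.coeFn_zero ℂ 2 (volume : Measure ℝ)] with ξ hξ _
    rw [hξ]; rfl
  add_mem' := by
    intro f g hf hg
    change ∀ᵐ ξ : ℝ, ξ < 0 → (𝓕 (f + g) : Lp ℂ 2 (volume : Measure ℝ)) ξ = 0
    rw [FourierTransform.fourier_add]
    filter_upwards [hf, hg, Lp.coeFn_add (𝓕 f) (𝓕 g)] with ξ h1 h2 h3 hξ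
    rw [h3, Pi.add_apply, h1 hξ, h2 hξ, add_zero]
  smul_mem' := by
    intro c f hf
    change ∀ᵐ ξ : ℝ, ξ < 0 → (𝓕 (c • f) : Lp ℂ 2 (volume : Measure ℝ)) ξ = 0
    rw [FourierTransform.fourier_smul]
    filter_upwards [hf, Lp.coeFn_smul c (𝓕 f)] with ξ h1 h2 hξ
    rw [h2, Pi.smul_apply, h1 hξ, smul_zero]

/-- The graph of `L_u = (1/i) ∂_x - C_+ u C_+` as an unbounded operator on the Hardy space `H⁺`
(where `C_+` is the identity): `IsLaxImage u φ f` says that `φ ∈ H⁺` lies in the domain, i.e. its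
distributional derivative `dφ` is in `L²` (and `g = u φ` is in `L²`), and that
`f = (1/i) dφ - C_+ (u φ)`. -/
def IsLaxImage (u : ℝ → ℝ) (φ f : hardy) : Prop :=
  ∃ dφ g : Lp ℂ 2 (volume : Measure ℝ),
    TemperedDistribution.derivCLM ℂ
        ((φ : Lp ℂ 2 (volume : Measure ℝ)) : 𝓢'(ℝ, ℂ)) = (dφ : 𝓢'(ℝ, ℂ)) ∧
    (g =ᵐ[volume] fun x => (u x : ℂ) * (φ : Lp ℂ 2 (volume : Measure ℝ)) x) ∧
    (f : Lp ℂ 2 (volume : Measure ℝ)) = (1 / Complex.I) • dφ - cauchyPlus g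

/-- The resolvent set `ρ(L_u)`: those `k` for which `L_u - k`, from its domain to `H⁺`, has an
everywhere defined bounded two-sided inverse `R`. -/
def laxResolventSet (u : ℝ → ℝ) : Set ℂ :=
  {k | ∃ R : hardy →L[ℂ] hardy,
    (∀ f : hardy, IsLaxImage u (R f) (f + k • R f)) ∧
    ∀ φ f : hardy, IsLaxImage u φ f → R (f - k • φ) = φ}

/-! ### The spectral variable and the convolution kernels -/

/-- The two sides of the cut `(0, ∞)`. -/
inductive Side
  | plus
  | minus

/-- `1` for the upper side and `-1` for the lower side of the cut. -/
def Side.sgn : Side → ℝ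
  | .plus => 1
  | .minus => -1

/-- Spectral points: complex numbers `k`, and boundary points `l + 0i`, `l - 0i` with `l` real. -/
inductive SpectralPoint
  | interior (k : ℂ)
  | boundary (l : ℝ) (σ : Side)

/-- The complex number below a spectral point. -/
def SpectralPoint.val : SpectralPoint → ℂ
  | .interior k => k
  | .boundary l _ => l

/-- The kernel `G_k(x) = (1/2π) ∫_0^∞ e^{ixξ} / (ξ - k) dξ`, an improper integral, for
`k ∈ ℂ \ [0, ∞)` and `x ≠ 0`. -/
def kernel (k : ℂ) (x : ℝ) : ℂ :=
  (1 / (2 * Real.pi) : ℂ) *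
    limUnder atTop fun N : ℝ => ∫ ξ in (0 : ℝ)..N, Complex.exp (Complex.I * x * ξ) / (ξ - k)

/-- The kernel `G_{l ± 0i}(x) = lim_{ε ↘ 0} G_{l ± iε}(x)`, for `l > 0` and `x ≠ 0`. -/
def boundaryKernel (l : ℝ) (σ : Side) (x : ℝ) : ℂ :=
  limUnder (𝓝[>] (0 : ℝ)) fun ε : ℝ => kernel (l + σ.sgn * ε * Complex.I) x

/-- The kernel `G_z` at a spectral point `z`. -/
def SpectralPoint.G : SpectralPoint → ℝ → ℂ
  | .interior k => kernel k
  | .boundary l σ => boundaryKernel l σ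

/-- `ρ(L_u) ∪ (ℝ⁺ ± 0i)`: the resolvent set glued with two copies of the positive half line. -/
def spectralDomain (u : ℝ → ℝ) : Set SpectralPoint :=
  {z | match z with
    | .interior k => k ∈ laxResolventSet u
    | .boundary l _ => 0 < l}

/-- The `r`-neighbourhood of a spectral point: a disc about an interior point, and the closed half
disc on the side `σ` about a boundary point on that side. -/
def SpectralPoint.near (z : SpectralPoint) (r : ℝ) : Set SpectralPoint :=
  match z with
  | .interior k => {y | ∃ k' : ℂ, y = .interior k' ∧ ‖k' - k‖ < r}
  | .boundary l σ =>
      {y | (∃ k' : ℂ, y = .interior k' ∧ 0 < σ.sgn * k'.im ∧ ‖k' - l‖ < r) ∨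
        ∃ l' : ℝ, y = .boundary l' σ ∧ |l' - l| < r}

/-- `m = g + G_z * (u m)`, where the convolution integral converges absolutely at every point and
the equality holds almost everywhere. -/
def SolvesJost (u : ℝ → ℝ) (z : SpectralPoint) (g m : ℝ → ℂ) : Prop :=
  ConvolutionExists z.G (fun y => (u y : ℂ) * m y) (ContinuousLinearMap.mul ℂ ℂ) volume ∧
  m =ᵐ[volume] fun x =>
    g x + convolution z.G (fun y => (u y : ℂ) * m y) (ContinuousLinearMap.mul ℂ ℂ) volume x

end BenjaminOno

end

noncomputable section

namespace BenjaminOno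

open scoped ComplexConjugate

/-! Put b = s - s₁ and n = w^{-b} m. The equation becomes n = g + A M n in L^∞, where M : L^∞ → L²
multiplies by w^s u and A : L² → L^∞ is F ↦ w^{-b} (G_z * (w^{-s₁} F)). The composite M A is compact
on L²: the value of G_z * (w^{-s₁} F) at a point is the pairing of F with a fixed L² function, so
weak convergence of F gives pointwise convergence, dominated by a multiple of w^s |u|
(`AdmissibleKernel.isCompactOperator`). Hence 1 - M A is invertible as soon as it is injective, and
the solution g + A (1 - M A)⁻¹ M g is analytic in (A, g) (`analyticAt_fredholmSol`). Existence,
uniqueness, analyticity and Hölder continuity all reduce to injectivity and to the regularity of z ↦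
A. Boundedness of m comes from the same kernel estimates with b = 0.

Regularity of A. The kernel G_k is the inverse Fourier transform of 1_{η>0} / (2πη - k), which is an
analytic L²-valued function of k off [0, ∞); wave packets show that ρ(L_u) does not meet [0, ∞).
Near the cut, `kernel_eq_jump_add` gives G_k(x) = ± i e^{ikx} 1_{±x>0} + G_{-k}(-x). The second term
is analytic across the cut. The first is Hölder in k up to the cut, with exponent γ and at the price
of a factor w^γ, which the weights absorb when γ ≤ s - s₁ and s₁ - γ > 1/2.

Injectivity. Let m = G_z * Φ with Φ = u m. At a point of ρ(L_u), m is an L² eigenfunction of L_u,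
hence zero. At l ± 0i it is not known that m is square integrable, so let p_ε = G_{l±iε} * Φ, which
satisfies |p_ε - m| ≤ C ε^γ w^γ, and let h = 𝓕 p_ε, g = 𝓕 Φ, a(τ) = ∫ conj h(η) h(η+τ) dη. Since
(2πη - k) h = g for η > 0 and h = 0 for η ≤ 0, `correlation_identity` yields (2πτ - 2i Im k) a(τ) =
R + E for τ > 0. Here E measures how far Φ conj p_ε is from being real; it is O(ε^γ) because Φ conj
m = u |m|² is real. The term R comes from the edge of the half line and is close to -τ |g(0)|² / l
for small τ and ε. As l > 0, this main term contributes a nonpositive real part, so Re a(τ) ≤ κ + K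
ε^{γ/2} |τ|^{γ/2 - 1} for small τ ≠ 0 (`re_correlation_le`). But a is the Fourier transform of
|p_ε|² ≥ 0. Averaging over τ = t - t' with 0 < t, t' ≤ d = ε^{γ/4} bounds ∫ |p_ε|² |χ_d|² by 2κ,
where χ_d → 1, and Fatou's lemma gives ∫ |m|² ≤ 2κ for every κ > 0. Thus m = 0. -/

/-- The Hilbert space `L²(ℝ)`. -/
abbrev L2 := Lp ℂ 2 (volume : Measure ℝ)

/-! ### Fourier transforms on L¹ ∩ L² and on L² -/

theorem flip_innerₗ : (innerₗ ℝ : ℝ →ₗ[ℝ] ℝ →ₗ[ℝ] ℝ).flip = innerₗ ℝ := by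
  refine LinearMap.ext₂ fun x y => ?_
  simp

theorem flip_neg_innerₗ : (-(innerₗ ℝ : ℝ →ₗ[ℝ] ℝ →ₗ[ℝ] ℝ)).flip = -innerₗ ℝ := by
  refine LinearMap.ext₂ fun x y => ?_
  simp [mul_comm]

/-- The function-level and the `L²` inverse Fourier transforms agree on `L¹ ∩ L²`. -/
theorem coeFn_fourierInv_toLp {f : ℝ → ℂ} (h1 : Integrable f) (h2 : MemLp f 2) :
    ((𝓕⁻ (h2.toLp f) : L2) : ℝ → ℂ) =ᵐ[volume] 𝓕⁻ f := by
  have hcont : Continuous (𝓕⁻ f) :=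
    VectorFourier.fourierIntegral_continuous Real.continuous_fourierChar (by fun_prop) h1
  refine ae_eq_of_integral_contDiff_smul_eq
    ((Lp.memLp _).locallyIntegrable (by norm_num)) hcont.locallyIntegrable ?_
  intro g hg hgc
  have hg₁ : HasCompactSupport (Complex.ofRealCLM ∘ g) := hgc.comp_left rfl
  have hg₂ : ContDiff ℝ ((⊤ : ℕ∞) : WithTop ℕ∞) (Complex.ofRealCLM ∘ g) :=
    Complex.ofRealCLM.contDiff.comp hg
  set G : 𝓢(ℝ, ℂ) := hg₁.toSchwartzMap hg₂
  have hG : ∀ x, G x = (g x : ℂ) := fun x => rfl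
  have key := congrArg (fun T : 𝓢'(ℝ, ℂ) => T G)
    -- The L² transform is tested against G as a tempered distribution, and the function-level
    -- transform by the self-adjointness of the Fourier integral on L¹; both move the transform onto
    -- G.
    (Lp.fourierInv_toTemperedDistribution_eq (h2.toLp f))
  simp only [TemperedDistribution.fourierInv_apply, Lp.toTemperedDistribution_apply] at key
  have hc : (∫ x, g x • (𝓕⁻ (h2.toLp f) : L2) x) = ∫ x, g x • (𝓕⁻ f) x := calc
      ∫ x, g x • (𝓕⁻ (h2.toLp f) : L2) x
      = ∫ x, G x • (𝓕⁻ (h2.toLp f) : L2) x := by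
        refine integral_congr_ae (ae_of_all _ fun x => ?_); simp [hG]
    _ = ∫ x, (𝓕⁻ G) x • (h2.toLp f) x := key.symm
    _ = ∫ x, (𝓕⁻ (G : ℝ → ℂ)) x • f x := by
        refine integral_congr_ae ?_
        filter_upwards [h2.coeFn_toLp] with x hx
        rw [hx, SchwartzMap.fourierInv_coe]
    _ = ∫ x, G x • (𝓕⁻ f) x := by
        have := VectorFourier.integral_fourierIntegral_smul_eq_flip (μ := (volume : Measure ℝ))
          (ν := (volume : Measure ℝ)) (e := Real.fourierChar) (L := -(innerₗ ℝ))
          Real.continuous_fourierChar (by fun_prop) G.integrable h1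
        rw [flip_neg_innerₗ] at this
        exact this
    _ = ∫ x, g x • (𝓕⁻ f) x := by
        refine integral_congr_ae (ae_of_all _ fun x => ?_); simp [hG]
  exact hc

theorem coeFn_fourier_toLp {f : ℝ → ℂ} (h1 : Integrable f) (h2 : MemLp f 2) :
    ((𝓕 (h2.toLp f) : L2) : ℝ → ℂ) =ᵐ[volume] 𝓕 f := by
  have hcont : Continuous (𝓕 f) :=
    VectorFourier.fourierIntegral_continuous Real.continuous_fourierChar (by fun_prop) h1
  refine ae_eq_of_integral_contDiff_smul_eq
    ((Lp.memLp _).locallyIntegrable (by norm_num)) hcont.locallyIntegrable ?_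
  intro g hg hgc
  have hg₁ : HasCompactSupport (Complex.ofRealCLM ∘ g) := hgc.comp_left rfl
  have hg₂ : ContDiff ℝ ((⊤ : ℕ∞) : WithTop ℕ∞) (Complex.ofRealCLM ∘ g) :=
    Complex.ofRealCLM.contDiff.comp hg
  set G : 𝓢(ℝ, ℂ) := hg₁.toSchwartzMap hg₂
  have hG : ∀ x, G x = (g x : ℂ) := fun x => rfl
  have key := congrArg (fun T : 𝓢'(ℝ, ℂ) => T G)
    (Lp.fourier_toTemperedDistribution_eq (h2.toLp f))
  simp only [TemperedDistribution.fourier_apply, Lp.toTemperedDistribution_apply] at key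
  have hc : (∫ x, g x • (𝓕 (h2.toLp f) : L2) x) = ∫ x, g x • (𝓕 f) x := calc
      ∫ x, g x • (𝓕 (h2.toLp f) : L2) x
      = ∫ x, G x • (𝓕 (h2.toLp f) : L2) x := by
        refine integral_congr_ae (ae_of_all _ fun x => ?_); simp [hG]
    _ = ∫ x, (𝓕 G) x • (h2.toLp f) x := key.symm
    _ = ∫ x, (𝓕 (G : ℝ → ℂ)) x • f x := by
        refine integral_congr_ae ?_
        filter_upwards [h2.coeFn_toLp] with x hx
        rw [hx, SchwartzMap.fourier_coe]
    _ = ∫ x, G x • (𝓕 f) x := by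
        have := VectorFourier.integral_fourierIntegral_smul_eq_flip (μ := (volume : Measure ℝ))
          (ν := (volume : Measure ℝ)) (e := Real.fourierChar) (L := (innerₗ ℝ))
          Real.continuous_fourierChar (by fun_prop) G.integrable h1
        rw [flip_innerₗ] at this
        exact this
    _ = ∫ x, g x • (𝓕 f) x := by
        refine integral_congr_ae (ae_of_all _ fun x => ?_); simp [hG]
  exact hc

theorem memLp_fourier {f : ℝ → ℂ} (h1 : Integrable f) (h2 : MemLp f 2) : MemLp (𝓕 f) 2 :=
  (memLp_congr_ae (coeFn_fourier_toLp h1 h2)).1 (Lp.memLp _)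

theorem continuous_fourier {f : ℝ → ℂ} (h1 : Integrable f) : Continuous (𝓕 f) :=
  VectorFourier.fourierIntegral_continuous Real.continuous_fourierChar (by fun_prop) h1

theorem norm_fourier_le {f : ℝ → ℂ} (η : ℝ) : ‖𝓕 f η‖ ≤ ∫ x, ‖f x‖ :=
  VectorFourier.norm_fourierIntegral_le_integral_norm _ _ _ _ _

theorem fourierInv_apply (f : ℝ → ℂ) (x : ℝ) :
    𝓕⁻ f x = ∫ η : ℝ, Complex.exp (2 * Real.pi * x * η * Complex.I) * f η := by
  rw [Real.fourierInv_eq']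
  refine integral_congr_ae (ae_of_all _ fun η => ?_)
  simp only [RCLike.inner_apply, conj_trivial, smul_eq_mul]
  congr 2
  push_cast
  ring

theorem fourier_apply (f : ℝ → ℂ) (η : ℝ) :
    𝓕 f η = ∫ x : ℝ, Complex.exp (-(2 * Real.pi * x * η * Complex.I)) * f x := by
  rw [Real.fourier_real_eq_integral_exp_smul]
  refine integral_congr_ae (ae_of_all _ fun η => ?_)
  simp

theorem norm_exp_phase (x η : ℝ) : ‖Complex.exp (2 * Real.pi * x * η * Complex.I)‖ = 1 := by
  have := Complex.norm_exp_ofReal_mul_I (2 * Real.pi * x * η)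
  push_cast at this
  exact this

/-- This turns a convolution value into an inner product, so that Plancherel applies to it at every
single x. -/
theorem fourier_conj_reflect {Φ : ℝ → ℂ} (x η : ℝ) :
    𝓕 (fun y => starRingEnd ℂ (Φ (x - y))) η =
      starRingEnd ℂ (Complex.exp (2 * Real.pi * x * η * Complex.I) * 𝓕 Φ η) := by
  rw [fourier_apply, fourier_apply, ← integral_const_mul, ← integral_conj,
    ← integral_sub_left_eq_self _ volume x]
  refine integral_congr_ae (ae_of_all _ fun y => ?_)
  simp only [sub_sub_cancel, map_mul, ← Complex.exp_conj, ← mul_assoc, ← Complex.exp_add]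
  congr 2
  simp only [map_neg, map_add, map_mul, Complex.conj_ofReal, Complex.conj_I, Complex.conj_ofNat]
  push_cast
  ring

/-- Convolution with an inverse Fourier transform, at every point. -/
theorem integral_fourierInv_mul (ψ : L2) {Φ : ℝ → ℂ} (h1 : Integrable Φ) (h2 : MemLp Φ 2)
    (x : ℝ) :
    ∫ y, (𝓕⁻ ψ : L2) y * Φ (x - y) =
      ∫ η : ℝ, Complex.exp (2 * Real.pi * x * η * Complex.I) * (ψ η * 𝓕 Φ η) := by
  have h1' : Integrable (fun y => starRingEnd ℂ (Φ (x - y))) :=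
    (Complex.conjLIE.toContinuousLinearEquiv.integrable_comp_iff).2 (h1.comp_sub_left x)
  have h2' : MemLp (fun y => starRingEnd ℂ (Φ (x - y))) 2 := by
    have h3 : MemLp (fun y => Φ (x - y)) 2 :=
      h2.comp_measurePreserving (Measure.measurePreserving_sub_left volume x)
    exact h3.star
  have key : inner ℂ (h2'.toLp _) (𝓕⁻ ψ : L2) = inner ℂ (𝓕 (h2'.toLp _)) ψ := by
    rw [← Lp.inner_fourier_eq, FourierTransform.fourier_fourierInv_eq]
  rw [L2.inner_def, L2.inner_def] at key
  calc ∫ y, (𝓕⁻ ψ : L2) y * Φ (x - y)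
      = ∫ y, inner ℂ (h2'.toLp _ y) ((𝓕⁻ ψ : L2) y) := by
        refine integral_congr_ae ?_
        filter_upwards [h2'.coeFn_toLp] with y hy
        simp [hy]
    _ = _ := key
    _ = _ := by
        refine integral_congr_ae ?_
        filter_upwards [coeFn_fourier_toLp h1' h2'] with η hη
        rw [hη, fourier_conj_reflect]
        simp
        ring

/-- If `η H(η)` is square integrable then `𝓕⁻ H` has a weak derivative in `L²`. -/
theorem derivCLM_fourierInv {H H' : L2}
    (h : H' =ᵐ[volume] fun η => (2 * Real.pi * Complex.I * η) * H η) :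
    TemperedDistribution.derivCLM ℂ ((𝓕⁻ H : L2) : 𝓢'(ℝ, ℂ)) = ((𝓕⁻ H' : L2) : 𝓢'(ℝ, ℂ)) := by
  ext G
  rw [TemperedDistribution.derivCLM_apply_apply, ← Lp.fourierInv_toTemperedDistribution_eq,
    ← Lp.fourierInv_toTemperedDistribution_eq, TemperedDistribution.fourierInv_apply,
    TemperedDistribution.fourierInv_apply, Lp.toTemperedDistribution_apply,
    Lp.toTemperedDistribution_apply]
  have hD : ∀ η : ℝ, 𝓕⁻ (-(SchwartzMap.derivCLM ℂ ℂ) G) η =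
      (2 * Real.pi * Complex.I * η) * 𝓕⁻ G η := by
    intro η
    have h1 := congrFun (Real.fourier_deriv G.integrable G.differentiable
      ((SchwartzMap.derivCLM ℂ ℂ) G).integrable) (-η)
    rw [FourierTransform.fourierInv_neg, neg_apply]
    rw [SchwartzMap.fourierInv_coe, SchwartzMap.fourierInv_coe, Real.fourierInv_eq_fourier_neg,
      Real.fourierInv_eq_fourier_neg]
    have : 𝓕 (⇑((SchwartzMap.derivCLM ℂ ℂ) G)) = 𝓕 (deriv G) := rfl
    rw [this, h1]
    simp
  refine integral_congr_ae ?_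
  filter_upwards [h] with η hη
  rw [hη, hD, smul_eq_mul, smul_eq_mul]
  ring

/-- Identification of an `L²` inverse Fourier transform through symmetric partial integrals. -/
theorem fourierInv_ae_eq_of_tendsto (ψ : L2) {L : ℝ → ℂ}
    (hL : ∀ᵐ x : ℝ, Tendsto (fun N : ℕ => ∫ η in (-(N : ℝ))..N,
      Complex.exp (2 * Real.pi * x * η * Complex.I) * ψ η) atTop (𝓝 (L x))) :
    (𝓕⁻ ψ : L2) =ᵐ[volume] L := by
  have hm : ∀ N : ℕ, MemLp ((Ioc (-(N : ℝ)) N).indicator ψ) 2 := fun N =>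
    (Lp.memLp ψ).indicator measurableSet_Ioc
  have hi : ∀ N : ℕ, Integrable ((Ioc (-(N : ℝ)) N).indicator ψ) := fun N => by
    rw [integrable_indicator_iff measurableSet_Ioc]
    exact ((Lp.memLp ψ).locallyIntegrable (by norm_num)).integrableOn_isCompact isCompact_Icc
      |>.mono_set Ioc_subset_Icc_self
  have hconv : Tendsto (fun N : ℕ => (hm N).toLp _) atTop (𝓝 ψ) := by
    rw [Lp.tendsto_Lp_iff_tendsto_eLpNorm']
    have hlim : Tendsto (fun N : ℕ => ∫⁻ x, (‖((Ioc (-(N : ℝ)) N).indicator ψ) x - ψ x‖ₑ) ^ (2 : ℝ))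
        atTop (𝓝 (∫⁻ _ : ℝ, 0)) := by
      refine tendsto_lintegral_of_dominated_convergence' (fun x => ‖ψ x‖ₑ ^ (2 : ℝ)) ?_ ?_ ?_ ?_
      · intro N
        exact ((((hm N).aestronglyMeasurable.sub (Lp.memLp ψ).aestronglyMeasurable).enorm).pow_const _)
      · intro N
        refine ae_of_all _ fun x => ?_
        by_cases hx : x ∈ Ioc (-(N : ℝ)) N <;> simp [hx]
      · have := (Lp.memLp ψ).eLpNorm_lt_top
        have h3 := lintegral_rpow_enorm_lt_top_of_eLpNorm_lt_top (by norm_num) (by norm_num) this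
        simpa using h3.ne
      · refine ae_of_all _ fun x => ?_
        refine tendsto_const_nhds.congr' ?_
        obtain ⟨N, hN⟩ := exists_nat_gt |x|
        filter_upwards [eventually_ge_atTop N] with n hn
        have : x ∈ Ioc (-(n : ℝ)) n := by
          have h4 : |x| < n := hN.trans_le (by exact_mod_cast hn)
          exact ⟨(abs_lt.1 h4).1, (abs_lt.1 h4).2.le⟩
        simp [this]
    have h5 : ∀ N : ℕ, eLpNorm (⇑((hm N).toLp _) - ⇑ψ) 2 volume =
        (∫⁻ x, (‖((Ioc (-(N : ℝ)) N).indicator ψ) x - ψ x‖ₑ) ^ (2 : ℝ)) ^ (1 / (2 : ℝ)) := by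
      intro N
      rw [eLpNorm_eq_lintegral_rpow_enorm_toReal (by norm_num) (by norm_num)]
      simp only [ENNReal.toReal_ofNat]
      congr 1
      refine lintegral_congr_ae ?_
      filter_upwards [(hm N).coeFn_toLp] with x hx
      simp [hx]
    simp_rw [h5]
    have := hlim.ennrpow_const (1 / (2 : ℝ))
    simpa using this
  have hconv' : Tendsto (fun N : ℕ => (𝓕⁻ ((hm N).toLp _) : L2)) atTop (𝓝 (𝓕⁻ ψ)) :=
    ((Lp.fourierTransformₗᵢ ℝ ℂ).symm.continuous.tendsto ψ).comp hconv
  -- L² convergence of the truncated transforms gives convergence almost everywhere only along a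
  -- subsequence. That is enough, since the pointwise limit L is assumed along the whole sequence.
  obtain ⟨ns, hns, hae⟩ := (tendstoInMeasure_of_tendsto_Lp hconv').exists_seq_tendsto_ae
  have hall : ∀ᵐ x : ℝ, ∀ N : ℕ, (𝓕⁻ ((hm N).toLp _) : L2) x =
      𝓕⁻ ((Ioc (-(N : ℝ)) N).indicator ψ) x :=
    ae_all_iff.2 fun N => coeFn_fourierInv_toLp (hi N) (hm N)
  filter_upwards [hL, hae, hall] with x h1 h2 h3
  refine tendsto_nhds_unique h2 ?_
  have h4 := h1.comp hns.tendsto_atTop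
  refine h4.congr fun j => ?_
  rw [h3, fourierInv_apply, Function.comp_apply, intervalIntegral.integral_of_le
    (by have : (0 : ℝ) ≤ ns j := by positivity
        linarith), ← integral_indicator measurableSet_Ioc]
  refine integral_congr_ae (ae_of_all _ fun η => ?_)
  by_cases hx : η ∈ Ioc (-(ns j : ℝ)) (ns j) <;> simp [hx]

/-! ### The kernel off the half line: convergence and continuity -/

theorem ne_zero_of_neg_mem_slitPlane {k : ℂ} (hk : -k ∈ Complex.slitPlane) : k ≠ 0 := by
  rintro rfl
  simp at hk

/-- The condition `-k ∈ slitPlane` says that k is off [0, ∞). The distance to the half line controls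
bounded t and the reverse triangle inequality controls large t. -/
theorem exists_norm_sub_ge {k : ℂ} (hk : -k ∈ Complex.slitPlane) :
    ∃ c > 0, ∀ t : ℝ, 0 ≤ t → c * (1 + t) ≤ ‖(t : ℂ) - k‖ := by
  obtain ⟨d, hd, hball⟩ := Metric.isOpen_iff.1 Complex.isOpen_slitPlane _ hk
  have h1 : ∀ t : ℝ, 0 ≤ t → d ≤ ‖(t : ℂ) - k‖ := by
    intro t ht
    by_contra! h
    have : (-(t : ℂ)) ∈ Complex.slitPlane := hball (by
      rw [Metric.mem_ball, dist_eq_norm]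
      rwa [show -(t : ℂ) - -k = -((t : ℂ) - k) by ring, norm_neg])
    rw [Complex.mem_slitPlane_iff] at this
    simp at this
    linarith
  -- With N = ‖t - k‖, add d ≤ N, d (t - ‖k‖) ≤ d N and d ‖k‖ ≤ N ‖k‖.
  refine ⟨d / (1 + d + ‖k‖), by positivity, fun t ht => ?_⟩
  rw [div_mul_eq_mul_div, div_le_iff₀ (by positivity)]
  have h2 : t - ‖k‖ ≤ ‖(t : ℂ) - k‖ := by
    have := norm_sub_norm_le (t : ℂ) k
    simpa [abs_of_nonneg ht] using this
  nlinarith [h1 t ht, norm_nonneg k, mul_le_mul_of_nonneg_left h2 hd.le,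
    mul_le_mul_of_nonneg_right (h1 t ht) (norm_nonneg k)]

theorem exists_norm_sub_ge_nhds {k : ℂ} (hk : -k ∈ Complex.slitPlane) :
    ∃ c > 0, ∀ k' : ℂ, ‖k' - k‖ ≤ c → ∀ t : ℝ, 0 ≤ t → c * (1 + t) ≤ ‖(t : ℂ) - k'‖ := by
  obtain ⟨c, hc, h⟩ := exists_norm_sub_ge hk
  refine ⟨c / 2, by positivity, fun k' hk' t ht => ?_⟩
  have h1 := h t ht
  have h2 : ‖(t : ℂ) - k‖ ≤ ‖(t : ℂ) - k'‖ + ‖k' - k‖ := by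
    have := norm_add_le ((t : ℂ) - k') (k' - k)
    rwa [sub_add_sub_cancel] at this
  nlinarith

theorem sub_ne_zero_of_slit {k : ℂ} (hk : -k ∈ Complex.slitPlane) {t : ℝ} (ht : 0 ≤ t) :
    (t : ℂ) - k ≠ 0 := by
  obtain ⟨c, hc, h⟩ := exists_norm_sub_ge hk
  have := h t ht
  rw [← norm_pos_iff]
  nlinarith

theorem integrableOn_one_add_sq_inv : IntegrableOn (fun t : ℝ => (1 + t) ^ (-2 : ℝ)) (Ioi 0) := by
  have h := integrableOn_add_rpow_Ioi_of_lt (a := -2) (c := 0) (m := 1) (by norm_num) (by norm_num)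
  simpa [add_comm] using h

theorem norm_exp_I_mul (x ξ : ℝ) : ‖Complex.exp (Complex.I * x * ξ)‖ = 1 := by
  have := Complex.norm_exp_ofReal_mul_I (x * ξ)
  rw [← this]
  congr 2
  push_cast
  ring

theorem norm_exp_div_sq_le {k : ℂ} {c : ℝ} (hc : 0 < c) {t : ℝ} (ht : 0 ≤ t)
    (h : c * (1 + t) ≤ ‖(t : ℂ) - k‖) (x : ℝ) :
    ‖Complex.exp (Complex.I * x * t) / ((t : ℂ) - k) ^ 2‖ ≤ c ^ (-2 : ℝ) * (1 + t) ^ (-2 : ℝ) := by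
  rw [norm_div, norm_exp_I_mul, norm_pow, ← Real.mul_rpow hc.le (by linarith),
    Real.rpow_neg (by positivity), one_div]
  have h3 : 0 < c * (1 + t) := by positivity
  gcongr
  exact_mod_cast pow_le_pow_left₀ h3.le h 2

theorem continuousOn_exp_div {k : ℂ} (hk : -k ∈ Complex.slitPlane) (x : ℝ) (n : ℕ) :
    ContinuousOn (fun ξ : ℝ => Complex.exp (Complex.I * x * ξ) / ((ξ : ℂ) - k) ^ n) (Ici 0) := by
  refine ContinuousOn.div (by fun_prop) (by fun_prop) fun t ht => ?_
  exact pow_ne_zero _ (sub_ne_zero_of_slit hk ht)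

theorem integrableOn_exp_div_sq {k : ℂ} (hk : -k ∈ Complex.slitPlane) (x : ℝ) :
    IntegrableOn (fun ξ : ℝ => Complex.exp (Complex.I * x * ξ) / ((ξ : ℂ) - k) ^ 2) (Ioi 0) := by
  obtain ⟨c, hc, h⟩ := exists_norm_sub_ge hk
  refine Integrable.mono' (integrableOn_one_add_sq_inv.const_mul (c ^ (-2 : ℝ))) ?_ ?_
  · exact ((continuousOn_exp_div hk x 2).mono Ioi_subset_Ici_self).aestronglyMeasurable
      measurableSet_Ioi
  · filter_upwards [ae_restrict_mem measurableSet_Ioi] with t ht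
    exact norm_exp_div_sq_le hc (le_of_lt ht) (h t (le_of_lt ht)) x

/-- The limit of the improper integral defining `G_k(x)`, after an integration by parts. -/
def kernelLim (k : ℂ) (x : ℝ) : ℂ :=
  1 / (Complex.I * x) *
    (1 / k + ∫ ξ in Ioi (0 : ℝ), Complex.exp (Complex.I * x * ξ) / ((ξ : ℂ) - k) ^ 2)

theorem tendsto_kernelLim {k : ℂ} (hk : -k ∈ Complex.slitPlane) {x : ℝ} (hx : x ≠ 0) :
    Tendsto (fun N : ℝ => ∫ ξ in (0 : ℝ)..N, Complex.exp (Complex.I * x * ξ) / (ξ - k)) atTop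
      (𝓝 (kernelLim k x)) := by
  have hx' : (x : ℂ) ≠ 0 := by exact_mod_cast hx
  have hIx : Complex.I * x ≠ 0 := mul_ne_zero Complex.I_ne_zero hx'
  have hk0 : k ≠ 0 := ne_zero_of_neg_mem_slitPlane hk
  have hparts : ∀ N : ℝ, 0 ≤ N → ∫ ξ in (0 : ℝ)..N, Complex.exp (Complex.I * x * ξ) / (ξ - k) =
      Complex.exp (Complex.I * x * N) / (Complex.I * x * (N - k)) +
      -- Integration by parts trades the conditionally convergent 1/ξ decay for an absolutely
      -- convergent 1/ξ² integral; the boundary term at N tends to zero and the one at 0 leaves 1/k.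
      1 / (Complex.I * x) * (1 / k + ∫ ξ in (0 : ℝ)..N,
        Complex.exp (Complex.I * x * ξ) / ((ξ : ℂ) - k) ^ 2) := by
    intro N hN
    have hsub : uIcc 0 N ⊆ Ici 0 := by
      rw [uIcc_of_le hN]; exact Icc_subset_Ici_self
    have i1 : IntervalIntegrable (fun ξ : ℝ => Complex.exp (Complex.I * x * ξ) / ((ξ : ℂ) - k))
        volume 0 N := by
      have := (continuousOn_exp_div hk x 1).mono hsub
      simp only [pow_one] at this
      exact this.intervalIntegrable
    have i2 : IntervalIntegrable (fun ξ : ℝ => Complex.exp (Complex.I * x * ξ) / ((ξ : ℂ) - k) ^ 2)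
        volume 0 N := ((continuousOn_exp_div hk x 2).mono hsub).intervalIntegrable
    have hd : ∀ ξ ∈ uIcc 0 N, HasDerivAt
        (fun ξ : ℝ => Complex.exp (Complex.I * x * ξ) / (Complex.I * x * ((ξ : ℂ) - k)))
        (Complex.exp (Complex.I * x * ξ) / ((ξ : ℂ) - k) -
          1 / (Complex.I * x) * (Complex.exp (Complex.I * x * ξ) / ((ξ : ℂ) - k) ^ 2)) ξ := by
      intro ξ hξ
      have hne := sub_ne_zero_of_slit hk (hsub hξ)
      have h1 : HasDerivAt (fun ξ : ℝ => (ξ : ℂ)) 1 ξ := Complex.ofRealCLM.hasDerivAt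
      have h2 := (h1.const_mul (Complex.I * x)).cexp
      have h3 := (h1.sub_const k).const_mul (Complex.I * x)
      refine (h2.div h3 (mul_ne_zero hIx hne)).congr_deriv ?_
      field_simp
    have := intervalIntegral.integral_eq_sub_of_hasDerivAt hd (i1.sub (i2.const_mul _))
    rw [intervalIntegral.integral_sub i1 (i2.const_mul _), intervalIntegral.integral_const_mul] at this
    rw [sub_eq_iff_eq_add] at this
    rw [this]
    simp
    field_simp
    ring
  have t1 : Tendsto (fun N : ℝ => Complex.exp (Complex.I * x * N) / (Complex.I * x * (N - k)))
      atTop (𝓝 0) := by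
    rw [tendsto_zero_iff_norm_tendsto_zero]
    have h4 : Tendsto (fun N : ℝ => ‖Complex.I * x‖⁻¹ * (N - ‖k‖)⁻¹) atTop (𝓝 (‖Complex.I * x‖⁻¹ * 0)) :=
      ((tendsto_atTop_add_const_right _ (-‖k‖) tendsto_id).inv_tendsto_atTop).const_mul _
    rw [mul_zero] at h4
    refine squeeze_zero' (Eventually.of_forall fun _ => norm_nonneg _) ?_ h4
    filter_upwards [eventually_gt_atTop ‖k‖] with N hN
    have h0 : 0 ≤ N := (norm_nonneg k).trans hN.le
    rw [norm_div, norm_exp_I_mul, norm_mul, one_div, mul_inv]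
    have : N - ‖k‖ ≤ ‖(N : ℂ) - k‖ := by
      have := norm_sub_norm_le (N : ℂ) k
      simpa [abs_of_nonneg h0] using this
    gcongr
  have t2 := intervalIntegral_tendsto_integral_Ioi 0 (integrableOn_exp_div_sq hk x) tendsto_id
  have t3 := t1.add ((t2.const_add (1 / k)).const_mul (1 / (Complex.I * x)))
  rw [zero_add] at t3
  refine t3.congr' ?_
  filter_upwards [eventually_ge_atTop 0] with N hN
  rw [hparts N hN]
  rfl

theorem kernel_eq {k : ℂ} (hk : -k ∈ Complex.slitPlane) {x : ℝ} (hx : x ≠ 0) :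
    kernel k x = 1 / (2 * Real.pi) * kernelLim k x := by
  rw [kernel, (tendsto_kernelLim hk hx).limUnder_eq]

theorem continuousOn_kernel {k : ℂ} (hk : -k ∈ Complex.slitPlane) :
    ContinuousOn (kernel k) {0}ᶜ := by
  obtain ⟨c, hc, h⟩ := exists_norm_sub_ge hk
  have h1 : Continuous fun x : ℝ => ∫ ξ in Ioi (0 : ℝ),
      Complex.exp (Complex.I * x * ξ) / ((ξ : ℂ) - k) ^ 2 := by
    refine continuous_of_dominated (bound := fun t => c ^ (-2 : ℝ) * (1 + t) ^ (-2 : ℝ)) ?_ ?_ ?_ ?_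
    · intro x
      exact (integrableOn_exp_div_sq hk x).aestronglyMeasurable
    · intro x
      filter_upwards [ae_restrict_mem measurableSet_Ioi] with t ht
      exact norm_exp_div_sq_le hc (le_of_lt ht) (h t (le_of_lt ht)) x
    · exact integrableOn_one_add_sq_inv.const_mul _
    · exact ae_of_all _ fun t => by fun_prop
  have h2 : ContinuousOn (fun x : ℝ => 1 / (2 * Real.pi) * kernelLim k x) {0}ᶜ := by
    unfold kernelLim
    refine continuousOn_const.mul (ContinuousOn.mul ?_ (continuous_const.add h1).continuousOn)
    refine continuousOn_const.div (by fun_prop) fun x hx => ?_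
    exact mul_ne_zero Complex.I_ne_zero (by exact_mod_cast hx)
  exact h2.congr fun x hx => kernel_eq hk hx

theorem tendsto_kernel {k : ℂ} (hk : -k ∈ Complex.slitPlane) {x : ℝ} (hx : x ≠ 0) :
    Tendsto (fun k' => kernel k' x) (𝓝 k) (𝓝 (kernel k x)) := by
  obtain ⟨c, hc, h⟩ := exists_norm_sub_ge_nhds hk
  have hnear : ∀ᶠ k' in 𝓝 k, ‖k' - k‖ ≤ c := by
    filter_upwards [Metric.closedBall_mem_nhds k hc] with k' hk'
    rwa [← dist_eq_norm]
  have hslit : ∀ᶠ k' in 𝓝 k, -k' ∈ Complex.slitPlane :=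
    (continuous_neg.tendsto k).eventually (Complex.isOpen_slitPlane.mem_nhds hk)
  have h1 : Tendsto (fun k' => ∫ ξ in Ioi (0 : ℝ),
      Complex.exp (Complex.I * x * ξ) / ((ξ : ℂ) - k') ^ 2) (𝓝 k) (𝓝 (∫ ξ in Ioi (0 : ℝ),
      Complex.exp (Complex.I * x * ξ) / ((ξ : ℂ) - k) ^ 2)) := by
    refine tendsto_integral_filter_of_dominated_convergence
      (fun t => c ^ (-2 : ℝ) * (1 + t) ^ (-2 : ℝ)) ?_ ?_ ?_ ?_
    · filter_upwards [hslit] with k' hk'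
      exact (integrableOn_exp_div_sq hk' x).aestronglyMeasurable
    · filter_upwards [hnear] with k' hk'
      filter_upwards [ae_restrict_mem measurableSet_Ioi] with t ht
      exact norm_exp_div_sq_le hc (le_of_lt ht) (h k' hk' t (le_of_lt ht)) x
    · exact integrableOn_one_add_sq_inv.const_mul _
    · filter_upwards [ae_restrict_mem measurableSet_Ioi] with t ht
      have hne := sub_ne_zero_of_slit hk (le_of_lt ht)
      exact tendsto_const_nhds.div ((tendsto_const_nhds.sub tendsto_id).pow 2) (pow_ne_zero _ hne)
  have h2 : Tendsto (fun k' => 1 / (2 * Real.pi) * kernelLim k' x) (𝓝 k)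
      (𝓝 (1 / (2 * Real.pi) * kernelLim k x)) :=
    (((tendsto_const_nhds.div tendsto_id (ne_zero_of_neg_mem_slitPlane hk)).add h1).const_mul _).const_mul _
  rw [← kernel_eq hk hx] at h2
  refine h2.congr' ?_
  filter_upwards [hslit] with k' hk'
  rw [kernel_eq hk' hx]

/-! ### The kernel as the inverse Fourier transform of its symbol -/

/-- The symbol of `G_k` as a Fourier multiplier. -/
def symb (k : ℂ) : ℝ → ℂ := (Ioi (0 : ℝ)).indicator fun η => 1 / ((2 * Real.pi * η : ℝ) - k)

theorem symb_of_pos (k : ℂ) {η : ℝ} (h : 0 < η) :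
    symb k η = 1 / ((2 * Real.pi * η : ℝ) - k) := indicator_of_mem (mem_Ioi.2 h) _

theorem symb_of_nonpos (k : ℂ) {η : ℝ} (h : η ≤ 0) : symb k η = 0 :=
  indicator_of_notMem (by simpa using h) _

theorem measurable_symb (k : ℂ) : Measurable (symb k) :=
  Measurable.indicator (by fun_prop) measurableSet_Ioi

theorem memLp_indicator_one_add_inv : MemLp ((Ioi (0 : ℝ)).indicator fun t => (1 + t)⁻¹) 2 := by
  rw [memLp_two_iff_integrable_sq]
  · have : (fun x => (Ioi (0 : ℝ)).indicator (fun t => (1 + t)⁻¹) x ^ 2) =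
        (Ioi (0 : ℝ)).indicator fun t => (1 + t) ^ (-2 : ℝ) := by
      ext x
      by_cases hx : x ∈ Ioi (0 : ℝ)
      · simp only [hx, indicator_of_mem]
        rw [Real.rpow_neg (by have : 0 < x := hx; linarith)]
        simp
      · simp [hx]
    rw [this, integrable_indicator_iff measurableSet_Ioi]
    exact integrableOn_one_add_sq_inv
  · exact (Measurable.indicator (by fun_prop) measurableSet_Ioi).aestronglyMeasurable

theorem norm_symb_le {k : ℂ} {c : ℝ} (hc : 0 < c)
    (h : ∀ t : ℝ, 0 ≤ t → c * (1 + t) ≤ ‖(t : ℂ) - k‖) (η : ℝ) :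
    ‖symb k η‖ ≤ c⁻¹ * (Ioi (0 : ℝ)).indicator (fun t => (1 + t)⁻¹) η := by
  by_cases hη : η ∈ Ioi (0 : ℝ)
  · have hη' : 0 < η := hη
    rw [symb, indicator_of_mem hη, indicator_of_mem hη, norm_div, norm_one, one_div, ← mul_inv]
    have h1 := h (2 * Real.pi * η) (by positivity)
    have h2 : η ≤ 2 * Real.pi * η := by nlinarith [Real.pi_gt_three]
    have h3 : c * (1 + η) ≤ ‖((2 * Real.pi * η : ℝ) : ℂ) - k‖ := by nlinarith
    exact inv_anti₀ (by positivity) h3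
  · simp [symb, hη]

theorem memLp_symb {k : ℂ} (hk : -k ∈ Complex.slitPlane) : MemLp (symb k) 2 := by
  obtain ⟨c, hc, h⟩ := exists_norm_sub_ge hk
  exact (memLp_indicator_one_add_inv.const_mul c⁻¹).mono' (measurable_symb k).aestronglyMeasurable
    (ae_of_all _ (norm_symb_le hc h))

theorem integral_scaled_exp_div (k : ℂ) (x N : ℝ) :
    ∫ η in (0 : ℝ)..N, Complex.exp (2 * Real.pi * x * η * Complex.I) / ((2 * Real.pi * η : ℝ) - k) =
      1 / (2 * Real.pi) * ∫ ξ in (0 : ℝ)..(2 * Real.pi * N),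
        Complex.exp (Complex.I * x * ξ) / (ξ - k) := by
  have hpi : (2 * Real.pi) ≠ 0 := by positivity
  have := intervalIntegral.integral_comp_mul_left (a := 0) (b := N)
    (fun ξ : ℝ => Complex.exp (Complex.I * x * ξ) / (ξ - k)) hpi
  rw [mul_zero] at this
  rw [show (1 / (2 * Real.pi) : ℂ) = (((2 * Real.pi)⁻¹ : ℝ) : ℂ) by push_cast; ring,
    ← Complex.real_smul, ← this]
  refine intervalIntegral.integral_congr fun η _ => ?_
  congr 2
  push_cast
  ring

theorem tendsto_kernel_scaled {k : ℂ} (hk : -k ∈ Complex.slitPlane) {x : ℝ} (hx : x ≠ 0) :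
    Tendsto (fun N : ℕ => ∫ η in (0 : ℝ)..N,
      Complex.exp (2 * Real.pi * x * η * Complex.I) / ((2 * Real.pi * η : ℝ) - k)) atTop
      (𝓝 (kernel k x)) := by
  simp_rw [integral_scaled_exp_div]
  rw [kernel_eq hk hx]
  refine Tendsto.const_mul _ ?_
  exact (tendsto_kernelLim hk hx).comp
    (tendsto_natCast_atTop_atTop.const_mul_atTop (by positivity))

theorem ae_ne_zero : ∀ᵐ x : ℝ, x ≠ 0 := by
  simp [ae_iff]

/-- The symmetric partial integrals of the symbol are, after ξ = 2πη, the partial integrals of the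
improper integral defining `kernel`, because the symbol vanishes on the negative half line. -/
theorem kernel_ae_eq {k : ℂ} (hk : -k ∈ Complex.slitPlane) :
    (𝓕⁻ ((memLp_symb hk).toLp _) : L2) =ᵐ[volume] kernel k := by
  refine fourierInv_ae_eq_of_tendsto _ ?_
  filter_upwards [ae_ne_zero] with x hx
  refine (tendsto_kernel_scaled hk hx).congr fun N => ?_
  have hN : (0 : ℝ) ≤ N := by positivity
  rw [intervalIntegral.integral_of_le hN, intervalIntegral.integral_of_le (by linarith),
    ← integral_indicator measurableSet_Ioc, ← integral_indicator measurableSet_Ioc]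
  refine integral_congr_ae ?_
  filter_upwards [(memLp_symb hk).coeFn_toLp] with η hη
  by_cases h0 : 0 < η
  · by_cases h1 : η ≤ N
    · have : -(N : ℝ) < η := by linarith
      simp only [indicator, mem_Ioc, h0, h1, this, and_self, if_true, hη]
      rw [symb_of_pos k h0, mul_one_div]
    · simp [indicator, h1]
  · simp [indicator, h0, hη, symb_of_nonpos k (not_lt.1 h0)]

/-! ### The jump of the kernel across the cut -/

theorem Side.sgn_ne_zero (σ : Side) : σ.sgn ≠ 0 := by cases σ <;> simp [Side.sgn]

theorem Side.abs_sgn (σ : Side) : |σ.sgn| = 1 := by cases σ <;> simp [Side.sgn]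

theorem Side.sgn_mul_self (σ : Side) : σ.sgn * σ.sgn = 1 := by cases σ <;> simp [Side.sgn]

/-- The non-decaying part `± i e^{ikx} 1_{±x>0}` of the kernel. -/
def jumpKernel (σ : Side) (k : ℂ) (x : ℝ) : ℂ :=
  if 0 < σ.sgn * x then σ.sgn * Complex.I * Complex.exp (Complex.I * k * x) else 0

theorem measurable_jumpKernel (σ : Side) (k : ℂ) : Measurable (jumpKernel σ k) := by
  unfold jumpKernel
  exact Measurable.ite (measurableSet_lt measurable_const (by fun_prop)) (by fun_prop) (by fun_prop)

theorem norm_jumpKernel_le (σ : Side) (k : ℂ) (x : ℝ) :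
    ‖jumpKernel σ k x‖ ≤ Real.exp (-(σ.sgn * k.im) * |x|) := by
  unfold jumpKernel
  split_ifs with h
  · rw [norm_mul, norm_mul, Complex.norm_I, Complex.norm_real, Real.norm_eq_abs, σ.abs_sgn,
      one_mul, one_mul, Complex.norm_exp]
    have : |x| = σ.sgn * x := by
      rw [← abs_of_pos h, abs_mul, σ.abs_sgn, one_mul]
    rw [this]
    have h2 := σ.sgn_mul_self
    refine le_of_eq (congrArg _ ?_)
    simp
    linear_combination (-(k.im * x)) * h2
  · simp; positivity

theorem continuousOn_jumpKernel (σ : Side) (k : ℂ) : ContinuousOn (jumpKernel σ k) {0}ᶜ := by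
  intro x hx
  have hx' : σ.sgn * x ≠ 0 := mul_ne_zero σ.sgn_ne_zero hx
  refine ContinuousAt.continuousWithinAt ?_
  rcases lt_or_gt_of_ne hx' with h | h
  · have : ∀ᶠ y in 𝓝 x, σ.sgn * y < 0 :=
      (continuous_const.mul continuous_id).continuousAt.eventually_lt_const h
    refine (continuousAt_const (y := (0 : ℂ))).congr ?_
    filter_upwards [this] with y hy
    simp [jumpKernel, hy.le]
  · have : ∀ᶠ y in 𝓝 x, 0 < σ.sgn * y :=
      (continuous_const.mul continuous_id).continuousAt.eventually_const_lt h
    refine ContinuousAt.congr (f := fun y : ℝ => σ.sgn * Complex.I *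
      Complex.exp (Complex.I * k * y)) (by fun_prop) ?_
    filter_upwards [this] with y hy
    simp only [jumpKernel, if_pos hy]

theorem integrable_exp_neg_abs {c : ℝ} (hc : 0 < c) :
    Integrable fun x : ℝ => Real.exp (-c * |x|) := by
  have h1 : IntegrableOn (fun x : ℝ => Real.exp (-c * |x|)) (Ioi 0) := by
    refine (integrableOn_exp_mul_Ioi (a := -c) (by linarith) 0).congr_fun (fun x hx => ?_)
      measurableSet_Ioi
    have hx' : 0 < x := hx
    simp only [abs_of_pos hx']
  have h2 : IntegrableOn (fun x : ℝ => Real.exp (-c * |x|)) (Iic 0) := by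
    refine (integrableOn_exp_mul_Iic (a := c) hc 0).congr_fun (fun x hx => ?_)
      measurableSet_Iic
    have hx' : x ≤ 0 := hx
    simp only [abs_of_nonpos hx', neg_mul_neg]
  have := h2.union h1
  rwa [Iic_union_Ioi, integrableOn_univ] at this

theorem integrable_jumpKernel {σ : Side} {k : ℂ} (hk : 0 < σ.sgn * k.im) :
    Integrable (jumpKernel σ k) :=
  (integrable_exp_neg_abs hk).mono' (measurable_jumpKernel σ k).aestronglyMeasurable
    (ae_of_all _ (norm_jumpKernel_le σ k))

theorem memLp_jumpKernel {σ : Side} {k : ℂ} (hk : 0 < σ.sgn * k.im) :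
    MemLp (jumpKernel σ k) 2 := by
  rw [memLp_two_iff_integrable_sq_norm (measurable_jumpKernel σ k).aestronglyMeasurable]
  have hc : 0 < 2 * (σ.sgn * k.im) := by positivity
  refine (integrable_exp_neg_abs hc).mono'
    ((measurable_jumpKernel σ k).norm.pow_const 2).aestronglyMeasurable (ae_of_all _ fun x => ?_)
  have h1 := norm_jumpKernel_le σ k x
  have h2 : Real.exp (-(2 * (σ.sgn * k.im)) * |x|) = Real.exp (-(σ.sgn * k.im) * |x|) ^ 2 := by
    rw [← Real.exp_nat_mul]
    congr 1
    push_cast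
    ring
  rw [h2, Real.norm_of_nonneg (by positivity)]
  gcongr

/-- The sign condition on Im k makes the exponential decay on the half line supporting the kernel,
so the transform is an elementary integral. It plays the role of the residue computation for 1/(ξ -
k) over the whole line. -/
theorem fourier_jumpKernel {σ : Side} {k : ℂ} (hk : 0 < σ.sgn * k.im) (η : ℝ) :
    𝓕 (jumpKernel σ k) η = 1 / ((2 * Real.pi * η : ℝ) - k) := by
  rw [fourier_apply]
  have hne : ((2 * Real.pi * η : ℝ) : ℂ) - k ≠ 0 := by
    intro h
    have h1 := congrArg Complex.im h
    rw [Complex.sub_im, Complex.ofReal_im, zero_sub, Complex.zero_im, neg_eq_zero] at h1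
    rw [h1, mul_zero] at hk
    exact lt_irrefl _ hk
  set a : ℂ := Complex.I * (k - (2 * Real.pi * η : ℝ)) with ha
  have hane : a ≠ 0 := by
    rw [ha]
    refine mul_ne_zero Complex.I_ne_zero ?_
    rwa [← neg_sub, neg_ne_zero]
  have hare : a.re = -k.im := by
    rw [ha, Complex.mul_re, Complex.sub_im, Complex.ofReal_im]
    simp
  cases σ with
  | plus =>
    simp only [Side.sgn, one_mul] at hk
    have : ∀ x : ℝ, Complex.exp (-(2 * Real.pi * x * η * Complex.I)) * jumpKernel .plus k x =
        (Ioi (0 : ℝ)).indicator (fun x : ℝ => Complex.I * Complex.exp (a * x)) x := by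
      intro x
      by_cases hx : 0 < x
      · simp only [jumpKernel, Side.sgn, one_mul, if_pos hx, indicator_of_mem (mem_Ioi.2 hx)]
        rw [Complex.ofReal_one, one_mul, mul_left_comm, ← Complex.exp_add, ha]
        congr 2
        push_cast
        ring
      · simp [jumpKernel, Side.sgn, hx]
    simp_rw [this]
    rw [integral_indicator measurableSet_Ioi, integral_const_mul,
      integral_exp_mul_complex_Ioi (by rw [hare]; linarith)]
    rw [ha] at hane ⊢
    have h2 := (mul_ne_zero_iff.1 hane).2
    simp only [Complex.ofReal_zero, mul_zero, Complex.exp_zero]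
    field_simp
    ring
  | minus =>
    simp only [Side.sgn] at hk
    have : ∀ᵐ x : ℝ, Complex.exp (-(2 * Real.pi * x * η * Complex.I)) * jumpKernel .minus k x =
        (Iic (0 : ℝ)).indicator (fun x : ℝ => -Complex.I * Complex.exp (a * x)) x := by
      filter_upwards [ae_ne_zero] with x hx0
      by_cases hx : x ≤ 0
      · have hx' : 0 < -1 * x := by
          have := lt_of_le_of_ne hx hx0
          linarith
        have e : jumpKernel .minus k x = -Complex.I * Complex.exp (Complex.I * k * x) := by
          rw [jumpKernel, if_pos (show 0 < Side.minus.sgn * x from hx')]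
          simp [Side.sgn]
        rw [e, indicator_of_mem (mem_Iic.2 hx), mul_left_comm, ← Complex.exp_add, ha]
        congr 2
        push_cast
        ring
      · have hx' : ¬ 0 < -1 * x := by linarith
        simp [jumpKernel, Side.sgn, hx, (not_le.1 hx).le]
    rw [integral_congr_ae this]
    rw [integral_indicator measurableSet_Iic, integral_const_mul,
      integral_exp_mul_complex_Iic (by rw [hare]; linarith)]
    rw [ha] at hane ⊢
    have h2 := (mul_ne_zero_iff.1 hane).2
    simp only [Complex.ofReal_zero, mul_zero, Complex.exp_zero]
    field_simp
    ring

theorem neg_mem_slitPlane_of_im {k : ℂ} (hk : k.im ≠ 0) : -k ∈ Complex.slitPlane := by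
  rw [Complex.mem_slitPlane_iff]
  right
  simpa using hk

theorem mem_slitPlane_of_re {k : ℂ} (hk : 0 < k.re) : - -k ∈ Complex.slitPlane := by
  rw [neg_neg, Complex.mem_slitPlane_iff]
  exact Or.inl hk

/-- The whole-line transform of 1/(2πη - k) is the jump kernel. Cutting the frequency integral at 0
and reflecting the negative half gives G_k(x) - G_{-k}(-x). For k near (0, ∞) the point -k is far
from the half line, so the reflected kernel ignores the cut. -/
theorem kernel_eq_jump_add {σ : Side} {k : ℂ} (hk : 0 < σ.sgn * k.im) {x : ℝ} (hx : x ≠ 0) :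
    kernel k x = jumpKernel σ k x + kernel (-k) (-x) := by
  have him : k.im ≠ 0 := fun h => by simp [h] at hk
  have hk1 : -k ∈ Complex.slitPlane := neg_mem_slitPlane_of_im him
  have hk2 : - -k ∈ Complex.slitPlane := neg_mem_slitPlane_of_im (by simpa using him)
  have hfull : MemLp (fun η : ℝ => 1 / (((2 * Real.pi * η : ℝ) : ℂ) - k)) 2 := by
    have := memLp_fourier (integrable_jumpKernel hk) (memLp_jumpKernel hk)
    rwa [funext (fourier_jumpKernel hk)] at this
  have h1 : (hfull.toLp _ : L2) = 𝓕 ((memLp_jumpKernel hk).toLp _) := by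
    refine Lp.ext ?_
    filter_upwards [hfull.coeFn_toLp,
      coeFn_fourier_toLp (integrable_jumpKernel hk) (memLp_jumpKernel hk)] with η h2 h3
    rw [h2, h3, fourier_jumpKernel hk]
  have h2 : (𝓕⁻ (hfull.toLp _) : L2) =ᵐ[volume] jumpKernel σ k := by
    rw [h1, FourierTransform.fourierInv_fourier_eq]
    exact (memLp_jumpKernel hk).coeFn_toLp
  have h3 : (𝓕⁻ (hfull.toLp _) : L2) =ᵐ[volume] fun x => kernel k x - kernel (-k) (-x) := by
    refine fourierInv_ae_eq_of_tendsto _ ?_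
    filter_upwards [ae_ne_zero] with x hx
    have t1 := (tendsto_kernel_scaled hk1 hx).sub
      (tendsto_kernel_scaled hk2 (x := -x) (neg_ne_zero.2 hx))
    refine t1.congr fun N => ?_
    have hc : Continuous fun η : ℝ => Complex.exp (2 * Real.pi * x * η * Complex.I) /
        (((2 * Real.pi * η : ℝ) : ℂ) - k) := by
      refine Continuous.div (by fun_prop) (by fun_prop) fun η h => ?_
      have h1 := congrArg Complex.im h
      rw [Complex.sub_im, Complex.ofReal_im, zero_sub, Complex.zero_im, neg_eq_zero] at h1
      exact him h1
    have h4 : ∫ η in (-(N : ℝ))..N, Complex.exp (2 * Real.pi * x * η * Complex.I) *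
        (hfull.toLp _) η = ∫ η in (-(N : ℝ))..N,
        Complex.exp (2 * Real.pi * x * η * Complex.I) / (((2 * Real.pi * η : ℝ) : ℂ) - k) := by
      refine intervalIntegral.integral_congr_ae ?_
      filter_upwards [hfull.coeFn_toLp] with η hη _
      rw [hη, mul_one_div]
    rw [h4, ← intervalIntegral.integral_add_adjacent_intervals (a := -(N : ℝ)) (b := 0) (c := N)
      (hc.intervalIntegrable _ _) (hc.intervalIntegrable _ _), sub_eq_add_neg, add_comm]
    congr 1
    have h5 := intervalIntegral.integral_comp_neg (a := 0) (b := N)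
      (fun η : ℝ => Complex.exp (2 * Real.pi * x * η * Complex.I) /
        (((2 * Real.pi * η : ℝ) : ℂ) - k))
    rw [neg_zero] at h5
    rw [← h5, ← intervalIntegral.integral_neg]
    refine intervalIntegral.integral_congr fun η _ => ?_
    rw [← div_neg]
    congr 1
    · congr 1
      push_cast
      ring
    · push_cast
      ring
  -- Both sides are continuous off 0, so almost everywhere equality becomes equality at each x ≠ 0.
  -- The pointwise form is needed for the limit defining `boundaryKernel`.
  have h4 : EqOn (fun x => kernel k x - kernel (-k) (-x)) (jumpKernel σ k) {0}ᶜ := by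
    refine Measure.eqOn_open_of_ae_eq (μ := volume) ((h3.symm.trans h2).filter_mono
      (ae_mono Measure.restrict_le_self)) isOpen_compl_singleton ?_ (continuousOn_jumpKernel σ k)
    refine (continuousOn_kernel hk1).sub ((continuousOn_kernel hk2).comp (by fun_prop) ?_)
    intro y hy
    simpa using hy
  have := h4 hx
  simp only at this
  linear_combination this

theorem boundaryKernel_eq {l : ℝ} (hl : 0 < l) (σ : Side) {x : ℝ} (hx : x ≠ 0) :
    boundaryKernel l σ x = jumpKernel σ l x + kernel (-l) (-x) := by
  refine Tendsto.limUnder_eq ?_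
  have hk2 : - -(l : ℂ) ∈ Complex.slitPlane := mem_slitPlane_of_re (by simpa using hl)
  have h0 : Tendsto (fun ε : ℝ => (l : ℂ) + σ.sgn * ε * Complex.I) (𝓝[>] 0) (𝓝 l) := by
    have : Continuous fun ε : ℝ => (l : ℂ) + σ.sgn * ε * Complex.I := by fun_prop
    have h := this.tendsto 0
    simp only [Complex.ofReal_zero, mul_zero, zero_mul, add_zero] at h
    exact h.mono_left nhdsWithin_le_nhds
  have h1 : Tendsto (fun ε : ℝ => jumpKernel σ ((l : ℂ) + σ.sgn * ε * Complex.I) x) (𝓝[>] 0)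
      (𝓝 (jumpKernel σ l x)) := by
    unfold jumpKernel
    split_ifs
    · have : Continuous fun k : ℂ => σ.sgn * Complex.I * Complex.exp (Complex.I * k * x) := by
        fun_prop
      exact (this.tendsto _).comp h0
    · exact tendsto_const_nhds
  have h2 := (tendsto_kernel hk2 (neg_ne_zero.2 hx)).comp (((continuous_neg.tendsto _).comp h0))
  refine (h1.add h2).congr' ?_
  filter_upwards [self_mem_nhdsWithin] with ε hε
  have hε' : 0 < ε := hε
  refine (kernel_eq_jump_add ?_ hx).symm
  have : ((l : ℂ) + σ.sgn * ε * Complex.I).im = σ.sgn * ε := by simp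
  rw [this, ← mul_assoc, σ.sgn_mul_self, one_mul]
  exact hε'

/-! ### The weight -/

theorem one_le_weight (x : ℝ) : 1 ≤ weight x := by
  unfold weight
  linarith [abs_nonneg x]

theorem weight_sub_le (x y : ℝ) : weight (x - y) ≤ weight x * weight y := by
  unfold weight
  nlinarith [abs_sub x y, abs_nonneg x, abs_nonneg y, mul_nonneg (abs_nonneg x) (abs_nonneg y)]

theorem weight_rpow_pos (x σ : ℝ) : 0 < weight x ^ σ := Real.rpow_pos_of_pos (weight_pos x) σ

/-! ### Weighted `L^∞` classes -/

/-- The Banach space `L^∞(ℝ)`. -/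
abbrev Linf := Lp ℂ ∞ (volume : Measure ℝ)

/-- Dictionary between L^∞ bounds after removal of the weight and growth bounds of order w^b. -/
theorem norm_weight_smul_le {b C x : ℝ} {z : ℂ} :
    ‖((weight x ^ (-b) : ℝ) : ℂ) * z‖ ≤ C ↔ ‖z‖ ≤ C * weight x ^ b := by
  rw [norm_mul, Complex.norm_real, Real.norm_of_nonneg (weight_rpow_pos x _).le,
    Real.rpow_neg (weight_pos x).le, inv_mul_le_iff₀ (weight_rpow_pos x b), mul_comm]

theorem Linf.norm_le_of_ae_bound {C : ℝ} (hC : 0 ≤ C) {f : Linf} (h : ∀ᵐ x, ‖f x‖ ≤ C) :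
    ‖f‖ ≤ C := by
  rw [Lp.norm_def, eLpNorm_exponent_top]
  exact ENNReal.toReal_le_of_le_ofReal hC (eLpNormEssSup_le_of_ae_bound h)

theorem Linf.ae_bound (f : Linf) : ∀ᵐ x, ‖f x‖ ≤ ‖f‖ := by
  have hfin : eLpNormEssSup f volume ≠ ⊤ := by
    have := (Lp.memLp f).eLpNorm_lt_top
    rw [eLpNorm_exponent_top] at this
    exact this.ne
  filter_upwards [enorm_ae_le_eLpNormEssSup f volume] with x hx
  have h2 := ENNReal.toReal_mono hfin hx
  rwa [toReal_enorm, ← eLpNorm_exponent_top, ← Lp.norm_def] at h2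

theorem memLp_weight_mul {b : ℝ} {f : ℝ → ℂ} (hf : AEStronglyMeasurable f volume)
    (h : ∃ C : ℝ, ∀ x, ‖f x‖ ≤ C * weight x ^ b) :
    MemLp (fun x => ((weight x ^ (-b) : ℝ) : ℂ) * f x) ∞ := by
  obtain ⟨C, h⟩ := h
  exact memLp_top_of_bound ((Complex.measurable_ofReal.comp
    (measurable_weight_rpow _)).aestronglyMeasurable.mul hf) C
      (ae_of_all _ fun x => norm_weight_smul_le.2 (h x))

/-- The class of `w^{-b} f` in `L^∞` for a function `f` of growth at most `w^b`. -/
def Linf.ofBound (b : ℝ) (f : ℝ → ℂ) (hf : AEStronglyMeasurable f volume)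
    (h : ∃ C : ℝ, ∀ x, ‖f x‖ ≤ C * weight x ^ b) : Linf :=
  (memLp_weight_mul hf h).toLp _

theorem Linf.coeFn_ofBound {b : ℝ} {f : ℝ → ℂ} (hf : AEStronglyMeasurable f volume)
    (h : ∃ C : ℝ, ∀ x, ‖f x‖ ≤ C * weight x ^ b) :
    (Linf.ofBound b f hf h : ℝ → ℂ) =ᵐ[volume] fun x => ((weight x ^ (-b) : ℝ) : ℂ) * f x :=
  (memLp_weight_mul hf h).coeFn_toLp

theorem Linf.norm_ofBound_le {b C : ℝ} (hC : 0 ≤ C) {f : ℝ → ℂ}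
    (hf : AEStronglyMeasurable f volume) (h : ∀ x, ‖f x‖ ≤ C * weight x ^ b) :
    ‖Linf.ofBound b f hf ⟨C, h⟩‖ ≤ C := by
  refine Linf.norm_le_of_ae_bound hC ?_
  filter_upwards [Linf.coeFn_ofBound hf ⟨C, h⟩] with x hx
  rw [hx]
  exact norm_weight_smul_le.2 (h x)

/-! ### Pairings in `L²` -/

theorem integral_mul_eq_inner {a : ℝ → ℂ} (ha : MemLp a 2) (F : L2) :
    ∫ y, a y * F y = inner ℂ (ha.star.toLp _) F := by
  rw [L2.inner_def]
  refine integral_congr_ae ?_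
  filter_upwards [ha.star.coeFn_toLp] with y hy
  rw [hy]
  simp [mul_comm]

theorem norm_integral_mul_le {a : ℝ → ℂ} (ha : MemLp a 2) (F : L2) :
    ‖∫ y, a y * F y‖ ≤ (eLpNorm a 2 volume).toReal * ‖F‖ := by
  rw [integral_mul_eq_inner ha F]
  refine (norm_inner_le_norm _ _).trans (le_of_eq ?_)
  rw [Lp.norm_toLp]
  congr 2
  exact eLpNorm_congr_norm_ae (ae_of_all _ fun x => by simp)

theorem integrable_mul_L2 {a : ℝ → ℂ} (ha : MemLp a 2) (F : L2) :
    Integrable fun y => a y * F y :=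
  ha.integrable_mul (Lp.memLp F)

/-- Dominated convergence in `L²`. -/
theorem tendsto_L2_of_dominated {F : ℕ → L2} {F₀ : L2} {g : ℝ → ℝ} (hg : MemLp g 2)
    (hb : ∀ n, ∀ᵐ x, ‖F n x‖ ≤ g x) (hb₀ : ∀ᵐ x, ‖F₀ x‖ ≤ g x)
    (hlim : ∀ᵐ x, Tendsto (fun n => F n x) atTop (𝓝 (F₀ x))) :
    Tendsto F atTop (𝓝 F₀) := by
  rw [Lp.tendsto_Lp_iff_tendsto_eLpNorm']
  have key : Tendsto (fun n : ℕ => ∫⁻ x, ‖F n x - F₀ x‖ₑ ^ (2 : ℝ))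
      atTop (𝓝 (∫⁻ _ : ℝ, 0)) := by
    refine tendsto_lintegral_of_dominated_convergence' (fun x => ‖2 * g x‖ₑ ^ (2 : ℝ)) ?_ ?_ ?_ ?_
    · intro n
      exact (((Lp.aestronglyMeasurable _).sub (Lp.aestronglyMeasurable _)).enorm).pow_const _
    · intro n
      filter_upwards [hb n, hb₀] with x h1 h2
      gcongr
      rw [enorm_le_iff_norm_le]
      calc ‖F n x - F₀ x‖ ≤ ‖F n x‖ + ‖F₀ x‖ := norm_sub_le _ _
        _ ≤ 2 * g x := by linarith
        _ ≤ ‖2 * g x‖ := Real.le_norm_self _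
    · have := (hg.const_mul 2).eLpNorm_lt_top
      have h3 := lintegral_rpow_enorm_lt_top_of_eLpNorm_lt_top (by norm_num) (by norm_num) this
      simpa using h3.ne
    · filter_upwards [hlim] with x hx
      have h1 : Tendsto (fun n => ‖F n x - F₀ x‖ₑ) atTop (𝓝 0) := by
        have := (hx.sub_const (F₀ x)).enorm
        simpa using this
      have := h1.ennrpow_const (2 : ℝ)
      simpa using this
  have h5 : ∀ n : ℕ, eLpNorm (⇑(F n) - ⇑F₀) 2 volume =
      (∫⁻ x, ‖F n x - F₀ x‖ₑ ^ (2 : ℝ)) ^ (1 / (2 : ℝ)) := by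
    intro n
    rw [eLpNorm_eq_lintegral_rpow_enorm_toReal (by norm_num) (by norm_num)]
    simp
  simp_rw [h5]
  have := key.ennrpow_const (1 / (2 : ℝ))
  simpa using this

/-- An operator on a separable Hilbert space that maps weakly convergent sequences to norm
convergent ones is compact. -/
theorem isCompactOperator_of_weak_to_strong {H E : Type*} [NormedAddCommGroup H]
    [InnerProductSpace ℂ H] [CompleteSpace H] [TopologicalSpace.SeparableSpace H]
    [NormedAddCommGroup E] [NormedSpace ℂ E] (T : H →L[ℂ] E)
    (hT : ∀ (F : ℕ → H) (F₀ : H), (∀ n, ‖F n‖ ≤ 1) → ‖F₀‖ ≤ 1 →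
      (∀ h : H, Tendsto (fun n => inner ℂ h (F n)) atTop (𝓝 (inner ℂ h F₀))) →
      Tendsto (fun n => T (F n)) atTop (𝓝 (T F₀))) : IsCompactOperator T := by
  refine (isCompactOperator_iff_image_closedBall_subset_compact (T : H →ₗ[ℂ] E) one_pos).2
    ⟨T '' Metric.closedBall 0 1, ?_, subset_rfl⟩
  rw [isCompact_iff_isSeqCompact]
  intro y hy
  choose F hF hFy using hy
  have hF' : ∀ n, ‖F n‖ ≤ 1 := fun n => by simpa using hF n
  -- Riesz representation places the sequence in the dual ball, where separability of H makes the
  -- Banach–Alaoglu theorem sequential.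
  let φ : ℕ → WeakDual ℂ H := fun n =>
    StrongDual.toWeakDual (InnerProductSpace.toDual ℂ H (F n))
  have hφ : ∀ n, φ n ∈ WeakDual.toStrongDual ⁻¹' Metric.closedBall (0 : StrongDual ℂ H) 1 := by
    intro n
    simp only [mem_preimage, mem_closedBall_zero_iff]
    change ‖InnerProductSpace.toDual ℂ H (F n)‖ ≤ 1
    rw [LinearIsometryEquiv.norm_map]
    exact hF' n
  obtain ⟨φ₀, hφ₀, ns, hns, hlim⟩ := WeakDual.isSeqCompact_closedBall ℂ H 0 1 hφ
  set F₀ : H := (InnerProductSpace.toDual ℂ H).symm (WeakDual.toStrongDual φ₀) with hF₀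
  have hF₀n : ‖F₀‖ ≤ 1 := by
    rw [hF₀, LinearIsometryEquiv.norm_map]
    simpa using hφ₀
  refine ⟨T F₀, ⟨F₀, by simpa using hF₀n, rfl⟩, ns, hns, ?_⟩
  have hw : ∀ h : H, Tendsto (fun n => inner ℂ h (F (ns n))) atTop (𝓝 (inner ℂ h F₀)) := by
    intro h
    have h1 : Tendsto (fun n => φ (ns n) h) atTop (𝓝 (φ₀ h)) :=
      ((WeakDual.eval_continuous h).tendsto φ₀).comp hlim
    have h2 : φ₀ h = inner ℂ F₀ h := by
      rw [hF₀, InnerProductSpace.toDual_symm_apply]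
      rfl
    have h3 : ∀ n, φ (ns n) h = inner ℂ (F (ns n)) h := fun n => rfl
    simp_rw [h2, h3] at h1
    have h4 := (Complex.continuous_conj.tendsto _).comp h1
    simpa [Function.comp_def] using h4
  have := hT (fun n => F (ns n)) F₀ (fun n => hF' _) hF₀n hw
  refine this.congr fun n => ?_
  exact hFy (ns n)

/-! ### Weighted convolution operators -/

/-- The kernel `G` maps `w^{-s₁} L²` to functions of growth `w^b` under convolution. -/
structure AdmissibleKernel (s₁ b C : ℝ) (G : ℝ → ℂ) : Prop where
  nonneg : 0 ≤ C
  meas : AEStronglyMeasurable G volume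
  bound : ∀ x, eLpNorm (fun y => (weight y ^ (-s₁) : ℝ) * G (x - y)) 2 volume ≤
    ENNReal.ofReal (C * weight x ^ b)

/-- The convolution of `G` with `w^{-s₁} F`. -/
def weightedConv (s₁ : ℝ) (G F : ℝ → ℂ) (x : ℝ) : ℂ :=
  ∫ y, (weight y ^ (-s₁) : ℝ) * G (x - y) * F y

section Kernels

variable {s₁ b C : ℝ} {G : ℝ → ℂ}

theorem AEStronglyMeasurable.reflect_translate (hG : AEStronglyMeasurable G volume) (x : ℝ) :
    AEStronglyMeasurable (fun y => G (x - y)) volume :=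
  hG.comp_measurePreserving (Measure.measurePreserving_sub_left volume x)

theorem AdmissibleKernel.memLp (h : AdmissibleKernel s₁ b C G) (x : ℝ) :
    MemLp (fun y => ((weight y ^ (-s₁) : ℝ) : ℂ) * G (x - y)) 2 :=
  ⟨(Complex.measurable_ofReal.comp (measurable_weight_rpow _)).aestronglyMeasurable.mul
    (AEStronglyMeasurable.reflect_translate h.meas x), (h.bound x).trans_lt ENNReal.ofReal_lt_top⟩

theorem AdmissibleKernel.norm_weightedConv_le (h : AdmissibleKernel s₁ b C G) (F : L2) (x : ℝ) :
    ‖weightedConv s₁ G F x‖ ≤ C * ‖F‖ * weight x ^ b := by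
  refine (norm_integral_mul_le (h.memLp x) F).trans ?_
  have h1 := ENNReal.toReal_le_of_le_ofReal
    (mul_nonneg h.nonneg (weight_rpow_pos x b).le) (h.bound x)
  calc _ ≤ C * weight x ^ b * ‖F‖ := by gcongr
    _ = _ := by ring

theorem AdmissibleKernel.integrable (h : AdmissibleKernel s₁ b C G) (F : L2) (x : ℝ) :
    Integrable fun y => (weight y ^ (-s₁) : ℝ) * G (x - y) * F y :=
  integrable_mul_L2 (h.memLp x) F

/-- Measurability of x ↦ ∫ is taken from the product-measurable convolution integrand, as the
pointwise definition of `weightedConv` does not give it. -/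
theorem aestronglyMeasurable_weightedConv (hG : AEStronglyMeasurable G volume) (F : L2) :
    AEStronglyMeasurable (weightedConv s₁ G F) volume := by
  have h1 : AEStronglyMeasurable (fun y => ((weight y ^ (-s₁) : ℝ) : ℂ) * F y) volume :=
    (Complex.measurable_ofReal.comp (measurable_weight_rpow _)).aestronglyMeasurable.mul
      (Lp.aestronglyMeasurable F)
  have h2 := (AEStronglyMeasurable.convolution_integrand (ContinuousLinearMap.mul ℂ ℂ)
    h1 hG (μ := volume)).integral_prod_right'
  refine h2.congr (ae_of_all _ fun x => ?_)
  refine integral_congr_ae (ae_of_all _ fun y => ?_)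
  simp only [ContinuousLinearMap.mul_apply']
  ring

theorem AdmissibleKernel.weightedConv_add (h : AdmissibleKernel s₁ b C G) (F F' : L2) (x : ℝ) :
    weightedConv s₁ G (F + F' : L2) x = weightedConv s₁ G F x + weightedConv s₁ G F' x := by
  unfold weightedConv
  rw [← integral_add (h.integrable F x) (h.integrable F' x)]
  refine integral_congr_ae ?_
  filter_upwards [Lp.coeFn_add F F'] with y hy
  rw [hy, Pi.add_apply, mul_add]

theorem weightedConv_smul (c : ℂ) (F : L2) (x : ℝ) :
    weightedConv s₁ G (c • F : L2) x = c * weightedConv s₁ G F x := by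
  unfold weightedConv
  rw [← integral_const_mul]
  refine integral_congr_ae ?_
  filter_upwards [Lp.coeFn_smul c F] with y hy
  rw [hy, Pi.smul_apply, smul_eq_mul]
  ring

theorem AdmissibleKernel.exists_bound (h : AdmissibleKernel s₁ b C G) (F : L2) :
    ∃ C : ℝ, ∀ x, ‖weightedConv s₁ G F x‖ ≤ C * weight x ^ b :=
  ⟨_, h.norm_weightedConv_le F⟩

/-- The bounded operator `F ↦ w^{-b} (G * (w^{-s₁} F))` from `L²` to `L^∞` (zero if `G` is not
admissible). -/
def convOp (s₁ b : ℝ) (G : ℝ → ℂ) : L2 →L[ℂ] Linf := by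
  classical
  -- The constant chosen here only witnesses boundedness; the operator does not depend on it, and
  -- `norm_convOp_le` holds for every admissible C.
  exact if h : ∃ C, AdmissibleKernel s₁ b C G then
    LinearMap.mkContinuous
      { toFun := fun F => Linf.ofBound b (weightedConv s₁ G F)
          (aestronglyMeasurable_weightedConv h.choose_spec.meas F) (h.choose_spec.exists_bound F)
        map_add' := fun F F' => by
          refine Lp.ext ?_
          filter_upwards [Linf.coeFn_ofBound
              (aestronglyMeasurable_weightedConv h.choose_spec.meas (F + F'))
              (h.choose_spec.exists_bound (F + F')),
            Linf.coeFn_ofBound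
              (aestronglyMeasurable_weightedConv h.choose_spec.meas F)
              (h.choose_spec.exists_bound F),
            Linf.coeFn_ofBound
              (aestronglyMeasurable_weightedConv h.choose_spec.meas F')
              (h.choose_spec.exists_bound F'),
            Lp.coeFn_add
              (Linf.ofBound b (weightedConv s₁ G F)
                (aestronglyMeasurable_weightedConv h.choose_spec.meas F)
                (h.choose_spec.exists_bound F))
              (Linf.ofBound b (weightedConv s₁ G F')
                (aestronglyMeasurable_weightedConv h.choose_spec.meas F')
                (h.choose_spec.exists_bound F'))] with x h1 h2 h3 h4
          rw [h1, h4, Pi.add_apply, h2, h3, h.choose_spec.weightedConv_add, mul_add]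
        map_smul' := fun c F => by
          refine Lp.ext ?_
          filter_upwards [Linf.coeFn_ofBound
              (aestronglyMeasurable_weightedConv h.choose_spec.meas (c • F))
              (h.choose_spec.exists_bound (c • F)),
            Linf.coeFn_ofBound
              (aestronglyMeasurable_weightedConv h.choose_spec.meas F)
              (h.choose_spec.exists_bound F),
            Lp.coeFn_smul c
              (Linf.ofBound b (weightedConv s₁ G F)
                (aestronglyMeasurable_weightedConv h.choose_spec.meas F)
                (h.choose_spec.exists_bound F))] with x h1 h2 h3
          rw [h1, RingHom.id_apply, h3, Pi.smul_apply, h2, weightedConv_smul, smul_eq_mul,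
            mul_left_comm] }
      h.choose fun F => Linf.norm_ofBound_le
          (mul_nonneg h.choose_spec.nonneg (norm_nonneg F))
          (aestronglyMeasurable_weightedConv h.choose_spec.meas F)
          (h.choose_spec.norm_weightedConv_le F)
  else 0

theorem AdmissibleKernel.coeFn_convOp (h : AdmissibleKernel s₁ b C G) (F : L2) :
    (convOp s₁ b G F : ℝ → ℂ) =ᵐ[volume]
      fun x => ((weight x ^ (-b) : ℝ) : ℂ) * weightedConv s₁ G F x := by
  have h' : ∃ C, AdmissibleKernel s₁ b C G := ⟨C, h⟩
  rw [convOp, dif_pos h']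
  exact Linf.coeFn_ofBound (aestronglyMeasurable_weightedConv h'.choose_spec.meas F)
    (h'.choose_spec.exists_bound F)

theorem AdmissibleKernel.norm_convOp_le (h : AdmissibleKernel s₁ b C G) :
    ‖convOp s₁ b G‖ ≤ C := by
  refine ContinuousLinearMap.opNorm_le_bound _ h.nonneg fun F => ?_
  refine Linf.norm_le_of_ae_bound (mul_nonneg h.nonneg (norm_nonneg F)) ?_
  filter_upwards [h.coeFn_convOp F] with x hx
  rw [hx]
  exact norm_weight_smul_le.2 (h.norm_weightedConv_le F x)

theorem weightedConv_congr_ae {G' : ℝ → ℂ} (h : G =ᵐ[volume] G') (F : ℝ → ℂ) (x : ℝ) :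
    weightedConv s₁ G F x = weightedConv s₁ G' F x := by
  refine integral_congr_ae ?_
  have := (Measure.measurePreserving_sub_left volume x).quasiMeasurePreserving.ae_eq_comp h
  filter_upwards [this] with y hy
  simp only [Function.comp_apply] at hy
  rw [hy]

theorem AdmissibleKernel.congr_ae {G' : ℝ → ℂ} (h : AdmissibleKernel s₁ b C G)
    (h' : G =ᵐ[volume] G') : AdmissibleKernel s₁ b C G' where
  nonneg := h.nonneg
  meas := h.meas.congr h'
  bound x := by
    refine le_of_eq_of_le (eLpNorm_congr_ae ?_) (h.bound x)
    have := (Measure.measurePreserving_sub_left volume x).quasiMeasurePreserving.ae_eq_comp h'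
    filter_upwards [this] with y hy
    simp only [Function.comp_apply] at hy
    rw [hy]

theorem AdmissibleKernel.convOp_congr_ae {G' : ℝ → ℂ} (h : AdmissibleKernel s₁ b C G)
    (h' : G =ᵐ[volume] G') : convOp s₁ b G = convOp s₁ b G' := by
  ext1 F
  refine Lp.ext ?_
  filter_upwards [h.coeFn_convOp F, (h.congr_ae h').coeFn_convOp F] with x h1 h2
  rw [h1, h2, weightedConv_congr_ae h']

theorem AdmissibleKernel.add {C' : ℝ} {G' : ℝ → ℂ} (h : AdmissibleKernel s₁ b C G)
    (h' : AdmissibleKernel s₁ b C' G') : AdmissibleKernel s₁ b (C + C') (fun x => G x + G' x) where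
  nonneg := add_nonneg h.nonneg h'.nonneg
  meas := h.meas.add h'.meas
  bound x := by
    have h0 := weight_rpow_pos x b
    rw [add_mul, ENNReal.ofReal_add (mul_nonneg h.nonneg h0.le) (mul_nonneg h'.nonneg h0.le)]
    refine le_trans ?_ (add_le_add (h.bound x) (h'.bound x))
    refine le_of_eq_of_le ?_ (eLpNorm_add_le (h.memLp x).1 (h'.memLp x).1 (by norm_num))
    congr 1
    ext y
    simp only [Pi.add_apply]
    ring

theorem AdmissibleKernel.smul (h : AdmissibleKernel s₁ b C G) (c : ℂ) :
    AdmissibleKernel s₁ b (‖c‖ * C) (fun x => c * G x) where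
  nonneg := mul_nonneg (norm_nonneg c) h.nonneg
  meas := h.meas.const_mul c
  bound x := by
    rw [mul_assoc, ENNReal.ofReal_mul (norm_nonneg c), ofReal_norm]
    refine le_trans (le_of_eq ?_) (mul_le_mul_right (h.bound x) _)
    rw [← eLpNorm_const_smul]
    congr 1
    ext y
    simp only [Pi.smul_apply, smul_eq_mul]
    ring

theorem AdmissibleKernel.convOp_add {C' : ℝ} {G' : ℝ → ℂ} (h : AdmissibleKernel s₁ b C G)
    (h' : AdmissibleKernel s₁ b C' G') :
    convOp s₁ b (fun x => G x + G' x) = convOp s₁ b G + convOp s₁ b G' := by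
  ext1 F
  refine Lp.ext ?_
  rw [add_apply]
  filter_upwards [h.coeFn_convOp F, h'.coeFn_convOp F, (h.add h').coeFn_convOp F,
    Lp.coeFn_add (convOp s₁ b G F) (convOp s₁ b G' F)] with x h1 h2 h3 h4
  rw [h3, h4, Pi.add_apply, h1, h2, ← mul_add]
  congr 1
  unfold weightedConv
  rw [← integral_add (h.integrable F x) (h'.integrable F x)]
  congr 1
  ext y
  ring

theorem AdmissibleKernel.convOp_smul (h : AdmissibleKernel s₁ b C G) (c : ℂ) :
    convOp s₁ b (fun x => c * G x) = c • convOp s₁ b G := by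
  ext1 F
  refine Lp.ext ?_
  rw [smul_apply]
  filter_upwards [h.coeFn_convOp F, (h.smul c).coeFn_convOp F,
    Lp.coeFn_smul c (convOp s₁ b G F)] with x h1 h2 h3
  rw [h2, h3, Pi.smul_apply, h1, smul_eq_mul, mul_left_comm]
  congr 1
  unfold weightedConv
  rw [← integral_const_mul]
  congr 1
  ext y
  ring

theorem AdmissibleKernel.convOp_sub {C' : ℝ} {G' : ℝ → ℂ} (h : AdmissibleKernel s₁ b C G)
    (h' : AdmissibleKernel s₁ b C' G') :
    convOp s₁ b (fun x => G x - G' x) = convOp s₁ b G - convOp s₁ b G' := by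
  have h1 := h.convOp_add (h'.smul (-1))
  rw [h'.convOp_smul] at h1
  simp only [neg_one_mul, neg_smul, one_smul, ← sub_eq_add_neg] at h1
  exact h1

end Kernels

instance : TopologicalSpace.SeparableSpace L2 := by
  have : Fact ((2 : ℝ≥0∞) ≠ ∞) := ⟨by norm_num⟩
  infer_instance

/-! ### Multiplication operators and compactness -/

theorem memLp_mul_Linf {v : ℝ → ℝ} (hv : MemLp v 2) (n : Linf) :
    MemLp (fun x => (v x : ℂ) * n x) 2 :=
  (Lp.memLp n).mul (p := 2) (q := ∞) (r := 2) hv.ofReal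

/-- Multiplication by `v ∈ L²`, from `L^∞` to `L²`. -/
def mulOp {v : ℝ → ℝ} (hv : MemLp v 2) : Linf →L[ℂ] L2 :=
  LinearMap.mkContinuous
    { toFun := fun n => (memLp_mul_Linf hv n).toLp _
      map_add' := fun n n' => by
        refine Lp.ext ?_
        filter_upwards [(memLp_mul_Linf hv (n + n')).coeFn_toLp, (memLp_mul_Linf hv n).coeFn_toLp,
          (memLp_mul_Linf hv n').coeFn_toLp, Lp.coeFn_add n n',
          Lp.coeFn_add ((memLp_mul_Linf hv n).toLp _) ((memLp_mul_Linf hv n').toLp _)]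
          with x h1 h2 h3 h4 h5
        rw [h1, h5, Pi.add_apply, h2, h3, h4, Pi.add_apply, mul_add]
      map_smul' := fun c n => by
        refine Lp.ext ?_
        filter_upwards [(memLp_mul_Linf hv (c • n)).coeFn_toLp, (memLp_mul_Linf hv n).coeFn_toLp,
          Lp.coeFn_smul c n, Lp.coeFn_smul c ((memLp_mul_Linf hv n).toLp _)] with x h1 h2 h3 h4
        rw [h1, RingHom.id_apply, h4, Pi.smul_apply, h2, h3, Pi.smul_apply, smul_eq_mul,
          smul_eq_mul, mul_left_comm] }
    ‖hv.toLp v‖ fun n => by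
      rw [mul_comm]
      refine Lp.norm_le_mul_norm_of_ae_le_mul ?_
      filter_upwards [(memLp_mul_Linf hv n).coeFn_toLp, hv.coeFn_toLp, Linf.ae_bound n]
        with x h1 h2 h3
      refine (congrArg norm h1).trans_le ?_
      rw [h2, norm_mul, Complex.norm_real, mul_comm]
      gcongr

theorem coeFn_mulOp {v : ℝ → ℝ} (hv : MemLp v 2) (n : Linf) :
    (mulOp hv n : ℝ → ℂ) =ᵐ[volume] fun x => (v x : ℂ) * n x :=
  (memLp_mul_Linf hv n).coeFn_toLp

/-- For each x the value of the convolution is an inner product of F with a fixed L² function, so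
weakly convergent F give pointwise convergence. Multiplication by v supplies the dominating function
C |v| ∈ L², and dominated convergence makes the convergence strong. -/
theorem AdmissibleKernel.isCompactOperator {s₁ b C : ℝ} {G : ℝ → ℂ}
    (h : AdmissibleKernel s₁ b C G) {v : ℝ → ℝ} (hv : MemLp v 2) :
    IsCompactOperator (mulOp hv ∘L convOp s₁ b G) := by
  refine isCompactOperator_of_weak_to_strong _ fun F F₀ hF hF₀ hw => ?_
  have hcoe : ∀ F : L2, ((mulOp hv ∘L convOp s₁ b G) F : ℝ → ℂ) =ᵐ[volume]
      fun x => (v x : ℂ) * (((weight x ^ (-b) : ℝ) : ℂ) * weightedConv s₁ G F x) := by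
    intro F
    filter_upwards [coeFn_mulOp hv (convOp s₁ b G F), h.coeFn_convOp F] with x h1 h2
    rw [ContinuousLinearMap.comp_apply, h1, h2]
  have hbd : ∀ F : L2, ‖F‖ ≤ 1 → ∀ᵐ x, ‖((mulOp hv ∘L convOp s₁ b G) F) x‖ ≤ C * ‖v x‖ := by
    intro F hF
    filter_upwards [hcoe F] with x hx
    rw [hx, norm_mul, Complex.norm_real, mul_comm]
    gcongr
    refine norm_weight_smul_le.2 ((h.norm_weightedConv_le F x).trans ?_)
    have := weight_rpow_pos x b
    have := h.nonneg
    gcongr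
    nlinarith
  refine tendsto_L2_of_dominated (hv.norm.const_mul C) (fun n => hbd _ (hF n)) (hbd _ hF₀) ?_
  have hall : ∀ᵐ x, ∀ n, ((mulOp hv ∘L convOp s₁ b G) (F n)) x =
      (v x : ℂ) * (((weight x ^ (-b) : ℝ) : ℂ) * weightedConv s₁ G (F n) x) :=
    ae_all_iff.2 fun n => hcoe (F n)
  filter_upwards [hall, hcoe F₀] with x h1 h2
  rw [h2]
  simp_rw [h1]
  refine Tendsto.const_mul _ (Tendsto.const_mul _ ?_)
  unfold weightedConv
  have e : ∀ F : L2, ∫ y, (weight y ^ (-s₁) : ℝ) * G (x - y) * F y =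
      inner ℂ ((h.memLp x).star.toLp _) F := fun F => integral_mul_eq_inner (h.memLp x) F
  simp_rw [e]
  exact hw _

/-! ### The Fredholm alternative -/

/-- Fredholm alternative at the spectral value 1: if 1 is not an eigenvalue of a compact operator,
it lies in the resolvent set. -/
theorem isUnit_one_sub_of_compact {T : L2 →L[ℂ] L2} (hT : IsCompactOperator T)
    (hinj : ∀ F, T F = F → F = 0) : IsUnit (1 - T) := by
  rcases hT.hasEigenvalue_or_mem_resolventSet one_ne_zero with h | h
  · obtain ⟨F, hF⟩ := h.exists_hasEigenvector
    exact absurd (hinj F (by simpa using hF.apply_eq_smul)) hF.2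
  · simpa [resolventSet] using h

/-- The solution of `n = g + A M n`, as a function of `A` and `g`. -/
def fredholmSol (M : Linf →L[ℂ] L2) (p : (L2 →L[ℂ] Linf) × Linf) : Linf :=
  p.2 + p.1 (Ring.inverse (1 - M ∘L p.1) (M p.2))

theorem fredholmSol_eq {M : Linf →L[ℂ] L2} {A : L2 →L[ℂ] Linf} {g : Linf}
    (hu : IsUnit (1 - M ∘L A)) :
    fredholmSol M (A, g) = g + A (M (fredholmSol M (A, g))) := by
  have h1 : (1 - M ∘L A) * Ring.inverse (1 - M ∘L A) = 1 := Ring.mul_inverse_cancel _ hu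
  have h2 : Ring.inverse (1 - M ∘L A) (M g) - M (A (Ring.inverse (1 - M ∘L A) (M g))) = M g :=
    congrArg (fun T : L2 →L[ℂ] L2 => T (M g)) h1
  have h3 : M (fredholmSol M (A, g)) = Ring.inverse (1 - M ∘L A) (M g) := by
    rw [fredholmSol, map_add]
    exact (sub_eq_iff_eq_add.1 h2).symm
  rw [h3]
  rfl

/-- Applying M to the equation gives (1 - M A)(M n) = M g on L², which determines M n and then n = g
+ A (M n). -/
theorem eq_fredholmSol {M : Linf →L[ℂ] L2} {A : L2 →L[ℂ] Linf} {g n : Linf}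
    (hu : IsUnit (1 - M ∘L A)) (hn : n = g + A (M n)) : n = fredholmSol M (A, g) := by
  have h1 : Ring.inverse (1 - M ∘L A) * (1 - M ∘L A) = 1 := Ring.inverse_mul_cancel _ hu
  have h2 : Ring.inverse (1 - M ∘L A) (M n - M (A (M n))) = M n :=
    congrArg (fun T : L2 →L[ℂ] L2 => T (M n)) h1
  have h3 : M n - M (A (M n)) = M g := by
    rw [← map_sub]
    congr 1
    rw [sub_eq_iff_eq_add]
    exact hn
  rw [h3] at h2
  rw [fredholmSol, h2]
  exact hn

theorem analyticAt_clm_apply {P E F : Type*} [NormedAddCommGroup P] [NormedSpace ℂ P]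
    [NormedAddCommGroup E] [NormedSpace ℂ E] [NormedAddCommGroup F] [NormedSpace ℂ F]
    {T : P → E →L[ℂ] F} {x : P → E} {p : P} (hT : AnalyticAt ℂ T p) (hx : AnalyticAt ℂ x p) :
    AnalyticAt ℂ (fun q => T q (x q)) p :=
  ((ContinuousLinearMap.id ℂ (E →L[ℂ] F)).analyticAt_bilinear (T p, x p)).comp₂ hT hx

/-- Inversion is analytic at units of a Banach algebra. Joint analyticity in operator and datum lets
the plane wave vary together with the kernel. -/
theorem analyticAt_fredholmSol {M : Linf →L[ℂ] L2} {A : L2 →L[ℂ] Linf} {g : Linf}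
    (hu : IsUnit (1 - M ∘L A)) : AnalyticAt ℂ (fredholmSol M) (A, g) := by
  have h1 : AnalyticAt ℂ (fun p : (L2 →L[ℂ] Linf) × Linf => (1 : L2 →L[ℂ] L2) - M ∘L p.1) (A, g) :=
    analyticAt_const.sub
      (((ContinuousLinearMap.compL ℂ L2 Linf L2 M).analyticAt A).comp_of_eq analyticAt_fst rfl)
  have h2 : AnalyticAt ℂ (fun p : (L2 →L[ℂ] Linf) × Linf =>
      Ring.inverse ((1 : L2 →L[ℂ] L2) - M ∘L p.1)) (A, g) :=
    (analyticAt_inverse (𝕜 := ℂ) hu.unit).comp_of_eq h1 rfl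
  have h3 : AnalyticAt ℂ (fun p : (L2 →L[ℂ] Linf) × Linf => M p.2) (A, g) :=
    (M.analyticAt g).comp_of_eq analyticAt_snd rfl
  exact analyticAt_snd.add (analyticAt_clm_apply analyticAt_fst (analyticAt_clm_apply h2 h3))

/-! ### Examples of admissible kernels -/

theorem memLp_weight_rpow {σ : ℝ} (hσ : 1 / 2 < σ) : MemLp (fun y => weight y ^ (-σ)) 2 := by
  rw [memLp_two_iff_integrable_sq (measurable_weight_rpow _).aestronglyMeasurable]
  have h := integrable_one_add_norm (E := ℝ) (μ := volume) (r := 2 * σ) (by simp; linarith)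
  refine h.congr (ae_of_all _ fun y => ?_)
  simp only [weight]
  rw [← Real.rpow_natCast, ← Real.rpow_mul (by positivity), Real.norm_eq_abs]
  congr 1
  push_cast
  ring

theorem weight_rpow_le_one {σ : ℝ} (hσ : 0 ≤ σ) (y : ℝ) : weight y ^ (-σ) ≤ 1 :=
  Real.rpow_le_one_of_one_le_of_nonpos (one_le_weight y) (by linarith)

/-- A translate of G has the same L² norm and w^{-s₁} ≤ 1, so the bound is uniform in x and any b ≥
0 is allowed. -/
theorem admissibleKernel_of_memLp {s₁ b : ℝ} (hs : 0 ≤ s₁) (hb : 0 ≤ b) {G : ℝ → ℂ}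
    (hG : MemLp G 2) : AdmissibleKernel s₁ b (eLpNorm G 2 volume).toReal G where
  nonneg := ENNReal.toReal_nonneg
  meas := hG.1
  bound x := by
    have h1 : eLpNorm (fun y => G (x - y)) 2 volume = eLpNorm G 2 volume :=
      eLpNorm_comp_measurePreserving hG.1 (Measure.measurePreserving_sub_left volume x)
    have h2 : eLpNorm G 2 volume = ENNReal.ofReal (eLpNorm G 2 volume).toReal :=
      (ENNReal.ofReal_toReal hG.2.ne).symm
    calc eLpNorm (fun y => (weight y ^ (-s₁) : ℝ) * G (x - y)) 2 volume
        ≤ eLpNorm (fun y => G (x - y)) 2 volume := by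
          refine eLpNorm_mono fun y => ?_
          rw [norm_mul, Complex.norm_real, Real.norm_of_nonneg (weight_rpow_pos y _).le]
          exact mul_le_of_le_one_left (norm_nonneg _) (weight_rpow_le_one hs y)
      _ = ENNReal.ofReal (eLpNorm G 2 volume).toReal := by rw [h1, ← h2]
      _ ≤ _ := by
          refine ENNReal.ofReal_le_ofReal (le_mul_of_one_le_right ENNReal.toReal_nonneg ?_)
          exact Real.one_le_rpow (one_le_weight x) hb

/-- Submultiplicativity w(x - y)^β ≤ w(x)^β w(y)^β separates the variables; what is left in y is
w^{-(s₁-β)}, square integrable exactly because s₁ - β > 1/2. This is for kernels that do not decay.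
-/
theorem admissibleKernel_of_growth {s₁ b β D : ℝ} (hβ : 0 ≤ β) (hβs : 1 / 2 < s₁ - β)
    (hβb : β ≤ b) (hD : 0 ≤ D) {G : ℝ → ℂ} (hG : AEStronglyMeasurable G volume)
    (hbd : ∀ x, ‖G x‖ ≤ D * weight x ^ β) :
    AdmissibleKernel s₁ b (D * (eLpNorm (fun y => weight y ^ (-(s₁ - β))) 2 volume).toReal) G where
  nonneg := mul_nonneg hD ENNReal.toReal_nonneg
  meas := hG
  bound x := by
    have hfin := (memLp_weight_rpow hβs).2.ne
    have hxb : weight x ^ β ≤ weight x ^ b :=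
      Real.rpow_le_rpow_of_exponent_le (one_le_weight x) hβb
    have h0 := (weight_rpow_pos x b).le
    calc eLpNorm (fun y => (weight y ^ (-s₁) : ℝ) * G (x - y)) 2 volume
        ≤ eLpNorm (fun y => (D * weight x ^ b) * weight y ^ (-(s₁ - β))) 2 volume := by
          refine eLpNorm_mono_real fun y => ?_
          rw [norm_mul, Complex.norm_real, Real.norm_of_nonneg (weight_rpow_pos y _).le]
          have hy := (weight_rpow_pos y (-s₁)).le
          have h1 : weight (x - y) ^ β ≤ weight x ^ b * weight y ^ β := by
            calc weight (x - y) ^ β ≤ (weight x * weight y) ^ β :=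
                  Real.rpow_le_rpow (weight_pos _).le (weight_sub_le x y) hβ
              _ = weight x ^ β * weight y ^ β :=
                  Real.mul_rpow (weight_pos _).le (weight_pos _).le
              _ ≤ _ := mul_le_mul_of_nonneg_right hxb (weight_rpow_pos y β).le
          calc weight y ^ (-s₁) * ‖G (x - y)‖
              ≤ weight y ^ (-s₁) * (D * (weight x ^ b * weight y ^ β)) := by
                gcongr
                exact (hbd _).trans (by gcongr)
            _ = (D * weight x ^ b) * (weight y ^ (-s₁) * weight y ^ β) := by ring
            _ = _ := by
                rw [← Real.rpow_add (weight_pos y)]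
                congr 2
                ring
      _ = ENNReal.ofReal (D * weight x ^ b) *
            eLpNorm (fun y => weight y ^ (-(s₁ - β))) 2 volume := by
          have := eLpNorm_const_smul (μ := volume) (p := 2) (D * weight x ^ b)
            (fun y => weight y ^ (-(s₁ - β)))
          rw [← Real.enorm_of_nonneg (mul_nonneg hD h0), ← this]
          rfl
      _ = _ := by
          rw [← ENNReal.ofReal_toReal hfin, ← ENNReal.ofReal_mul (mul_nonneg hD h0),
            ENNReal.toReal_ofReal ENNReal.toReal_nonneg]
          congr 1
          ring

/-- `convOp` as a bounded linear function of a kernel in `L²`. -/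
def convOpL2 {s₁ b : ℝ} (hs : 0 ≤ s₁) (hb : 0 ≤ b) : L2 →L[ℂ] (L2 →L[ℂ] Linf) :=
  LinearMap.mkContinuous
    { toFun := fun G => convOp s₁ b G
      map_add' := fun G G' => by
        have h := admissibleKernel_of_memLp hs hb (Lp.memLp G)
        have h' := admissibleKernel_of_memLp hs hb (Lp.memLp G')
        rw [← h.convOp_add h']
        exact ((admissibleKernel_of_memLp hs hb (Lp.memLp (G + G'))).convOp_congr_ae
          (Lp.coeFn_add G G'))
      map_smul' := fun c G => by
        have h := admissibleKernel_of_memLp hs hb (Lp.memLp G)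
        rw [RingHom.id_apply, ← h.convOp_smul]
        exact ((admissibleKernel_of_memLp hs hb (Lp.memLp (c • G))).convOp_congr_ae
          (Lp.coeFn_smul c G)) }
    1 fun G => by
      rw [one_mul, Lp.norm_def]
      exact (admissibleKernel_of_memLp hs hb (Lp.memLp G)).norm_convOp_le

/-- The reflection `G ↦ G(-·)` of `L²`. -/
def reflectL2 : L2 →L[ℂ] L2 :=
  (Lp.compMeasurePreservingₗᵢ ℂ (fun x : ℝ => -x)
    (Measure.measurePreserving_neg volume)).toContinuousLinearMap

theorem coeFn_reflectL2 (G : L2) : (reflectL2 G : ℝ → ℂ) =ᵐ[volume] fun x => G (-x) :=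
  Lp.coeFn_compMeasurePreserving G (Measure.measurePreserving_neg volume)

/-! ### Analytic dependence of the kernel on the spectral parameter -/

/-- The class of the symbol of `G_k` in `L²`. -/
def symbL2 (k : ℂ) : L2 := by
  classical
  exact if h : -k ∈ Complex.slitPlane then (memLp_symb h).toLp _ else 0

theorem coeFn_symbL2 {k : ℂ} (hk : -k ∈ Complex.slitPlane) :
    (symbL2 k : ℝ → ℂ) =ᵐ[volume] symb k := by
  rw [symbL2, dif_pos hk]
  exact (memLp_symb hk).coeFn_toLp

theorem norm_symb_le_inv {k : ℂ} {c : ℝ} (hc : 0 < c)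
    (h : ∀ t : ℝ, 0 ≤ t → c * (1 + t) ≤ ‖(t : ℂ) - k‖) (η : ℝ) : ‖symb k η‖ ≤ c⁻¹ := by
  refine (norm_symb_le hc h η).trans (mul_le_of_le_one_right (by positivity) ?_)
  by_cases hη : η ∈ Ioi (0 : ℝ)
  · rw [indicator_of_mem hη]
    have : 0 < η := hη
    exact inv_le_one_of_one_le₀ (by linarith)
  · simp [hη]

theorem memLp_symb_sq {k : ℂ} (hk : -k ∈ Complex.slitPlane) :
    MemLp (fun η => symb k η * symb k η) 2 := by
  obtain ⟨c, hc, h⟩ := exists_norm_sub_ge hk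
  refine ((memLp_symb hk).norm.const_mul c⁻¹).mono'
    ((measurable_symb k).mul (measurable_symb k)).aestronglyMeasurable (ae_of_all _ fun η => ?_)
  rw [norm_mul]
  exact mul_le_mul_of_nonneg_right (norm_symb_le_inv hc h η) (norm_nonneg _)

/-- Second-order remainder in the expansion of a resolvent: the derivative of 1/(t - k) in k is its
square. -/
theorem symb_sub_sub {k k' : ℂ} (hk : -k ∈ Complex.slitPlane) (hk' : -k' ∈ Complex.slitPlane)
    (η : ℝ) : symb k' η - symb k η - (k' - k) * (symb k η * symb k η) =
      (k' - k) ^ 2 * (symb k η * symb k η) * symb k' η := by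
  by_cases hη : 0 < η
  · rw [symb_of_pos k hη, symb_of_pos k' hη]
    have h1 := sub_ne_zero_of_slit hk (t := 2 * Real.pi * η) (by positivity)
    have h2 := sub_ne_zero_of_slit hk' (t := 2 * Real.pi * η) (by positivity)
    field_simp
    ring
  · simp [symb_of_nonpos _ (not_lt.1 hη)]

/-- Two factors of the remainder are bounded by c⁻¹ uniformly in the frequency and the third by
c⁻¹/(1 + η), an L² function independent of k'. The remainder is therefore quadratic in k' - k in L²
norm. -/
theorem hasDerivAt_symbL2 {k : ℂ} (hk : -k ∈ Complex.slitPlane) :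
    HasDerivAt symbL2 ((memLp_symb_sq hk).toLp _) k := by
  obtain ⟨c, hc, h⟩ := exists_norm_sub_ge_nhds hk
  have hnear : ∀ᶠ k' in 𝓝 k, ‖k' - k‖ ≤ c := by
    filter_upwards [Metric.closedBall_mem_nhds k hc] with k' hk'
    rwa [← dist_eq_norm]
  have hslit : ∀ᶠ k' in 𝓝 k, -k' ∈ Complex.slitPlane :=
    (continuous_neg.tendsto k).eventually (Complex.isOpen_slitPlane.mem_nhds hk)
  have hk0 := h k (by simpa using hc.le)
  have hJm : MemLp (fun x => (((Ioi (0 : ℝ)).indicator (fun t => (1 + t)⁻¹) x : ℝ) : ℂ)) 2 :=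
    memLp_indicator_one_add_inv.ofReal
  set J : L2 := hJm.toLp _ with hJ
  rw [hasDerivAt_iff_isLittleO]
  have hO : (fun k' => symbL2 k' - symbL2 k - (k' - k) • (memLp_symb_sq hk).toLp _) =O[𝓝 k]
      fun k' => ‖k' - k‖ ^ 2 := by
    refine Asymptotics.IsBigO.of_bound (c⁻¹ * c⁻¹ * c⁻¹ * ‖J‖) ?_
    filter_upwards [hnear, hslit] with k' h1 h2
    rw [norm_pow, norm_norm]
    have : ‖symbL2 k' - symbL2 k - (k' - k) • (memLp_symb_sq hk).toLp _‖ ≤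
        (‖k' - k‖ ^ 2 * (c⁻¹ * c⁻¹ * c⁻¹)) * ‖J‖ := by
      refine Lp.norm_le_mul_norm_of_ae_le_mul ?_
      filter_upwards [coeFn_symbL2 hk, coeFn_symbL2 h2, (memLp_symb_sq hk).coeFn_toLp,
        Lp.coeFn_smul (k' - k) ((memLp_symb_sq hk).toLp _),
        Lp.coeFn_sub (symbL2 k') (symbL2 k),
        Lp.coeFn_sub (symbL2 k' - symbL2 k) ((k' - k) • (memLp_symb_sq hk).toLp _),
        hJm.coeFn_toLp] with η e1 e2 e3 e4 e5 e6 e7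
      rw [e6, Pi.sub_apply, e5, Pi.sub_apply, e4, Pi.smul_apply, e1, e2, e3, hJ, e7, smul_eq_mul,
        symb_sub_sub hk h2, norm_mul, norm_mul, norm_mul, norm_pow]
      have n1 := norm_symb_le_inv hc hk0 η
      have n2 := norm_symb_le hc (h k' h1) η
      have n3 : ‖(((Ioi (0 : ℝ)).indicator (fun t => (1 + t)⁻¹) η : ℝ) : ℂ)‖ =
          (Ioi (0 : ℝ)).indicator (fun t => (1 + t)⁻¹) η := by
        rw [Complex.norm_real, Real.norm_of_nonneg]
        refine indicator_nonneg (fun t ht => ?_) η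
        have : 0 < t := ht
        positivity
      refine le_of_le_of_eq (b := ‖k' - k‖ ^ 2 * (c⁻¹ * c⁻¹) *
        (c⁻¹ * (Ioi (0 : ℝ)).indicator (fun t => (1 + t)⁻¹) η)) (by gcongr) ?_
      rw [n3]
      ring
    calc _ ≤ _ := this
      _ = _ := by ring
  exact hO.trans_isLittleO (Asymptotics.isLittleO_pow_sub_sub k one_lt_two)

theorem analyticAt_symbL2 {k : ℂ} (hk : -k ∈ Complex.slitPlane) : AnalyticAt ℂ symbL2 k := by
  have hopen : IsOpen {k : ℂ | -k ∈ Complex.slitPlane} :=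
    Complex.isOpen_slitPlane.preimage continuous_neg
  -- Complex differentiability on an open set already implies analyticity for maps into a Banach
  -- space.
  have hd : DifferentiableOn ℂ symbL2 {k : ℂ | -k ∈ Complex.slitPlane} := fun k hk =>
    (hasDerivAt_symbL2 hk).differentiableAt.differentiableWithinAt
  exact hd.analyticOnNhd hopen k hk

/-- The class of `G_k` in `L²`. -/
def kernelL2 (k : ℂ) : L2 := 𝓕⁻ (symbL2 k)

theorem coeFn_kernelL2 {k : ℂ} (hk : -k ∈ Complex.slitPlane) :
    (kernelL2 k : ℝ → ℂ) =ᵐ[volume] kernel k := by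
  rw [kernelL2, symbL2, dif_pos hk]
  exact kernel_ae_eq hk

theorem analyticAt_kernelL2 {k : ℂ} (hk : -k ∈ Complex.slitPlane) : AnalyticAt ℂ kernelL2 k :=
  ((Lp.fourierTransformₗᵢ ℝ ℂ).symm.toContinuousLinearEquiv.toContinuousLinearMap.analyticAt
    _).comp (analyticAt_symbL2 hk)

section Operators

variable {s₁ b : ℝ}

theorem admissibleKernel_kernel (hs : 0 ≤ s₁) (hb : 0 ≤ b) {k : ℂ}
    (hk : -k ∈ Complex.slitPlane) : ∃ C, AdmissibleKernel s₁ b C (kernel k) :=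
  ⟨_, (admissibleKernel_of_memLp hs hb (Lp.memLp (kernelL2 k))).congr_ae (coeFn_kernelL2 hk)⟩

theorem convOp_kernel (hs : 0 ≤ s₁) (hb : 0 ≤ b) {k : ℂ} (hk : -k ∈ Complex.slitPlane) :
    convOp s₁ b (kernel k) = convOpL2 hs hb (kernelL2 k) :=
  ((admissibleKernel_of_memLp hs hb (Lp.memLp (kernelL2 k))).convOp_congr_ae
    (coeFn_kernelL2 hk)).symm

theorem analyticAt_convOp_kernel (hs : 0 ≤ s₁) (hb : 0 ≤ b) {k : ℂ}
    (hk : -k ∈ Complex.slitPlane) : AnalyticAt ℂ (fun k => convOp s₁ b (kernel k)) k := by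
  have h1 : AnalyticAt ℂ (fun k => convOpL2 hs hb (kernelL2 k)) k :=
    ((convOpL2 hs hb).analyticAt _).comp (analyticAt_kernelL2 hk)
  refine h1.congr ?_
  filter_upwards [(continuous_neg.tendsto k).eventually
    (Complex.isOpen_slitPlane.mem_nhds hk)] with k' hk'
  exact (convOp_kernel hs hb hk').symm

theorem coeFn_reflect_kernelL2 {k : ℂ} (hk : - -k ∈ Complex.slitPlane) :
    (reflectL2 (kernelL2 (-k)) : ℝ → ℂ) =ᵐ[volume] fun x => kernel (-k) (-x) := by
  refine (coeFn_reflectL2 _).trans ?_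
  exact (Measure.measurePreserving_neg volume).quasiMeasurePreserving.ae_eq_comp
    (coeFn_kernelL2 hk)

theorem admissibleKernel_reflect (hs : 0 ≤ s₁) (hb : 0 ≤ b) {k : ℂ}
    (hk : - -k ∈ Complex.slitPlane) :
    ∃ C, AdmissibleKernel s₁ b C (fun x => kernel (-k) (-x)) :=
  ⟨_, (admissibleKernel_of_memLp hs hb (Lp.memLp (reflectL2 (kernelL2 (-k))))).congr_ae
    (coeFn_reflect_kernelL2 hk)⟩

/-- The hypothesis excludes only (-∞, 0], so this covers the points of the cut (0, ∞). -/
theorem analyticAt_convOp_reflect (hs : 0 ≤ s₁) (hb : 0 ≤ b) {k : ℂ}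
    (hk : - -k ∈ Complex.slitPlane) :
    AnalyticAt ℂ (fun k => convOp s₁ b (fun x => kernel (-k) (-x))) k := by
  have h0 : AnalyticAt ℂ (fun k => kernelL2 (-k)) k :=
    (analyticAt_kernelL2 hk).comp analyticAt_id.neg
  have h1 : AnalyticAt ℂ (fun k => convOpL2 hs hb (reflectL2 (kernelL2 (-k)))) k :=
    ((convOpL2 hs hb).analyticAt _).comp ((reflectL2.analyticAt _).comp h0)
  refine h1.congr ?_
  filter_upwards [((continuous_neg.comp continuous_neg).tendsto k).eventually
    (Complex.isOpen_slitPlane.mem_nhds hk)] with k' hk'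
  exact (admissibleKernel_of_memLp hs hb (Lp.memLp (reflectL2 (kernelL2 (-k'))))).convOp_congr_ae
    (coeFn_reflect_kernelL2 hk')

/-! ### Hölder dependence up to the cut -/

theorem norm_exp_sub_exp_le {z w : ℂ} (hz : z.re ≤ 0) (hw : w.re ≤ 0) :
    ‖Complex.exp z - Complex.exp w‖ ≤ ‖z - w‖ := by
  have := (convex_halfSpace_re_le 0).norm_image_sub_le_of_norm_deriv_le (f := Complex.exp) (C := 1)
    (fun x _ => Complex.differentiableAt_exp) (fun x hx => by
      rw [Complex.deriv_exp, Complex.norm_exp]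
      exact Real.exp_le_one_iff.2 hx) hw hz
  simpa using this

/-- Interpolation between the Lipschitz bound on the left half plane, used for small distances, and
the trivial bound 2, used for large ones. It keeps the growth in x down to w^γ. -/
theorem norm_exp_sub_exp_le_rpow {z w : ℂ} (hz : z.re ≤ 0) (hw : w.re ≤ 0) {γ : ℝ} (h0 : 0 ≤ γ)
    (h1 : γ ≤ 1) : ‖Complex.exp z - Complex.exp w‖ ≤ 2 * ‖z - w‖ ^ γ := by
  rcases le_total ‖z - w‖ 1 with h | h
  · have h2 : ‖z - w‖ ≤ ‖z - w‖ ^ γ := by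
      rcases (norm_nonneg (z - w)).eq_or_lt with h3 | h3
      · rw [← h3]; positivity
      · calc ‖z - w‖ = ‖z - w‖ ^ (1 : ℝ) := (Real.rpow_one _).symm
          _ ≤ _ := Real.rpow_le_rpow_of_exponent_ge h3 h h1
    linarith [norm_exp_sub_exp_le hz hw, norm_nonneg (z - w)]
  · have h2 : 1 ≤ ‖z - w‖ ^ γ := Real.one_le_rpow h h0
    have h3 : ‖Complex.exp z‖ ≤ 1 := by
      rw [Complex.norm_exp]; exact Real.exp_le_one_iff.2 hz
    have h4 : ‖Complex.exp w‖ ≤ 1 := by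
      rw [Complex.norm_exp]; exact Real.exp_le_one_iff.2 hw
    linarith [norm_sub_le (Complex.exp z) (Complex.exp w)]

theorem norm_mul_rpow_le_weight {k k' : ℂ} (x : ℝ) {γ : ℝ} (h0 : 0 ≤ γ) :
    ‖Complex.I * k * x - Complex.I * k' * x‖ ^ γ ≤ ‖k - k'‖ ^ γ * weight x ^ γ := by
  rw [← Real.mul_rpow (norm_nonneg _) (weight_pos x).le]
  refine Real.rpow_le_rpow (norm_nonneg _) ?_ h0
  rw [← sub_mul, ← mul_sub, norm_mul, norm_mul, Complex.norm_I, one_mul, Complex.norm_real]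
  gcongr
  unfold weight
  rw [Real.norm_eq_abs]
  linarith

/-- On the closed half plane of the side σ the exponent i k x has nonpositive real part wherever the
jump kernel is nonzero. -/
theorem norm_jumpKernel_sub_le {σ : Side} {k k' : ℂ} (hk : 0 ≤ σ.sgn * k.im)
    (hk' : 0 ≤ σ.sgn * k'.im) {γ : ℝ} (h0 : 0 ≤ γ) (h1 : γ ≤ 1) (x : ℝ) :
    ‖jumpKernel σ k x - jumpKernel σ k' x‖ ≤ 2 * ‖k - k'‖ ^ γ * weight x ^ γ := by
  unfold jumpKernel
  split_ifs with h
  · have hre : ∀ k : ℂ, 0 ≤ σ.sgn * k.im → (Complex.I * k * x).re ≤ 0 := by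
      intro k hk
      have : (Complex.I * k * x).re = -(σ.sgn * k.im) * (σ.sgn * x) := by
        simp
        linear_combination (-(k.im * x)) * σ.sgn_mul_self
      rw [this]
      nlinarith
    rw [← mul_sub, norm_mul, norm_mul, Complex.norm_I, Complex.norm_real, Real.norm_eq_abs,
      σ.abs_sgn, one_mul, one_mul]
    refine (norm_exp_sub_exp_le_rpow (hre k hk) (hre k' hk') h0 h1).trans ?_
    linarith [norm_mul_rpow_le_weight (k := k) (k' := k') x h0]
  · have := weight_rpow_pos x γ
    rw [sub_zero, norm_zero]
    positivity

theorem norm_jumpKernel_le_one {σ : Side} {k : ℂ} (hk : 0 ≤ σ.sgn * k.im) (x : ℝ) :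
    ‖jumpKernel σ k x‖ ≤ 1 := by
  refine (norm_jumpKernel_le σ k x).trans (Real.exp_le_one_iff.2 ?_)
  rw [neg_mul]
  exact neg_nonpos.2 (by positivity)

/-- The kernel near a point of the side `σ` of the cut. -/
def sideKernel (σ : Side) (k : ℂ) (x : ℝ) : ℂ := jumpKernel σ k x + kernel (-k) (-x)

theorem kernel_ae_eq_sideKernel {σ : Side} {k : ℂ} (hk : 0 < σ.sgn * k.im) :
    kernel k =ᵐ[volume] sideKernel σ k := by
  filter_upwards [ae_ne_zero] with x hx
  exact kernel_eq_jump_add hk hx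

theorem boundaryKernel_ae_eq_sideKernel {l : ℝ} (hl : 0 < l) (σ : Side) :
    boundaryKernel l σ =ᵐ[volume] sideKernel σ l := by
  filter_upwards [ae_ne_zero] with x hx
  exact boundaryKernel_eq hl σ hx

theorem admissibleKernel_jump (hs : 1 / 2 < s₁) (hb : 0 ≤ b) {σ : Side} {k : ℂ}
    (hk : 0 ≤ σ.sgn * k.im) : ∃ C, AdmissibleKernel s₁ b C (jumpKernel σ k) :=
  ⟨_, admissibleKernel_of_growth (β := 0) (D := 1) le_rfl (by linarith) hb zero_le_one
    (measurable_jumpKernel σ k).aestronglyMeasurable fun x => by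
      simpa using norm_jumpKernel_le_one hk x⟩

theorem admissibleKernel_sideKernel (hs : 1 / 2 < s₁) (hb : 0 ≤ b) {σ : Side} {k : ℂ}
    (hk : 0 ≤ σ.sgn * k.im) (hre : 0 < k.re) :
    ∃ C, AdmissibleKernel s₁ b C (sideKernel σ k) := by
  obtain ⟨C, h⟩ := admissibleKernel_jump hs hb hk
  obtain ⟨C', h'⟩ := admissibleKernel_reflect (s₁ := s₁) (by linarith) hb (mem_slitPlane_of_re hre)
  exact ⟨_, h.add h'⟩

theorem convOp_sideKernel (hs : 1 / 2 < s₁) (hb : 0 ≤ b) {σ : Side} {k : ℂ}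
    (hk : 0 ≤ σ.sgn * k.im) (hre : 0 < k.re) :
    convOp s₁ b (sideKernel σ k) =
      convOp s₁ b (jumpKernel σ k) + convOp s₁ b (fun x => kernel (-k) (-x)) := by
  obtain ⟨C, h⟩ := admissibleKernel_jump hs hb hk
  obtain ⟨C', h'⟩ := admissibleKernel_reflect (s₁ := s₁) (by linarith) hb (mem_slitPlane_of_re hre)
  exact h.convOp_add h'

/-- A function analytic at a point is Hölder continuous near it. -/
theorem AnalyticAt.exists_holder {E F : Type*} [NormedAddCommGroup E] [NormedSpace ℂ E]
    [NormedAddCommGroup F] [NormedSpace ℂ F] {f : E → F} {z : E} (hf : AnalyticAt ℂ f z) :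
    ∃ r > 0, ∃ C ≥ 0, ∀ x y : E, ‖x - z‖ < r → ‖y - z‖ < r → ‖f x - f y‖ ≤ C * ‖x - y‖ := by
  obtain ⟨K, t, ht, hK⟩ := hf.hasStrictFDerivAt.exists_lipschitzOnWith
  obtain ⟨r, hr, hball⟩ := Metric.mem_nhds_iff.1 ht
  refine ⟨r, hr, K, K.2, fun x y hx hy => ?_⟩
  have := hK.dist_le_mul x (hball (by rwa [Metric.mem_ball, dist_eq_norm]))
    y (hball (by rwa [Metric.mem_ball, dist_eq_norm]))
  rwa [dist_eq_norm, dist_eq_norm] at this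

theorem le_rpow_of_le_one {t γ : ℝ} (h0 : 0 ≤ t) (h1 : t ≤ 1) (hγ1 : γ ≤ 1) :
    t ≤ t ^ γ := by
  rcases h0.eq_or_lt with h3 | h3
  · rw [← h3]; positivity
  · calc t = t ^ (1 : ℝ) := (Real.rpow_one _).symm
      _ ≤ _ := Real.rpow_le_rpow_of_exponent_ge h3 h1 hγ1

/-- The reflected kernel is analytic at k₀, hence Lipschitz nearby. The difference of jump kernels
grows at most like |k - k'|^γ w^γ, so `admissibleKernel_of_growth` with β = γ bounds its operator
norm. Boundary points are included, which gives continuity up to the cut. -/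
theorem exists_holder_convOp_sideKernel {γ : ℝ} (hγ : 0 ≤ γ) (hγ1 : γ ≤ 1)
    (hs : 1 / 2 < s₁ - γ) (hb : γ ≤ b) (σ : Side) {k₀ : ℂ} (hk₀ : 0 < k₀.re) :
    ∃ r > 0, ∃ C ≥ 0, ∀ k k' : ℂ, ‖k - k₀‖ < r → ‖k' - k₀‖ < r → 0 ≤ σ.sgn * k.im →
      0 ≤ σ.sgn * k'.im → 0 < k.re ∧ 0 < k'.re ∧
      ‖convOp s₁ b (sideKernel σ k) - convOp s₁ b (sideKernel σ k')‖ ≤ C * ‖k - k'‖ ^ γ := by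
  have hb0 : 0 ≤ b := hγ.trans hb
  have hs0 : 1 / 2 < s₁ := by linarith
  obtain ⟨r, hr, C, hC, h⟩ := AnalyticAt.exists_holder
    (analyticAt_convOp_reflect (s₁ := s₁) (by linarith) hb0 (mem_slitPlane_of_re hk₀))
  set W := (eLpNorm (fun y => weight y ^ (-(s₁ - γ))) 2 volume).toReal with hW
  have hW0 : 0 ≤ W := ENNReal.toReal_nonneg
  -- The radius 1/2 gives |k - k'| ≤ 1, so the Lipschitz bound implies the Hölder one; the radius Re
  -- k₀ keeps both points in the right half plane, where the reflected kernel is harmless.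
  refine ⟨min r (min (1 / 2) k₀.re), by positivity, 2 * W + C, by positivity,
    fun k k' hk hk' him him' => ?_⟩
  simp only [lt_min_iff] at hk hk'
  have hpos : ∀ k : ℂ, ‖k - k₀‖ < k₀.re → 0 < k.re := by
    intro k hk
    have := (Complex.abs_re_le_norm (k - k₀)).trans_lt hk
    rw [Complex.sub_re, abs_lt] at this
    linarith [this.1]
  have hre := hpos k hk.2.2
  have hre' := hpos k' hk'.2.2
  refine ⟨hre, hre', ?_⟩
  rw [convOp_sideKernel hs0 hb0 him hre, convOp_sideKernel hs0 hb0 him' hre', add_sub_add_comm]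
  have hkk : ‖k - k'‖ ≤ 1 := by
    have := norm_sub_le (k - k₀) (k' - k₀)
    rw [sub_sub_sub_cancel_right] at this
    linarith [hk.2.1, hk'.2.1]
  have e1 : ‖convOp s₁ b (jumpKernel σ k) - convOp s₁ b (jumpKernel σ k')‖ ≤
      2 * ‖k - k'‖ ^ γ * W := by
    obtain ⟨C₁, h₁⟩ := admissibleKernel_jump hs0 hb0 him
    obtain ⟨C₂, h₂⟩ := admissibleKernel_jump hs0 hb0 him'
    rw [← h₁.convOp_sub h₂]
    exact (admissibleKernel_of_growth hγ hs hb (by positivity)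
      ((measurable_jumpKernel σ k).sub (measurable_jumpKernel σ k')).aestronglyMeasurable
      (norm_jumpKernel_sub_le him him' hγ hγ1)).norm_convOp_le
  have e2 := h k k' hk.1 hk'.1
  have e3 := le_rpow_of_le_one (norm_nonneg (k - k')) hkk hγ1
  calc _ ≤ _ := norm_add_le _ _
    _ ≤ 2 * ‖k - k'‖ ^ γ * W + C * ‖k - k'‖ ^ γ := by
        refine add_le_add e1 (e2.trans ?_)
        gcongr
    _ = _ := by ring

/-! ### Plane waves -/

theorem norm_planeWave (l x : ℝ) : ‖Complex.exp (Complex.I * l * x)‖ = 1 := by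
  have := norm_exp_I_mul l x
  simpa using this

/-- The class of `w^{-b} e^{ilx}` in `L^∞`. -/
def planeWave {b : ℝ} (hb : 0 ≤ b) (l : ℝ) : Linf :=
  Linf.ofBound b (fun x : ℝ => Complex.exp (Complex.I * l * x))
    (by fun_prop) ⟨1, fun x => by
      rw [norm_planeWave, one_mul]
      exact Real.one_le_rpow (one_le_weight x) hb⟩

theorem coeFn_planeWave (hb : 0 ≤ b) (l : ℝ) : (planeWave hb l : ℝ → ℂ) =ᵐ[volume]
    fun x => ((weight x ^ (-b) : ℝ) : ℂ) * Complex.exp (Complex.I * l * x) :=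
  Linf.coeFn_ofBound _ _

theorem norm_planeWave_sub_le {γ : ℝ} (hγ : 0 ≤ γ) (hγ1 : γ ≤ 1) (hb : 0 ≤ b) (hγb : γ ≤ b)
    (l l' : ℝ) : ‖planeWave hb l - planeWave hb l'‖ ≤ 2 * |l - l'| ^ γ := by
  refine Linf.norm_le_of_ae_bound (by positivity) ?_
  filter_upwards [coeFn_planeWave hb l, coeFn_planeWave hb l',
    Lp.coeFn_sub (planeWave hb l) (planeWave hb l')] with x h1 h2 h3
  rw [h3, Pi.sub_apply, h1, h2, ← mul_sub, norm_weight_smul_le]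
  have hre : ∀ l : ℝ, (Complex.I * l * x : ℂ).re ≤ 0 := fun l => by simp
  refine (norm_exp_sub_exp_le_rpow (hre l) (hre l') hγ hγ1).trans ?_
  have h4 := norm_mul_rpow_le_weight (k := l) (k' := l') x hγ
  rw [← Complex.ofReal_sub, Complex.norm_real, Real.norm_eq_abs] at h4
  have h5 : |l - l'| ^ γ * weight x ^ γ ≤ |l - l'| ^ γ * weight x ^ b := by
    gcongr
    exact one_le_weight x
  linarith

end Operators

/-! ### Correlation identities -/

theorem fourier_mul_phase (Φ : ℝ → ℂ) (τ η : ℝ) :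
    𝓕 (fun x : ℝ => Complex.exp (2 * Real.pi * x * (-τ : ℝ) * Complex.I) * Φ x) η = 𝓕 Φ (η + τ) := by
  rw [fourier_apply, fourier_apply]
  refine integral_congr_ae (ae_of_all _ fun x => ?_)
  simp only [← mul_assoc, ← Complex.exp_add]
  congr 2
  push_cast
  ring

theorem fourierInv_comp_add (h : ℝ → ℂ) (τ x : ℝ) :
    𝓕⁻ (fun η => h (η + τ)) x = Complex.exp (2 * Real.pi * x * (-τ : ℝ) * Complex.I) * 𝓕⁻ h x := by
  rw [fourierInv_apply, fourierInv_apply, ← integral_const_mul,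
    ← integral_add_right_eq_self
      (fun η : ℝ => Complex.exp (2 * Real.pi * x * (-τ : ℝ) * Complex.I) *
        (Complex.exp (2 * Real.pi * x * η * Complex.I) * h η)) τ]
  refine integral_congr_ae (ae_of_all _ fun η => ?_)
  simp only [← mul_assoc, ← Complex.exp_add]
  congr 2
  push_cast
  ring

theorem conj_fourierInv (h : ℝ → ℂ) (x : ℝ) : conj (𝓕⁻ h x) = 𝓕 (fun η => conj (h η)) x := by
  rw [fourierInv_apply, fourier_apply, ← integral_conj]
  refine integral_congr_ae (ae_of_all _ fun η => ?_)
  simp only [map_mul, ← Complex.exp_conj]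
  congr 2
  simp only [Complex.conj_ofReal, Complex.conj_I, Complex.conj_ofNat]
  ring

theorem Integrable.conj {f : ℝ → ℂ} (h : Integrable f) : Integrable fun x => conj (f x) :=
  (Complex.conjLIE.toContinuousLinearEquiv.integrable_comp_iff).2 h

/-- The correlation of `Φ` with `𝓕⁻ h` at frequency `τ`. -/
theorem integral_phase_mul_conj_fourierInv {Φ h : ℝ → ℂ} (hΦ : Integrable Φ) (hh : Integrable h)
    (τ : ℝ) :
    ∫ x : ℝ, Complex.exp (2 * Real.pi * x * (-τ : ℝ) * Complex.I) * (Φ x * conj (𝓕⁻ h x)) =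
      ∫ η : ℝ, 𝓕 Φ (η + τ) * conj (h η) := by
  have hΦ' : Integrable
      (fun x : ℝ => Complex.exp (2 * Real.pi * x * (-τ : ℝ) * Complex.I) * Φ x) := by
    refine hΦ.norm.mono' (AEStronglyMeasurable.mul (by fun_prop) hΦ.aestronglyMeasurable)
      (ae_of_all _ fun x => ?_)
    rw [norm_mul, norm_exp_phase, one_mul]
  have := VectorFourier.integral_fourierIntegral_smul_eq_flip (μ := (volume : Measure ℝ))
    (ν := (volume : Measure ℝ)) (e := Real.fourierChar) (L := (innerₗ ℝ))
    Real.continuous_fourierChar (by fun_prop) hΦ' (Integrable.conj hh)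
  rw [flip_innerₗ] at this
  calc _ = ∫ x : ℝ, (Complex.exp (2 * Real.pi * x * (-τ : ℝ) * Complex.I) * Φ x) *
        𝓕 (fun η => conj (h η)) x := by
        refine integral_congr_ae (ae_of_all _ fun x => ?_)
        simp only [conj_fourierInv, mul_assoc]
    _ = ∫ η, 𝓕 (fun x : ℝ => Complex.exp (2 * Real.pi * x * (-τ : ℝ) * Complex.I) * Φ x) η *
        conj (h η) := this.symm
    _ = _ := by simp only [fourier_mul_phase]

/-- Plancherel for the correlation of `𝓕⁻ h` with itself. -/
theorem integral_phase_mul_norm_sq_fourierInv {h : ℝ → ℂ} (h1 : Integrable h) (h2 : MemLp h 2)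
    (τ : ℝ) :
    ∫ x : ℝ, Complex.exp (2 * Real.pi * x * (-τ : ℝ) * Complex.I) * (‖𝓕⁻ h x‖ ^ 2 : ℝ) =
      ∫ η : ℝ, conj (h η) * h (η + τ) := by
  have h1' : Integrable (fun η => h (η + τ)) := h1.comp_add_right τ
  have h2' : MemLp (fun η => h (η + τ)) 2 :=
    h2.comp_measurePreserving (measurePreserving_add_right volume τ)
  have key : inner ℂ (𝓕⁻ (h2.toLp h) : L2) (𝓕⁻ (h2'.toLp _) : L2) =
      inner ℂ (h2.toLp h) (h2'.toLp _) := by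
    rw [← Lp.inner_fourier_eq, FourierTransform.fourier_fourierInv_eq,
      FourierTransform.fourier_fourierInv_eq]
  rw [L2.inner_def, L2.inner_def] at key
  calc _ = ∫ x, inner ℂ ((𝓕⁻ (h2.toLp h) : L2) x) ((𝓕⁻ (h2'.toLp _) : L2) x) := by
        refine integral_congr_ae ?_
        filter_upwards [coeFn_fourierInv_toLp h1 h2, coeFn_fourierInv_toLp h1' h2'] with x e1 e2
        rw [e1, e2, fourierInv_comp_add]
        simp only [RCLike.inner_apply]
        rw [mul_assoc _ (𝓕⁻ h x), Complex.mul_conj, Complex.normSq_eq_norm_sq]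
    _ = _ := key
    _ = _ := by
        refine integral_congr_ae ?_
        filter_upwards [h2.coeFn_toLp, h2'.coeFn_toLp] with η e1 e2
        rw [e1, e2]
        simp only [RCLike.inner_apply]
        ring

theorem memLp_fourierInv {h : ℝ → ℂ} (h1 : Integrable h) (h2 : MemLp h 2) : MemLp (𝓕⁻ h) 2 :=
  (memLp_congr_ae (coeFn_fourierInv_toLp h1 h2)).1 (Lp.memLp _)

theorem continuous_fourierInv {f : ℝ → ℂ} (h1 : Integrable f) : Continuous (𝓕⁻ f) :=
  VectorFourier.fourierIntegral_continuous Real.continuous_fourierChar (by fun_prop) h1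

theorem integrable_symb_mul_fourier {k : ℂ} (hk : -k ∈ Complex.slitPlane) {Φ : ℝ → ℂ}
    (h1 : Integrable Φ) (h2 : MemLp Φ 2) : Integrable fun η => symb k η * 𝓕 Φ η :=
  (memLp_symb hk).integrable_mul (memLp_fourier h1 h2)

theorem memLp_symb_mul_fourier {k : ℂ} (hk : -k ∈ Complex.slitPlane) {Φ : ℝ → ℂ}
    (h1 : Integrable Φ) : MemLp (fun η => symb k η * 𝓕 Φ η) 2 := by
  refine ((memLp_symb hk).norm.mul_const (∫ x, ‖Φ x‖)).mono'
    ((measurable_symb k).aestronglyMeasurable.mul (continuous_fourier h1).aestronglyMeasurable)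
    (ae_of_all _ fun η => ?_)
  rw [norm_mul]
  exact mul_le_mul_of_nonneg_left (norm_fourier_le η) (norm_nonneg _)

/-- The commutator identity: multiplication by the frequency against the correlation of
`h = g / (2πη - k)` with itself. -/
theorem correlation_identity {k : ℂ} (hk : -k ∈ Complex.slitPlane) {Φ : ℝ → ℂ}
    (h1 : Integrable Φ) (h2 : MemLp Φ 2) {τ : ℝ} (hτ : 0 < τ) :
    (∫ η : ℝ, 𝓕 Φ (η + τ) * conj (symb k η * 𝓕 Φ η)) -
      ∫ η : ℝ, conj (𝓕 Φ (η - τ)) * (symb k η * 𝓕 Φ η) =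
    ((2 * Real.pi * τ : ℝ) - 2 * k.im * Complex.I) *
      (∫ η : ℝ, conj (symb k η * 𝓕 Φ η) * (symb k (η + τ) * 𝓕 Φ (η + τ))) -
    ∫ η in Ioc (-τ) 0, conj (𝓕 Φ η) * (symb k (η + τ) * 𝓕 Φ (η + τ)) := by
  set g := 𝓕 Φ with hg
  have hgc : Continuous g := continuous_fourier h1
  have hgb : ∀ η, ‖g η‖ ≤ ∫ x, ‖Φ x‖ := norm_fourier_le
  set h : ℝ → ℂ := fun η => symb k η * g η with hh
  have i1 : Integrable h := integrable_symb_mul_fourier hk h1 h2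
  have i2 : MemLp h 2 := memLp_symb_mul_fourier hk h1
  have i1' : Integrable (fun η => h (η + τ)) := i1.comp_add_right τ
  have i2' : MemLp (fun η => h (η + τ)) 2 :=
    i2.comp_measurePreserving (measurePreserving_add_right volume τ)
  have j1 : Integrable fun η => g (η + τ) * conj (h η) :=
    (Integrable.conj i1).bdd_mul (by fun_prop) (ae_of_all _ fun η => hgb (η + τ))
  have j2 : Integrable fun η => conj (g η) * h (η + τ) :=
    i1'.bdd_mul (c := ∫ x, ‖Φ x‖) (by fun_prop) (ae_of_all _ fun η => by
      simpa using hgb η)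
  have j3 : Integrable fun η => conj (h η) * h (η + τ) := (i2.star).integrable_mul i2'
  -- After this translation all integrals pair η with η + τ, and the identity holds pointwise in η.
  have e2 : ∫ η : ℝ, conj (g (η - τ)) * h η = ∫ η : ℝ, conj (g η) * h (η + τ) := by
    rw [← integral_add_right_eq_self (fun η : ℝ => conj (g (η - τ)) * h η) τ]
    simp
  rw [e2, ← integral_sub j1 j2, ← integral_indicator measurableSet_Ioc, ← integral_const_mul,
    ← integral_sub (j3.const_mul _) (j2.indicator measurableSet_Ioc)]
  refine integral_congr_ae (ae_of_all _ fun η => ?_)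
  have hpos : ∀ η : ℝ, 0 < η → g η = ((2 * Real.pi * η : ℝ) - k) * h η := by
    intro η hη
    have := sub_ne_zero_of_slit hk (t := 2 * Real.pi * η) (by positivity)
    simp only [hh, symb_of_pos k hη]
    field_simp
  have hneg : ∀ η : ℝ, η ≤ 0 → h η = 0 := fun η hη => by
    simp only [hh, symb_of_nonpos k hη, zero_mul]
  change g (η + τ) * conj (h η) - conj (g η) * h (η + τ) =
    ((2 * Real.pi * τ : ℝ) - 2 * k.im * Complex.I) * (conj (h η) * h (η + τ)) -
      (Ioc (-τ) 0).indicator (fun η => conj (g η) * h (η + τ)) η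
  rcases lt_or_ge 0 η with hη | hη
  · rw [indicator_of_notMem (fun hm => absurd hm.2 (not_le.2 hη)), hpos η hη,
      hpos (η + τ) (by linarith)]
    have hkc : (2 * k.im * Complex.I : ℂ) = k - conj k := by
      rw [Complex.sub_conj]
      push_cast
      ring
    rw [hkc]
    simp only [map_mul, map_sub, Complex.conj_ofReal]
    push_cast
    ring
  -- For η ≤ 0 only conj g(η) h(η+τ) survives, and only when η + τ > 0: this is the edge term over
  -- (-τ, 0].
  · rw [hneg η hη]
    by_cases hm : η ∈ Ioc (-τ) 0
    · rw [indicator_of_mem hm]; simp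
    · rw [indicator_of_notMem hm, hneg (η + τ)]
      · simp
      · by_contra! hlt
        exact hm ⟨by linarith, hη⟩

theorem norm_fourierInv_le {f : ℝ → ℂ} (x : ℝ) : ‖𝓕⁻ f x‖ ≤ ∫ η, ‖f η‖ :=
  VectorFourier.norm_fourierIntegral_le_integral_norm _ _ _ _ _

/-- If `Φ = u m` with `u` real, then the antisymmetric part of the correlation of `Φ` with `𝓕⁻ h`
is controlled by the distance between `𝓕⁻ h` and `m`. -/
theorem norm_antisymmetric_correlation_le {Φ h m : ℝ → ℂ} {u B : ℝ → ℝ} (hΦ : Integrable Φ)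
    (hh : Integrable h) (hu : ∀ᵐ x, Φ x = u x * m x) (hB : Integrable fun x => ‖Φ x‖ * B x)
    (hm : ∀ᵐ x, ‖𝓕⁻ h x - m x‖ ≤ B x) (τ : ℝ) :
    ‖(∫ η : ℝ, 𝓕 Φ (η + τ) * conj (h η)) - ∫ η : ℝ, conj (𝓕 Φ (η - τ)) * h η‖ ≤
      2 * ∫ x, ‖Φ x‖ * B x := by
  have hp : ∀ x, ‖𝓕⁻ h x‖ ≤ ∫ η, ‖h η‖ := norm_fourierInv_le
  have hpc : Continuous (𝓕⁻ h) := continuous_fourierInv hh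
  have i1 : Integrable fun x => Φ x * conj (𝓕⁻ h x) :=
    hΦ.mul_bdd (c := ∫ η, ‖h η‖) (by fun_prop) (ae_of_all _ fun x => by simpa using hp x)
  have ie : ∀ {f : ℝ → ℂ} (τ : ℝ), Integrable f →
      Integrable fun x : ℝ => Complex.exp (2 * Real.pi * x * τ * Complex.I) * f x := by
    intro f τ hf
    exact hf.bdd_mul (c := 1) (by fun_prop) (ae_of_all _ fun x => (norm_exp_phase x τ).le)
  have e2 : ∫ η : ℝ, conj (𝓕 Φ (η - τ)) * h η =
      ∫ x : ℝ, Complex.exp (2 * Real.pi * x * (-τ : ℝ) * Complex.I) * (conj (Φ x) * 𝓕⁻ h x) := by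
    have := congrArg conj (integral_phase_mul_conj_fourierInv hΦ hh (-τ))
    rw [← integral_conj, ← integral_conj] at this
    simp only [map_mul, Complex.conj_conj, ← sub_eq_add_neg] at this
    rw [← this]
    refine integral_congr_ae (ae_of_all _ fun x => ?_)
    simp only [← Complex.exp_conj, map_mul, Complex.conj_ofReal, Complex.conj_I,
      Complex.conj_ofNat]
    congr 2
    push_cast
    ring
  have i2 : Integrable fun x => conj (Φ x) * 𝓕⁻ h x := by
    simpa using Integrable.conj i1
  rw [e2, ← integral_phase_mul_conj_fourierInv hΦ hh, ← integral_sub (ie _ i1) (ie _ i2),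
    ← integral_const_mul]
  refine norm_integral_le_of_norm_le (hB.const_mul 2) ?_
  filter_upwards [hu, hm] with x h1 h2
  rw [← mul_sub, norm_mul, norm_exp_phase, one_mul]
  -- Since u is real, Φ conj m = conj Φ m, so m may be subtracted from 𝓕⁻ h without changing the
  -- expression.
  have h3 : Φ x * conj (𝓕⁻ h x) - conj (Φ x) * 𝓕⁻ h x =
      Φ x * conj (𝓕⁻ h x - m x) - conj (Φ x) * (𝓕⁻ h x - m x) := by
    rw [h1]
    simp only [map_mul, map_sub, Complex.conj_ofReal]
    ring
  rw [h3]
  refine (norm_sub_le _ _).trans ?_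
  rw [norm_mul, norm_mul, RCLike.norm_conj, RCLike.norm_conj]
  nlinarith [mul_le_mul_of_nonneg_left h2 (norm_nonneg (Φ x))]

/-- Interpolating the two lower bounds for |D| leaves a power of ε in the numerator and makes the
singularity in τ integrable. -/
theorem rpow_mul_rpow_le_norm {D : ℂ} {τ ε θ : ℝ} (hτ : 0 ≤ τ) (hε : 0 ≤ ε) (h0 : 0 < θ)
    (h1 : θ < 1) (hDτ : τ ≤ ‖D‖) (hDε : ε ≤ ‖D‖) : τ ^ (1 - θ) * ε ^ θ ≤ ‖D‖ := by
  calc τ ^ (1 - θ) * ε ^ θ ≤ ‖D‖ ^ (1 - θ) * ‖D‖ ^ θ := by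
        gcongr
    _ = ‖D‖ := by
        rw [← Real.rpow_add' (norm_nonneg D) (by norm_num)]
        simp

/-- One-sided bound for the correlation of the solution at small frequencies. -/
theorem re_correlation_le {l : ℝ} (hl : 0 < l) (σ : Side) {Φ m : ℝ → ℂ} {u : ℝ → ℝ}
    (h1 : Integrable Φ) (h2 : MemLp Φ 2) (hu : ∀ᵐ x, Φ x = u x * m x) {γ C ε₀ : ℝ} (hγ : 0 < γ)
    (hγ1 : γ < 1) (hΦ : Integrable fun x => ‖Φ x‖ * weight x ^ γ) (hC : 0 ≤ C) (hε₀ : 0 < ε₀)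
    (hm : ∀ ε : ℝ, 0 < ε → ε < ε₀ → ∀ᵐ x, ‖𝓕⁻ (fun η =>
      symb (l + σ.sgn * ε * Complex.I) η * 𝓕 Φ η) x - m x‖ ≤ C * ε ^ γ * weight x ^ γ)
    {κ : ℝ} (hκ : 0 < κ) :
    ∃ δ > 0, ∀ ε : ℝ, 0 < ε → ε < δ → ∀ τ : ℝ, τ ≠ 0 → |τ| < δ →
      (∫ x : ℝ, Complex.exp (2 * Real.pi * x * τ * Complex.I) * (‖𝓕⁻ (fun η =>
        symb (l + σ.sgn * ε * Complex.I) η * 𝓕 Φ η) x‖ ^ 2 : ℝ)).re ≤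
      κ + (2 * C * ∫ x, ‖Φ x‖ * weight x ^ γ) * ε ^ (γ / 2) * |τ| ^ (γ / 2 - 1) := by
  set g := 𝓕 Φ with hg
  have hgc : Continuous g := continuous_fourier h1
  set I := ∫ x, ‖Φ x‖ * weight x ^ γ with hI
  have hI0 : 0 ≤ I := integral_nonneg fun x =>
    mul_nonneg (norm_nonneg _) (weight_rpow_pos x γ).le
  -- The integrand of the edge term as a function of (η, η + τ, ε). It is continuous at the origin
  -- because the denominator there is -l ≠ 0.
  set Ψ : ℝ × ℝ × ℝ → ℂ := fun q => conj (g q.1) *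
    (1 / ((2 * Real.pi * q.2.1 : ℝ) - (l + σ.sgn * q.2.2 * Complex.I)) * g q.2.1) with hΨ
  have hΨc : ContinuousAt Ψ 0 := by
    refine ContinuousAt.mul (by fun_prop) (ContinuousAt.mul (ContinuousAt.div (by fun_prop)
      (by fun_prop) ?_) (by fun_prop))
    simp [hl.ne']
  -- This value is nonpositive because l > 0; the whole argument rests on this sign.
  have hΨ0 : Ψ 0 = ((-(‖g 0‖ ^ 2 / l) : ℝ) : ℂ) := by
    have : conj (g 0) * g 0 = ((‖g 0‖ ^ 2 : ℝ) : ℂ) := by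
      rw [mul_comm, Complex.mul_conj, Complex.normSq_eq_norm_sq]
    simp only [hΨ, Prod.fst_zero, Prod.snd_zero, mul_zero, Complex.ofReal_zero, zero_mul, add_zero,
      zero_sub]
    rw [show conj (g 0) * (1 / -(l : ℂ) * g 0) = -((conj (g 0) * g 0) / l) by ring, this]
    push_cast
    ring
  obtain ⟨δ, hδ, hball⟩ := Metric.continuousAt_iff.1 hΨc κ hκ
  have hmain : ∀ ε : ℝ, 0 < ε → ε < min δ ε₀ → ∀ τ : ℝ, 0 < τ → τ < min δ ε₀ →
      (∫ x : ℝ, Complex.exp (2 * Real.pi * x * (-τ : ℝ) * Complex.I) * (‖𝓕⁻ (fun η =>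
        symb (l + σ.sgn * ε * Complex.I) η * g η) x‖ ^ 2 : ℝ)).re ≤
      κ + (2 * C * I) * ε ^ (γ / 2) * τ ^ (γ / 2 - 1) := by
    intro ε hε hεδ τ hτ hτδ
    rw [lt_min_iff] at hεδ hτδ
    set k : ℂ := l + σ.sgn * ε * Complex.I with hk
    have hkim : k.im = σ.sgn * ε := by simp [hk]
    have hslit : -k ∈ Complex.slitPlane := neg_mem_slitPlane_of_im (by
      rw [hkim]; exact mul_ne_zero σ.sgn_ne_zero hε.ne')
    have i1 : Integrable fun η => symb k η * g η := integrable_symb_mul_fourier hslit h1 h2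
    have i2 : MemLp (fun η => symb k η * g η) 2 := memLp_symb_mul_fourier hslit h1
    rw [integral_phase_mul_norm_sq_fourierInv i1 i2 τ]
    have hid := correlation_identity hslit h1 h2 hτ
    have hE := norm_antisymmetric_correlation_le (B := fun x => C * ε ^ γ * weight x ^ γ) h1 i1 hu
      (by
        refine (hΦ.const_mul (C * ε ^ γ)).congr (ae_of_all _ fun x => ?_)
        ring) (hm ε hε hεδ.2) τ
    rw [← hg] at hid
    rw [hid] at hE
    have hIeq : ∫ x, ‖Φ x‖ * (C * ε ^ γ * weight x ^ γ) = C * ε ^ γ * I := by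
      rw [hI, ← integral_const_mul]
      refine integral_congr_ae (ae_of_all _ fun x => ?_)
      ring
    rw [hIeq] at hE
    set A := ∫ η : ℝ, conj (symb k η * g η) * (symb k (η + τ) * g (η + τ)) with hA
    set R := ∫ η in Ioc (-τ) 0, conj (g η) * (symb k (η + τ) * g (η + τ)) with hR
    set D : ℂ := (2 * Real.pi * τ : ℝ) - 2 * k.im * Complex.I with hD
    set c : ℝ := -(‖g 0‖ ^ 2 / l) with hc
    have hc0 : c ≤ 0 := by
      rw [hc, neg_nonpos]
      positivity
    have hDre : D.re = 2 * Real.pi * τ := by simp [hD]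
    have hDim : D.im = -(2 * (σ.sgn * ε)) := by simp [hD, hkim]
    have hDτ : τ ≤ ‖D‖ := by
      have := Complex.abs_re_le_norm D
      rw [hDre, abs_of_pos (by positivity)] at this
      nlinarith [Real.pi_gt_three]
    have hDε : ε ≤ ‖D‖ := by
      have := Complex.abs_im_le_norm D
      rw [hDim, abs_neg, abs_mul, abs_mul, σ.abs_sgn, abs_of_pos hε] at this
      norm_num at this
      linarith
    have hDpos : 0 < ‖D‖ := hτ.trans_le hDτ
    have hD0 : D ≠ 0 := norm_pos_iff.1 hDpos
    have hRc : ‖R - τ * c‖ ≤ κ * τ := by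
      have iR : IntegrableOn (fun η => conj (g η) * (symb k (η + τ) * g (η + τ))) (Ioc (-τ) 0) := by
        refine Integrable.integrableOn ?_
        exact (i1.comp_add_right τ).bdd_mul (c := ∫ x, ‖Φ x‖) (by fun_prop)
          (ae_of_all _ fun η => by simpa using norm_fourier_le (f := Φ) η)
      have hvol : volume.real (Ioc (-τ) 0) = τ := by simp [Measure.real, hτ.le]
      have e1 : R - τ * c = ∫ η in Ioc (-τ) 0,
          (conj (g η) * (symb k (η + τ) * g (η + τ)) - c) := by
        rw [integral_sub iR (by simp), setIntegral_const, hvol]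
        simp [hR]
      rw [e1]
      have e2 := norm_setIntegral_le_of_norm_le_const (μ := volume) (s := Ioc (-τ) 0) (C := κ)
        (f := fun η => conj (g η) * (symb k (η + τ) * g (η + τ)) - c) (by simp) ?_
      · rwa [hvol] at e2
      · intro η hη
        rcases hη with ⟨hη1, hη2⟩
        have hq : dist ((η, η + τ, ε) : ℝ × ℝ × ℝ) 0 < δ := by
          rw [dist_zero_right, Prod.norm_def, Prod.norm_def]
          simp only [Real.norm_eq_abs, sup_lt_iff, abs_lt]
          refine ⟨⟨?_, ?_⟩, ⟨?_, ?_⟩, ?_, ?_⟩ <;> linarith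
        have h3 := (hball hq).le
        rw [hΨ0, dist_eq_norm] at h3
        rw [symb_of_pos k (by linarith : 0 < η + τ)]
        exact h3
    -- The three terms have real parts at most 0 (since c ≤ 0 and Re D > 0), at most κ (since τ ≤
    -- |D|), and at most the antisymmetric error divided by |D|.
    have hAeq : A = (τ * c : ℝ) / D + (R - τ * c) / D + (D * A - R) / D := by
      field_simp
      push_cast
      ring
    have t1 : (((τ * c : ℝ) : ℂ) / D).re ≤ 0 := by
      rw [Complex.div_re, Complex.ofReal_re, Complex.ofReal_im, hDre]
      have : 0 ≤ Complex.normSq D := Complex.normSq_nonneg D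
      have h4 : τ * c * (2 * Real.pi * τ) ≤ 0 := by
        have : τ * c * (2 * Real.pi * τ) = c * (2 * Real.pi * τ ^ 2) := by ring
        rw [this]
        exact mul_nonpos_of_nonpos_of_nonneg hc0 (by positivity)
      simpa using div_nonpos_of_nonpos_of_nonneg h4 this
    have t2 : ((R - τ * c) / D).re ≤ κ := by
      refine (Complex.re_le_norm _).trans ?_
      rw [norm_div, div_le_iff₀ hDpos]
      exact hRc.trans (by gcongr)
    have t3 : ((D * A - R) / D).re ≤ (2 * C * I) * ε ^ (γ / 2) * τ ^ (γ / 2 - 1) := by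
      refine (Complex.re_le_norm _).trans ?_
      rw [norm_div, div_le_iff₀ hDpos]
      refine hE.trans ?_
      -- Half of the gain ε^γ pays for the singularity of 1/|D|; the other half is kept.
      have h5 := rpow_mul_rpow_le_norm (θ := γ / 2) hτ.le hε.le (by linarith) (by linarith) hDτ hDε
      calc 2 * (C * ε ^ γ * I) = (2 * C * I) * ε ^ (γ / 2) * τ ^ (γ / 2 - 1) *
            (τ ^ (1 - γ / 2) * ε ^ (γ / 2)) := by
            have e3 : τ ^ (γ / 2 - 1) * τ ^ (1 - γ / 2) = 1 := by
              rw [← Real.rpow_add hτ]; simp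
            have e4 : ε ^ (γ / 2) * ε ^ (γ / 2) = ε ^ γ := by
              rw [← Real.rpow_add hε]; simp
            rw [← e4]
            linear_combination (-(2 * C * I) * (ε ^ (γ / 2) * ε ^ (γ / 2))) * e3
        _ ≤ _ := by gcongr
    rw [hAeq, Complex.add_re, Complex.add_re]
    linarith
  refine ⟨min δ ε₀, by positivity, fun ε hε hεδ τ hτ hτδ => ?_⟩
  rcases lt_or_gt_of_ne hτ with h | h
  · have := hmain ε hε hεδ (-τ) (by linarith) (by rwa [abs_of_neg h] at hτδ)
    rw [abs_of_neg h]
    simpa using this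
  -- The density is real, so the transforms at τ and -τ are conjugate and have the same real part.
  · have := hmain ε hε hεδ τ h (by rwa [abs_of_pos h] at hτδ)
    rw [abs_of_pos h]
    refine le_of_eq_of_le ?_ this
    rw [← Complex.conj_re, ← integral_conj]
    congr 1
    refine integral_congr_ae (ae_of_all _ fun x => ?_)
    simp only [map_mul, ← Complex.exp_conj, Complex.conj_ofReal, Complex.conj_I,
      Complex.conj_ofNat]
    congr 2
    push_cast
    ring

/-! ### Averaging over small frequencies and vanishing on the cut -/

/-- The average of the characters `e^{2πixt}` over `0 < t ≤ d`. -/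
def charAverage (d x : ℝ) : ℂ :=
  (1 / d : ℂ) * ∫ t in Ioc 0 d, Complex.exp (2 * Real.pi * x * t * Complex.I)

theorem norm_charAverage_sub_one_le {d : ℝ} (hd : 0 < d) (x : ℝ) :
    ‖charAverage d x - 1‖ ≤ 2 * Real.pi * |x| * d := by
  have hdc : (d : ℂ) ≠ 0 := by exact_mod_cast hd.ne'
  have hvol : volume.real (Ioc 0 d) = d := by simp [Measure.real, hd.le]
  have hi : IntegrableOn (fun t : ℝ => Complex.exp (2 * Real.pi * x * t * Complex.I)) (Ioc 0 d) :=
    (Continuous.integrableOn_Icc (by fun_prop)).mono_set Ioc_subset_Icc_self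
  have e1 : charAverage d x - 1 = (1 / d : ℂ) *
      ∫ t in Ioc 0 d, (Complex.exp (2 * Real.pi * x * t * Complex.I) - 1) := by
    rw [integral_sub hi (by simp), setIntegral_const, hvol, charAverage]
    simp only [Complex.real_smul, mul_one]
    rw [mul_sub, one_div, inv_mul_cancel₀ hdc]
  have e2 := norm_setIntegral_le_of_norm_le_const (μ := volume) (s := Ioc 0 d)
    (C := 2 * Real.pi * |x| * d)
    (f := fun t : ℝ => Complex.exp (2 * Real.pi * x * t * Complex.I) - 1) (by simp) ?_
  · rw [hvol] at e2
    rw [e1, norm_mul, norm_div, norm_one, Complex.norm_real, Real.norm_of_nonneg hd.le]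
    calc 1 / d * _ ≤ 1 / d * (2 * Real.pi * |x| * d * d) := by gcongr
      _ = _ := by field_simp
  · intro t ht
    have h := norm_exp_sub_exp_le (z := 2 * Real.pi * x * t * Complex.I) (w := 0)
      (by simp) (by simp)
    rw [Complex.exp_zero, sub_zero] at h
    refine h.trans ?_
    have : ‖(2 * Real.pi * x * t * Complex.I : ℂ)‖ = 2 * Real.pi * |x| * t := by
      simp [abs_of_pos Real.pi_pos, abs_of_pos ht.1]
    rw [this]
    have := ht.2
    have := Real.pi_pos
    gcongr

theorem norm_charAverage_le_one {d : ℝ} (hd : 0 < d) (x : ℝ) : ‖charAverage d x‖ ≤ 1 := by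
  have hvol : volume.real (Ioc 0 d) = d := by simp [Measure.real, hd.le]
  have e2 := norm_setIntegral_le_of_norm_le_const (μ := volume) (s := Ioc 0 d) (C := 1)
    (f := fun t : ℝ => Complex.exp (2 * Real.pi * x * t * Complex.I)) (by simp)
    fun t _ => (norm_exp_phase x t).le
  rw [hvol, one_mul] at e2
  rw [charAverage, norm_mul, norm_div, norm_one, Complex.norm_real, Real.norm_of_nonneg hd.le]
  calc 1 / d * _ ≤ 1 / d * d := by gcongr
    _ = 1 := by field_simp

theorem continuous_charAverage (d : ℝ) : Continuous (charAverage d) := by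
  unfold charAverage
  refine continuous_const.mul ?_
  refine continuous_of_dominated (bound := fun _ => 1) (fun x => by fun_prop)
    (fun x => ae_of_all _ fun t => (norm_exp_phase x t).le) (by simp)
    (ae_of_all _ fun t => by fun_prop)

theorem integrable_abs_rpow {θ : ℝ} (hθ : 0 < θ) :
    Integrable ((Ioo (-1 : ℝ) 1).indicator fun y : ℝ => |y| ^ (θ - 1)) := by
  rw [integrable_indicator_iff measurableSet_Ioo]
  have h1 : IntegrableOn (fun y : ℝ => y ^ (θ - 1)) (Ioc 0 1) := by
    have := intervalIntegral.intervalIntegrable_rpow' (a := 0) (b := 1) (r := θ - 1) (by linarith)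
    rwa [intervalIntegrable_iff_integrableOn_Ioc_of_le zero_le_one] at this
  have h2 : IntegrableOn (fun y : ℝ => |y| ^ (θ - 1)) (Ioc 0 1) :=
    h1.congr_fun (fun y hy => by simp only [abs_of_pos hy.1]) measurableSet_Ioc
  have h3 : IntegrableOn (fun y : ℝ => |y| ^ (θ - 1)) (Ico (-1) 0) := by
    have := h2.comp_neg
    simpa using this
  refine (h3.union ((integrableOn_Icc_iff_integrableOn_Ioc (a := (0 : ℝ)) (b := 1)).2 h2)).mono_set ?_
  intro y hy
  rcases lt_or_ge y 0 with h | h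
  · exact Or.inl ⟨hy.1.le, h⟩
  · exact Or.inr ⟨h, hy.2.le⟩

/-- Averaging a one-sided bound for the Fourier transform of a positive function. -/
theorem integral_mul_norm_sq_charAverage_le {N : ℝ → ℝ} (hN : Integrable N) {d κ W θ : ℝ}
    (hd : 0 < d) (hd1 : d < 1) (hW : 0 ≤ W) (hθ : 0 < θ)
    (hU : ∀ τ : ℝ, τ ≠ 0 → |τ| < d →
      (∫ x : ℝ, Complex.exp (2 * Real.pi * x * τ * Complex.I) * (N x : ℂ)).re ≤
        κ + W * |τ| ^ (θ - 1)) :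
    ∫ x, N x * ‖charAverage d x‖ ^ 2 ≤
      κ + W / d * ∫ y, (Ioo (-1 : ℝ) 1).indicator (fun y : ℝ => |y| ^ (θ - 1)) y := by
  set V : ℝ → ℝ := (Ioo (-1 : ℝ) 1).indicator fun y : ℝ => |y| ^ (θ - 1) with hV
  have hVi : Integrable V := integrable_abs_rpow hθ
  -- The squared modulus of the average is d⁻² ∬ e^{2πix(t-t')} dt dt', so after Fubini only
  -- transforms at the differences t - t' appear. The diagonal, where no bound is available, is
  -- null.
  set μ : Measure ℝ := volume.restrict (Ioc 0 d) with hμ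
  have hμu : μ.real univ = d := by simp [hμ, Measure.real, hd.le]
  set e : ℝ → ℝ × ℝ → ℂ := fun x p => Complex.exp (2 * Real.pi * x * (p.1 - p.2 : ℝ) * Complex.I)
    with he
  have hsq : ∀ x, ((‖charAverage d x‖ ^ 2 : ℝ) : ℂ) = (1 / d ^ 2 : ℂ) * ∫ p, e x p ∂(μ.prod μ) := by
    intro x
    have h1 : ∫ p, e x p ∂(μ.prod μ) = (∫ t, Complex.exp (2 * Real.pi * x * t * Complex.I) ∂μ) *
        ∫ t, conj (Complex.exp (2 * Real.pi * x * t * Complex.I)) ∂μ := by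
      rw [← integral_prod_mul]
      refine integral_congr_ae (ae_of_all _ fun p => ?_)
      simp only [he, ← Complex.exp_conj, ← Complex.exp_add, map_mul, Complex.conj_ofReal,
        Complex.conj_I, Complex.conj_ofNat]
      congr 1
      push_cast
      ring
    rw [h1, integral_conj, ← Complex.normSq_eq_norm_sq, ← Complex.mul_conj, charAverage]
    simp only [map_mul, map_div₀, map_one, Complex.conj_ofReal]
    ring
  have hint : Integrable (fun q : ℝ × (ℝ × ℝ) => (N q.1 : ℂ) * e q.1 q.2)
      (volume.prod (μ.prod μ)) := by
    have h1 : Integrable (fun q : ℝ × (ℝ × ℝ) => (N q.1 : ℂ) * 1) (volume.prod (μ.prod μ)) :=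
      hN.ofReal.mul_prod (integrable_const (1 : ℂ))
    simp only [mul_one] at h1
    refine h1.mul_bdd (c := 1) (by fun_prop) (ae_of_all _ fun q => ?_)
    exact (norm_exp_phase q.1 (q.2.1 - q.2.2)).le
  have hconv : Integrable (fun p : ℝ × ℝ => V (p.1 - p.2)) (μ.prod μ) := by
    have h1 : Integrable (fun _ : ℝ => (1 : ℝ)) μ := integrable_const _
    have h2 := h1.convolution_integrand (ContinuousLinearMap.mul ℝ ℝ) hVi
    simp only [ContinuousLinearMap.mul_apply', one_mul] at h2
    exact h2.mono_measure (Measure.prod_mono Measure.restrict_le_self le_rfl)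
  -- For each fixed t' the inner integral is at most the full integral of V; this loses one power of
  -- d, hence W / d in the conclusion.
  have hconvle : ∫ p : ℝ × ℝ, V (p.1 - p.2) ∂(μ.prod μ) ≤ d * ∫ y, V y := by
    have hV0 : ∀ y, 0 ≤ V y := fun y => indicator_nonneg (fun y _ => by positivity) y
    rw [integral_prod_symm _ hconv]
    have h3 : ∀ t', ∫ t, V (t - t') ∂μ ≤ ∫ y, V y := by
      intro t'
      rw [← integral_sub_right_eq_self V t']
      exact setIntegral_le_integral (hVi.comp_sub_right t') (ae_of_all _ fun t => hV0 _)
    calc _ ≤ ∫ _t', ∫ y, V y ∂volume ∂μ :=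
          integral_mono hconv.integral_prod_right (integrable_const _) h3
      _ = _ := by rw [integral_const, hμu, smul_eq_mul]
  have hN2 : Integrable fun x => N x * ‖charAverage d x‖ ^ 2 := by
    have := continuous_charAverage d
    refine hN.mul_bdd (c := 1) (by fun_prop) (ae_of_all _ fun x => ?_)
    rw [norm_pow, norm_norm]
    exact pow_le_one₀ (norm_nonneg _) (norm_charAverage_le_one hd x)
  have hswap : ((∫ x, N x * ‖charAverage d x‖ ^ 2 : ℝ) : ℂ) = (1 / d ^ 2 : ℂ) *
      ∫ p, ∫ x, (N x : ℂ) * e x p ∂volume ∂(μ.prod μ) := by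
    rw [← integral_integral_swap hint, ← integral_const_mul]
    refine (integral_ofReal (𝕜 := ℂ)).symm.trans (integral_congr_ae (ae_of_all _ fun x => ?_))
    simp only [Complex.coe_algebraMap, Complex.ofReal_mul]
    rw [show ((‖charAverage d x‖ ^ 2 : ℝ) : ℂ) = _ from hsq x, integral_const_mul]
    ring
  have hre : ∫ x, N x * ‖charAverage d x‖ ^ 2 = (1 / d ^ 2) *
      ∫ p, (∫ x, (N x : ℂ) * e x p).re ∂(μ.prod μ) := by
    have h4 : ∫ p, (∫ x, (N x : ℂ) * e x p).re ∂(μ.prod μ) =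
        (∫ p, ∫ x, (N x : ℂ) * e x p ∂volume ∂(μ.prod μ)).re :=
      integral_re (𝕜 := ℂ) hint.integral_prod_right
    rw [h4, ← Complex.ofReal_re (∫ x, N x * ‖charAverage d x‖ ^ 2), hswap,
      show (1 / d ^ 2 : ℂ) = ((1 / d ^ 2 : ℝ) : ℂ) by push_cast; rfl, Complex.re_ofReal_mul]
  have hne : ∀ᵐ p ∂(μ.prod μ), p.1 ≠ p.2 ∧ |p.1 - p.2| < d := by
    have h5 : ∀ᵐ p ∂(μ.prod μ), p.1 ≠ p.2 := by
      rw [Measure.ae_prod_iff_ae_ae]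
      · refine ae_of_all _ fun t => ?_
        have : ∀ᵐ t' ∂(volume : Measure ℝ), t ≠ t' := by simp [ae_iff]
        exact ae_restrict_of_ae this
      · exact (measurableSet_eq_fun measurable_fst measurable_snd).compl
    have h6 : ∀ᵐ p ∂(μ.prod μ), p ∈ Ioc 0 d ×ˢ Ioc 0 d := by
      rw [hμ, Measure.prod_restrict]
      exact ae_restrict_mem (measurableSet_Ioc.prod measurableSet_Ioc)
    filter_upwards [h5, h6] with p h7 h8
    refine ⟨h7, abs_lt.2 ⟨?_, ?_⟩⟩ <;> linarith [h8.1.1, h8.1.2, h8.2.1, h8.2.2]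
  have hle : ∫ p, (∫ x, (N x : ℂ) * e x p).re ∂(μ.prod μ) ≤
      ∫ p, (κ + W * V (p.1 - p.2)) ∂(μ.prod μ) := by
    refine integral_mono_ae (hint.integral_prod_right.re)
      ((integrable_const κ).add (hconv.const_mul W)) ?_
    filter_upwards [hne] with p hp
    have h9 := hU (p.1 - p.2) (sub_ne_zero.2 hp.1) hp.2
    have h10 : V (p.1 - p.2) = |p.1 - p.2| ^ (θ - 1) := by
      refine indicator_of_mem ?_ _
      have := abs_lt.1 (hp.2.trans hd1)
      exact this
    rw [h10]
    refine le_of_eq_of_le ?_ h9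
    congr 1
    refine integral_congr_ae (ae_of_all _ fun x => ?_)
    simp only [he]
    ring
  rw [hre]
  rw [integral_add (integrable_const κ) (hconv.const_mul W), integral_const, integral_const_mul]
    at hle
  have huniv : (μ.prod μ).real univ = d ^ 2 := by
    rw [← univ_prod_univ, measureReal_prod_prod, hμu, sq]
  rw [huniv, smul_eq_mul] at hle
  calc _ ≤ 1 / d ^ 2 * (d ^ 2 * κ + W * (d * ∫ y, V y)) := by
        gcongr
        refine hle.trans ?_
        gcongr
    _ = _ := by field_simp

/-- The homogeneous equation has no nonzero solution at boundary points. -/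
theorem ae_eq_zero_of_boundary {l : ℝ} (hl : 0 < l) (σ : Side) {Φ m : ℝ → ℂ} {u : ℝ → ℝ}
    (h1 : Integrable Φ) (h2 : MemLp Φ 2) (hu : ∀ᵐ x, Φ x = u x * m x) {γ C ε₀ : ℝ} (hγ : 0 < γ)
    (hγ1 : γ < 1) (hΦ : Integrable fun x => ‖Φ x‖ * weight x ^ γ) (hC : 0 ≤ C) (hε₀ : 0 < ε₀)
    (hm : ∀ ε : ℝ, 0 < ε → ε < ε₀ → ∀ᵐ x, ‖𝓕⁻ (fun η =>
      symb (l + σ.sgn * ε * Complex.I) η * 𝓕 Φ η) x - m x‖ ≤ C * ε ^ γ * weight x ^ γ) :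
    m =ᵐ[volume] 0 := by
  set w₀ := ∫ y, (Ioo (-1 : ℝ) 1).indicator (fun y : ℝ => |y| ^ (γ / 2 - 1)) y with hw₀
  set K := 2 * C * ∫ x, ‖Φ x‖ * weight x ^ γ with hK
  have hK0 : 0 ≤ K := by
    have : 0 ≤ ∫ x, ‖Φ x‖ * weight x ^ γ := integral_nonneg fun x =>
      mul_nonneg (norm_nonneg _) (weight_rpow_pos x γ).le
    positivity
  set p : ℝ → ℝ → ℂ := fun ε => 𝓕⁻ fun η => symb (l + σ.sgn * ε * Complex.I) η * 𝓕 Φ η with hp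
  have hslit : ∀ ε : ℝ, 0 < ε → -((l : ℂ) + σ.sgn * ε * Complex.I) ∈ Complex.slitPlane :=
    fun ε hε => neg_mem_slitPlane_of_im (by
      simpa using ⟨σ.sgn_ne_zero, hε.ne'⟩)
  have hpc : ∀ ε : ℝ, 0 < ε → Continuous (p ε) := fun ε hε =>
    continuous_fourierInv (integrable_symb_mul_fourier (hslit ε hε) h1 h2)
  have hp2 : ∀ ε : ℝ, 0 < ε → MemLp (p ε) 2 := fun ε hε =>
    memLp_fourierInv (integrable_symb_mul_fourier (hslit ε hε) h1 h2)
      (memLp_symb_mul_fourier (hslit ε hε) h1)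
  set ε : ℕ → ℝ := fun n => ((n : ℝ) + 1)⁻¹ with hε
  have hεpos : ∀ n, 0 < ε n := fun n => by positivity
  have hε0 : Tendsto ε atTop (𝓝 0) := by
    simpa [hε] using tendsto_one_div_add_atTop_nhds_zero_nat (𝕜 := ℝ)
  -- The window must shrink so that the averages tend to 1, but slowly enough that ε^{γ/2} / d =
  -- ε^{γ/4} still tends to 0.
  set d : ℕ → ℝ := fun n => ε n ^ (γ / 4) with hd
  have hdpos : ∀ n, 0 < d n := fun n => Real.rpow_pos_of_pos (hεpos n) _
  have hpow : ∀ a : ℝ, 0 < a → Tendsto (fun n => ε n ^ a) atTop (𝓝 0) := by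
    intro a ha
    have := hε0.rpow_const (p := a) (Or.inr ha.le)
    rwa [Real.zero_rpow ha.ne'] at this
  have hd0 : Tendsto d atTop (𝓝 0) := hpow _ (by linarith)
  have hae : ∀ᵐ x, ∀ n : ℕ, ε n < ε₀ → ‖p (ε n) x - m x‖ ≤ C * ε n ^ γ * weight x ^ γ := by
    rw [ae_all_iff]
    intro n
    by_cases hn : ε n < ε₀
    · filter_upwards [hm (ε n) (hεpos n) hn] with x hx _
      exact hx
    · exact ae_of_all _ fun x h => absurd h hn
  set f : ℕ → ℝ → ℝ≥0∞ := fun n x => ENNReal.ofReal (‖p (ε n) x‖ ^ 2 * ‖charAverage (d n) x‖ ^ 2)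
    with hf
  have hlim : ∀ᵐ x, Tendsto (fun n => f n x) atTop (𝓝 (ENNReal.ofReal (‖m x‖ ^ 2))) := by
    filter_upwards [hae] with x hx
    refine ENNReal.tendsto_ofReal ?_
    have t1 : Tendsto (fun n => p (ε n) x) atTop (𝓝 (m x)) := by
      rw [tendsto_iff_norm_sub_tendsto_zero]
      have t := ((hpow γ hγ).const_mul C).mul_const (weight x ^ γ)
      rw [mul_zero, zero_mul] at t
      refine squeeze_zero' (Eventually.of_forall fun n => norm_nonneg _) ?_ t
      filter_upwards [hε0.eventually_lt_const hε₀] with n hn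
      exact hx n hn
    have t2 : Tendsto (fun n => charAverage (d n) x) atTop (𝓝 1) := by
      rw [tendsto_iff_norm_sub_tendsto_zero]
      have t := hd0.const_mul (2 * Real.pi * |x|)
      rw [mul_zero] at t
      exact squeeze_zero (fun n => norm_nonneg _)
        (fun n => norm_charAverage_sub_one_le (hdpos n) x) t
    have := (t1.norm.pow 2).mul (t2.norm.pow 2)
    simpa using this
  have hfm : ∀ n, AEMeasurable (f n) := by
    intro n
    have := hpc (ε n) (hεpos n)
    have := continuous_charAverage (d n)
    exact Measurable.aemeasurable (ENNReal.measurable_ofReal.comp (by fun_prop))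
  have hbound : ∀ κ : ℝ, 0 < κ → ∀ᶠ n in atTop, ∫⁻ x, f n x ≤ ENNReal.ofReal (2 * κ) := by
    intro κ hκ
    obtain ⟨δ, hδ, hre⟩ := re_correlation_le hl σ h1 h2 hu hγ hγ1 hΦ hC hε₀ hm hκ
    have t := (hpow (γ / 4) (by linarith)).const_mul (K * w₀)
    rw [mul_zero] at t
    filter_upwards [hε0.eventually_lt_const hδ, hd0.eventually_lt_const hδ,
      hd0.eventually_lt_const one_pos, t.eventually_lt_const hκ] with n e1 e2 e3 e4
    have hN : Integrable fun x => ‖p (ε n) x‖ ^ 2 := (hp2 (ε n) (hεpos n)).integrable_norm_pow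
      (by norm_num)
    have hb := integral_mul_norm_sq_charAverage_le hN (κ := κ) (W := K * ε n ^ (γ / 2))
      (θ := γ / 2) (hdpos n) e3 (by have := hεpos n; positivity) (by linarith)
      fun τ hτ hτd => hre (ε n) (hεpos n) e1 τ hτ (hτd.trans e2)
    have hN2 : Integrable fun x => ‖p (ε n) x‖ ^ 2 * ‖charAverage (d n) x‖ ^ 2 := by
      have := continuous_charAverage (d n)
      refine hN.mul_bdd (c := 1) (by fun_prop) (ae_of_all _ fun x => ?_)
      rw [norm_pow, norm_norm]
      exact pow_le_one₀ (norm_nonneg _) (norm_charAverage_le_one (hdpos n) x)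
    rw [← ofReal_integral_eq_lintegral_ofReal hN2 (ae_of_all _ fun x => by positivity)]
    refine ENNReal.ofReal_le_ofReal (hb.trans ?_)
    have h3 : K * ε n ^ (γ / 2) / d n = K * ε n ^ (γ / 4) := by
      rw [mul_div_assoc, hd]
      dsimp only
      rw [← Real.rpow_sub (hεpos n)]
      congr 2
      ring
    rw [h3, ← hw₀]
    linarith
  have hzero : ∫⁻ x, ENNReal.ofReal (‖m x‖ ^ 2) = 0 := by
    -- Fatou's lemma transfers the bound to m, which was not known to be square integrable.
    have hle : ∀ κ : ℝ, 0 < κ → ∫⁻ x, ENNReal.ofReal (‖m x‖ ^ 2) ≤ ENNReal.ofReal (2 * κ) := by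
      intro κ hκ
      calc ∫⁻ x, ENNReal.ofReal (‖m x‖ ^ 2) = ∫⁻ x, liminf (fun n => f n x) atTop := by
            refine lintegral_congr_ae ?_
            filter_upwards [hlim] with x hx
            exact hx.liminf_eq.symm
        _ ≤ liminf (fun n => ∫⁻ x, f n x) atTop := lintegral_liminf_le' hfm
        _ ≤ _ := by
            refine liminf_le_of_le (by isBoundedDefault) fun b hb => ?_
            obtain ⟨n, h3, h4⟩ := (hb.and (hbound κ hκ)).exists
            exact h3.trans h4
    refine le_antisymm (ENNReal.le_of_forall_pos_le_add fun κ hκ _ => ?_) bot_le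
    have := hle (κ / 2) (by have : (0 : ℝ) < κ := hκ; positivity)
    rw [mul_div_cancel₀ _ (two_ne_zero)] at this
    simpa using this
  have hmm : AEMeasurable (fun x => ENNReal.ofReal (‖m x‖ ^ 2)) :=
    aemeasurable_of_tendsto_metrizable_ae atTop hfm hlim
  rw [lintegral_eq_zero_iff' hmm] at hzero
  filter_upwards [hzero] with x hx
  simpa using hx

/-! ### The Lax operator on the Fourier side -/

theorem fourierInv_mem_hardy {H : L2} (h : ∀ᵐ η : ℝ, η < 0 → H η = 0) : (𝓕⁻ H : L2) ∈ hardy := by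
  change ∀ᵐ ξ : ℝ, ξ < 0 → (𝓕 (𝓕⁻ H : L2) : L2) ξ = 0
  rwa [FourierTransform.fourier_fourierInv_eq]

theorem coeFn_cutoffNonneg (f : L2) :
    (cutoffNonneg f : ℝ → ℂ) =ᵐ[volume] (Ici (0 : ℝ)).indicator f :=
  MemLp.coeFn_toLp _

theorem norm_cutoffNonneg_le (f : L2) : ‖cutoffNonneg f‖ ≤ ‖f‖ := by
  refine Lp.norm_le_norm_of_ae_le ?_
  filter_upwards [coeFn_cutoffNonneg f] with x hx
  rw [hx]
  exact norm_indicator_le_norm_self _ _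

theorem fourierInv_sub_L2 (f g : L2) : (𝓕⁻ (f - g) : L2) = 𝓕⁻ f - 𝓕⁻ g :=
  map_sub (Lp.fourierTransformₗᵢ ℝ ℂ).symm f g

theorem norm_fourierInv_L2 (f : L2) : ‖(𝓕⁻ f : L2)‖ = ‖f‖ :=
  (Lp.fourierTransformₗᵢ ℝ ℂ).symm.norm_map f

theorem norm_fourier_L2 (f : L2) : ‖(𝓕 f : L2)‖ = ‖f‖ :=
  (Lp.fourierTransformₗᵢ ℝ ℂ).norm_map f

/-- The operator `L_u` in terms of Fourier transforms. -/
theorem isLaxImage_fourierInv {u : ℝ → ℝ} {H H' g : L2} (hH : ∀ᵐ η : ℝ, η < 0 → H η = 0)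
    (hH' : ∀ᵐ η : ℝ, H' η = (2 * Real.pi * η : ℝ) * H η)
    (hg : g =ᵐ[volume] fun x => (u x : ℂ) * (𝓕⁻ H : L2) x) {F : L2}
    (hF : ∀ᵐ η : ℝ, η < 0 → F η = 0) (hFeq : F = H' - cutoffNonneg (𝓕 g)) :
    IsLaxImage u ⟨𝓕⁻ H, fourierInv_mem_hardy hH⟩ ⟨𝓕⁻ F, fourierInv_mem_hardy hF⟩ := by
  refine ⟨𝓕⁻ (Complex.I • H'), g, derivCLM_fourierInv ?_, hg, ?_⟩
  · filter_upwards [hH', Lp.coeFn_smul Complex.I H'] with η h1 h2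
    rw [h2, Pi.smul_apply, h1, smul_eq_mul]
    push_cast
    ring
  · change (𝓕⁻ F : L2) = _
    rw [hFeq, fourierInv_sub_L2, FourierTransform.fourierInv_smul, smul_smul,
      one_div_mul_cancel Complex.I_ne_zero, one_smul]
    rfl

/-- A point of the resolvent set is not an eigenvalue. -/
theorem eq_zero_of_mem_laxResolventSet {u : ℝ → ℝ} {k : ℂ} (hk : k ∈ laxResolventSet u) {H g : L2}
    (hH : ∀ᵐ η : ℝ, η < 0 → H η = 0) (hg : g =ᵐ[volume] fun x => (u x : ℂ) * (𝓕⁻ H : L2) x)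
    (hHg : ∀ᵐ η : ℝ, 0 < η → ((2 * Real.pi * η : ℝ) - k) * H η = (𝓕 g : L2) η) : H = 0 := by
  obtain ⟨R, -, hR⟩ := hk
  have hkH : ∀ᵐ η : ℝ, η < 0 → (k • H : L2) η = 0 := by
    filter_upwards [hH, Lp.coeFn_smul k H] with η h1 h2 hη
    rw [h2, Pi.smul_apply, h1 hη, smul_zero]
  -- The equation identifies 2πη H with this L² function, so 𝓕⁻ H lies in the domain of L_u and L_u
  -- maps it to k times itself. The left inverse R then kills it.
  have hlax := isLaxImage_fourierInv (u := u) (H' := k • H + cutoffNonneg (𝓕 g)) hH (by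
    filter_upwards [hH, hHg, Lp.coeFn_smul k H, coeFn_cutoffNonneg (𝓕 g),
      Lp.coeFn_add (k • H) (cutoffNonneg (𝓕 g)), ae_ne_zero] with η h1 h2 h3 h4 h5 h6
    rw [h5, Pi.add_apply, h3, h4, Pi.smul_apply, smul_eq_mul]
    rcases lt_or_gt_of_ne h6 with h | h
    · rw [indicator_of_notMem (by simpa using h), h1 h]; simp
    · rw [indicator_of_mem (by simpa using h.le), ← h2 h]; ring) hg hkH (by simp)
  have h0 := hR _ _ hlax
  have h1 : (⟨𝓕⁻ (k • H), fourierInv_mem_hardy hkH⟩ : hardy) -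
      k • ⟨𝓕⁻ H, fourierInv_mem_hardy hH⟩ = 0 := by
    ext1
    simp [FourierTransform.fourierInv_smul]
  rw [h1, map_zero] at h0
  have h2 : (𝓕⁻ H : L2) = 0 := (congrArg Subtype.val h0).symm
  rw [← norm_eq_zero, ← norm_fourierInv_L2, h2, norm_zero]

/-- The half line `[0, ∞)` is contained in the spectrum of `L_u`. -/
theorem neg_mem_slitPlane_of_mem_laxResolventSet {u : ℝ → ℝ} (hu : MemLp u 2) {k : ℂ}
    (hk : k ∈ laxResolventSet u) : -k ∈ Complex.slitPlane := by
  by_contra hslit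
  rw [Complex.mem_slitPlane_iff, not_or, not_lt, not_not] at hslit
  obtain ⟨hre, him⟩ := hslit
  simp only [Complex.neg_re, Complex.neg_im, Left.neg_nonpos_iff, neg_eq_zero] at hre him
  obtain ⟨R, -, hR⟩ := hk
  set a := k.re / (2 * Real.pi) with ha
  have ha0 : 0 ≤ a := by positivity
  have hka : k = (2 * Real.pi * a : ℝ) := by
    apply Complex.ext
    · rw [Complex.ofReal_re, ha]
      field_simp
    · rw [him, Complex.ofReal_im]
  set U := (eLpNorm u 2 volume).toReal with hU
  -- Weyl sequence of wave packets with frequencies in [a, a + δ]. The packet has L² norm √δ but sup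
  -- norm at most δ, so the potential term has norm at most δ ‖u‖, and the free part minus k has
  -- norm at most 2πδ √δ. A bounded left inverse is impossible as δ → 0.
  have hmain : ∀ δ : ℝ, 0 < δ → 1 ≤ ‖R‖ * (2 * Real.pi * δ + Real.sqrt δ * U) := by
    intro δ hδ
    set S := Icc a (a + δ) with hS
    have hSv : volume S = ENNReal.ofReal δ := by simp [hS]
    have hSfin : volume S ≠ ∞ := by simp [hSv]
    have hSr : volume.real S = δ := by simp [Measure.real, hSv, hδ.le]
    set H : L2 := indicatorConstLp 2 measurableSet_Icc hSfin (1 : ℂ) with hH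
    have hHc : (H : ℝ → ℂ) =ᵐ[volume] S.indicator fun _ => (1 : ℂ) := indicatorConstLp_coeFn
    have hHn : ‖H‖ = Real.sqrt δ := by
      rw [hH, norm_indicatorConstLp (by norm_num) (by norm_num), hSr, norm_one, one_mul,
        Real.sqrt_eq_rpow]
      norm_num
    have hind1 : Integrable (S.indicator fun _ => (1 : ℂ)) :=
      (integrable_indicator_iff measurableSet_Icc).2 (integrableOn_const hSfin)
    have hind2 : MemLp (S.indicator fun _ => (1 : ℂ)) 2 := memLp_indicator_const 2 measurableSet_Icc
      1 (Or.inr hSfin)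
    have hphi : ∀ᵐ x : ℝ, ‖(𝓕⁻ H : L2) x‖ ≤ δ := by
      have : H = hind2.toLp _ := rfl
      rw [this]
      filter_upwards [coeFn_fourierInv_toLp hind1 hind2] with x hx
      rw [hx]
      refine (norm_fourierInv_le x).trans (le_of_eq ?_)
      simp_rw [norm_indicator_eq_indicator_norm]
      rw [integral_indicator measurableSet_Icc]
      simpa using hδ.le
    have hgm : MemLp (fun x => (u x : ℂ) * (𝓕⁻ H : L2) x) 2 := by
      refine (hu.norm.const_mul δ).mono' (hu.ofReal.aestronglyMeasurable.mul
        (Lp.aestronglyMeasurable _)) ?_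
      filter_upwards [hphi] with x hx
      rw [norm_mul, Complex.norm_real, mul_comm]
      gcongr
    set g : L2 := hgm.toLp _ with hg
    have hgn : ‖g‖ ≤ δ * U := by
      have : ‖g‖ ≤ δ * ‖hu.toLp u‖ := by
        refine Lp.norm_le_mul_norm_of_ae_le_mul ?_
        filter_upwards [hgm.coeFn_toLp, hu.coeFn_toLp, hphi] with x h1 h2 h3
        rw [h1, h2, norm_mul, Complex.norm_real, mul_comm]
        gcongr
      rwa [Lp.norm_toLp u hu] at this
    have hEb : ∀ η : ℝ, ‖(((2 * Real.pi * η : ℝ) : ℂ) - k) * S.indicator (fun _ => (1 : ℂ)) η‖ ≤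
        2 * Real.pi * δ * ‖S.indicator (fun _ => (1 : ℂ)) η‖ := by
      intro η
      rw [norm_mul]
      by_cases hη : η ∈ S
      · refine mul_le_mul_of_nonneg_right ?_ (norm_nonneg _)
        rw [hka, ← Complex.ofReal_sub, Complex.norm_real, ← mul_sub, norm_mul, Real.norm_of_nonneg
          (by positivity), Real.norm_of_nonneg (by linarith [hη.1])]
        have := hη.2
        gcongr
        linarith
      · simp [hη]
    have hEm : MemLp (fun η : ℝ => (((2 * Real.pi * η : ℝ) : ℂ) - k) *
        S.indicator (fun _ => (1 : ℂ)) η) 2 := by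
      refine (hind2.norm.const_mul (2 * Real.pi * δ)).mono'
        (AEStronglyMeasurable.mul (by fun_prop) hind2.aestronglyMeasurable) (ae_of_all _ hEb)
    set E : L2 := hEm.toLp _ with hE
    have hEn : ‖E‖ ≤ 2 * Real.pi * δ * Real.sqrt δ := by
      rw [← hHn]
      refine Lp.norm_le_mul_norm_of_ae_le_mul ?_
      filter_upwards [hEm.coeFn_toLp, hHc] with η h1 h2
      rw [h1, h2]
      exact hEb η
    have hH0 : ∀ᵐ η : ℝ, η < 0 → H η = 0 := by
      filter_upwards [hHc] with η h1 hη
      rw [h1, indicator_of_notMem]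
      exact fun h => absurd (ha0.trans h.1) (not_le.2 hη)
    have hE0 : ∀ᵐ η : ℝ, η < 0 → E η = 0 := by
      filter_upwards [hEm.coeFn_toLp] with η h1 hη
      rw [h1, indicator_of_notMem, mul_zero]
      exact fun h => absurd (ha0.trans h.1) (not_le.2 hη)
    set F : L2 := E + k • H - cutoffNonneg (𝓕 g) with hF
    have hF0 : ∀ᵐ η : ℝ, η < 0 → F η = 0 := by
      filter_upwards [hH0, hE0, Lp.coeFn_sub (E + k • H) (cutoffNonneg (𝓕 g)),
        Lp.coeFn_add E (k • H), Lp.coeFn_smul k H, coeFn_cutoffNonneg (𝓕 g)] with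
        η h1 h2 h3 h4 h5 h6 hη
      rw [hF, h3, Pi.sub_apply, h4, Pi.add_apply, h5, h6, Pi.smul_apply, h1 hη, h2 hη,
        indicator_of_notMem (by simpa using hη)]
      simp
    have hlax := isLaxImage_fourierInv (u := u) (H' := E + k • H) hH0 (by
      filter_upwards [hHc, hEm.coeFn_toLp, Lp.coeFn_add E (k • H), Lp.coeFn_smul k H] with
        η h1 h2 h3 h4
      rw [h3, Pi.add_apply, h4, h2, Pi.smul_apply, h1, smul_eq_mul]
      ring) hgm.coeFn_toLp hF0 hF
    have h0 := hR _ _ hlax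
    have h1 : ‖(⟨𝓕⁻ H, fourierInv_mem_hardy hH0⟩ : hardy)‖ ≤ ‖R‖ *
        ‖(⟨𝓕⁻ F, fourierInv_mem_hardy hF0⟩ : hardy) - k • ⟨𝓕⁻ H, fourierInv_mem_hardy hH0⟩‖ := by
      conv_lhs => rw [← h0]
      exact R.le_opNorm _
    have h2 : ‖(⟨𝓕⁻ F, fourierInv_mem_hardy hF0⟩ : hardy) -
        k • ⟨𝓕⁻ H, fourierInv_mem_hardy hH0⟩‖ ≤ 2 * Real.pi * δ * Real.sqrt δ + δ * U := by
      have h3 : ((⟨𝓕⁻ F, fourierInv_mem_hardy hF0⟩ : hardy) -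
          k • ⟨𝓕⁻ H, fourierInv_mem_hardy hH0⟩ : hardy).1 = 𝓕⁻ (E - cutoffNonneg (𝓕 g)) := by
        change (𝓕⁻ F : L2) - k • (𝓕⁻ H : L2) = _
        rw [← FourierTransform.fourierInv_smul, ← fourierInv_sub_L2, hF]
        congr 1
        abel
      refine (congrArg norm h3).trans_le ?_
      rw [norm_fourierInv_L2]
      refine (norm_sub_le _ _).trans (add_le_add hEn ?_)
      exact (norm_cutoffNonneg_le _).trans ((norm_fourier_L2 g).le.trans hgn)
    have h4 : ‖(⟨𝓕⁻ H, fourierInv_mem_hardy hH0⟩ : hardy)‖ = Real.sqrt δ := by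
      rw [← hHn, ← norm_fourierInv_L2]
      rfl
    rw [h4] at h1
    have h5 : 0 < Real.sqrt δ := Real.sqrt_pos.2 hδ
    have h6 : Real.sqrt δ * 1 ≤ Real.sqrt δ * (‖R‖ * (2 * Real.pi * δ + Real.sqrt δ * U)) := by
      calc Real.sqrt δ * 1 ≤ ‖R‖ * (2 * Real.pi * δ * Real.sqrt δ + δ * U) := by
            rw [mul_one]
            exact h1.trans (mul_le_mul_of_nonneg_left h2 R.opNorm_nonneg)
        _ = ‖R‖ * (2 * Real.pi * δ * Real.sqrt δ + (Real.sqrt δ * Real.sqrt δ) * U) := by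
            rw [Real.mul_self_sqrt hδ.le]
        _ = _ := by ring
    exact le_of_mul_le_mul_left h6 h5
  have hlim : Tendsto (fun δ : ℝ => ‖R‖ * (2 * Real.pi * δ + Real.sqrt δ * U)) (𝓝[>] 0) (𝓝 0) := by
    have : Continuous fun δ : ℝ => ‖R‖ * (2 * Real.pi * δ + Real.sqrt δ * U) := by fun_prop
    have h := this.tendsto 0
    simp only [mul_zero, Real.sqrt_zero, zero_mul, add_zero] at h
    exact h.mono_left nhdsWithin_le_nhds
  obtain ⟨δ, h1, h2⟩ := ((hlim.eventually_lt_const one_pos).and self_mem_nhdsWithin).exists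
  exact absurd (hmain δ h2) (not_le.2 h1)

/-- The homogeneous equation has no nonzero solution at points of the resolvent set. -/
theorem ae_eq_zero_of_mem_laxResolventSet {u : ℝ → ℝ} {k : ℂ} (hk : k ∈ laxResolventSet u)
    (hslit : -k ∈ Complex.slitPlane) {Φ m : ℝ → ℂ} (h1 : Integrable Φ) (h2 : MemLp Φ 2)
    (hu : ∀ᵐ x, Φ x = u x * m x)
    (hm : ∀ᵐ x, 𝓕⁻ (fun η => symb k η * 𝓕 Φ η) x = m x) : m =ᵐ[volume] 0 := by
  have i1 := integrable_symb_mul_fourier hslit h1 h2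
  have i2 := memLp_symb_mul_fourier hslit h1
  have hH : i2.toLp _ = 0 := by
    refine eq_zero_of_mem_laxResolventSet hk (g := h2.toLp Φ) ?_ ?_ ?_
    · filter_upwards [i2.coeFn_toLp] with η h hη
      rw [h, symb_of_nonpos k hη.le, zero_mul]
    · filter_upwards [h2.coeFn_toLp, hu, hm, coeFn_fourierInv_toLp i1 i2] with x e1 e2 e3 e4
      rw [e1, e2, e4, e3]
    · filter_upwards [i2.coeFn_toLp, coeFn_fourier_toLp h1 h2] with η e1 e2 hη
      have := sub_ne_zero_of_slit hslit (t := 2 * Real.pi * η) (by positivity)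
      rw [e1, e2, symb_of_pos k hη]
      field_simp
  have h3 := coeFn_fourierInv_toLp i1 i2
  have h4 : (𝓕⁻ (i2.toLp _) : L2) = 0 := by
    rw [hH]
    exact map_zero (Lp.fourierTransformₗᵢ ℝ ℂ).symm
  rw [h4] at h3
  filter_upwards [h3, hm, Lp.coeFn_zero ℂ 2 (volume : Measure ℝ)] with x e1 e2 e3
  rw [← e2, ← e1, e3]

/-! ### The homogeneous equation -/

section Homogeneous

variable {s₁ : ℝ}

theorem measurable_weight_rpow_ofReal (σ : ℝ) :
    Measurable fun y : ℝ => ((weight y ^ σ : ℝ) : ℂ) :=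
  Complex.measurable_ofReal.comp (measurable_weight_rpow σ)

theorem integrable_weight_rpow_mul (hs : 1 / 2 < s₁) (F : L2) :
    Integrable fun y => ((weight y ^ (-s₁) : ℝ) : ℂ) * F y :=
  integrable_mul_L2 (memLp_weight_rpow hs).ofReal F

theorem memLp_weight_rpow_mul (hs : 0 ≤ s₁) (F : L2) :
    MemLp (fun y => ((weight y ^ (-s₁) : ℝ) : ℂ) * F y) 2 := by
  refine (Lp.memLp F).mono ((measurable_weight_rpow_ofReal _).aestronglyMeasurable.mul
    (Lp.aestronglyMeasurable F)) (ae_of_all _ fun y => ?_)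
  rw [norm_mul, Complex.norm_real, Real.norm_of_nonneg (weight_rpow_pos y _).le]
  exact mul_le_of_le_one_left (norm_nonneg _) (weight_rpow_le_one hs y)

theorem integrable_norm_mul_weight_rpow {γ : ℝ} (hs : 1 / 2 < s₁ - γ) (F : L2) :
    Integrable fun y => ‖((weight y ^ (-s₁) : ℝ) : ℂ) * F y‖ * weight y ^ γ := by
  refine (integrable_weight_rpow_mul hs F).norm.congr (ae_of_all _ fun y => ?_)
  simp only [norm_mul, Complex.norm_real, Real.norm_of_nonneg (weight_rpow_pos y _).le]
  rw [mul_right_comm, ← Real.rpow_add (weight_pos y)]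
  congr 2
  ring

/-- Plancherel in the form `integral_fourierInv_mul` gives equality at every x, and the right side
is the inverse transform of an integrable function. -/
theorem weightedConv_kernel (hs : 1 / 2 < s₁) {k : ℂ} (hk : -k ∈ Complex.slitPlane) (F : L2)
    (x : ℝ) : weightedConv s₁ (kernel k) F x =
      𝓕⁻ (fun η => symb k η * 𝓕 (fun y => ((weight y ^ (-s₁) : ℝ) : ℂ) * F y) η) x := by
  have h := integral_fourierInv_mul (symbL2 k) (integrable_weight_rpow_mul hs F)
    (memLp_weight_rpow_mul (by linarith) F) x
  rw [fourierInv_apply, weightedConv]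
  calc _ = ∫ y, kernel k y * (((weight (x - y) ^ (-s₁) : ℝ) : ℂ) * F (x - y)) := by
        rw [← integral_sub_left_eq_self _ volume x]
        refine integral_congr_ae (ae_of_all _ fun y => ?_)
        simp only [sub_sub_cancel]
        ring
    _ = ∫ y, (𝓕⁻ (symbL2 k) : L2) y * (((weight (x - y) ^ (-s₁) : ℝ) : ℂ) * F (x - y)) := by
        refine integral_congr_ae ?_
        filter_upwards [coeFn_kernelL2 hk] with y hy
        rw [← hy, kernelL2]
    _ = _ := h
    _ = _ := by
        refine integral_congr_ae ?_
        filter_upwards [coeFn_symbL2 hk] with η hη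
        rw [hη]

theorem exists_admissibleKernel {b : ℝ} (hs : 1 / 2 < s₁) (hb : 0 ≤ b) {u : ℝ → ℝ}
    (hu : MemLp u 2) {z : SpectralPoint} (hz : z ∈ spectralDomain u) :
    ∃ C, AdmissibleKernel s₁ b C z.G := by
  cases z with
  | interior k =>
    exact admissibleKernel_kernel (by linarith) hb (neg_mem_slitPlane_of_mem_laxResolventSet hu hz)
  | boundary l σ =>
    have hl : 0 < l := hz
    obtain ⟨C, h⟩ := admissibleKernel_sideKernel hs hb (σ := σ) (k := l) (by simp) (by simpa)
    exact ⟨C, h.congr_ae (boundaryKernel_ae_eq_sideKernel hl σ).symm⟩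

/-- The homogeneous equation `m = G_z * (u m)` only has the trivial solution. -/
theorem weightedConv_ae_eq_zero (hs : 1 / 2 < s₁) {u : ℝ → ℝ} (hu : MemLp u 2) {z : SpectralPoint}
    (hz : z ∈ spectralDomain u) {F : L2}
    (hF : ∀ᵐ y, ((weight y ^ (-s₁) : ℝ) : ℂ) * F y = u y * weightedConv s₁ z.G F y) :
    weightedConv s₁ z.G F =ᵐ[volume] 0 := by
  cases z with
  | interior k =>
    have hslit := neg_mem_slitPlane_of_mem_laxResolventSet hu hz
    exact ae_eq_zero_of_mem_laxResolventSet hz hslit (integrable_weight_rpow_mul hs F)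
      (memLp_weight_rpow_mul (by linarith) F) hF
      (ae_of_all _ fun x => (weightedConv_kernel hs hslit F x).symm)
  | boundary l σ =>
    have hl : 0 < l := hz
    -- Small enough that Φ = w^{-s₁} F stays integrable after multiplication by w^γ. The comparison
    -- below uses target weight exactly w^γ, so s does not enter.
    set γ := min ((s₁ - 1 / 2) / 2) (1 / 2) with hγ
    have hγ0 : 0 < γ := lt_min (by linarith) (by norm_num)
    have hγ1 : γ ≤ 1 / 2 := min_le_right _ _
    have hγs : 1 / 2 < s₁ - γ := by
      have : γ ≤ (s₁ - 1 / 2) / 2 := min_le_left _ _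
      linarith
    obtain ⟨r, hr, C, hC, h⟩ := exists_holder_convOp_sideKernel hγ0.le (by linarith) hγs le_rfl σ
      (k₀ := l) (by simpa)
    refine ae_eq_zero_of_boundary hl σ (integrable_weight_rpow_mul hs F)
      (memLp_weight_rpow_mul (by linarith) F) hF hγ0 (by linarith)
      (integrable_norm_mul_weight_rpow hγs F) (C := C * ‖F‖) (by positivity) hr ?_
    intro ε hε hεr
    set k : ℂ := l + σ.sgn * ε * Complex.I with hk
    have hkl : k - l = σ.sgn * ε * Complex.I := by rw [hk]; ring
    have hnorm : ‖k - l‖ = ε := by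
      rw [hkl, norm_mul, norm_mul, Complex.norm_I, Complex.norm_real, Complex.norm_real,
        Real.norm_eq_abs, σ.abs_sgn, Real.norm_of_nonneg hε.le]
      ring
    have him : 0 < σ.sgn * k.im := by
      have : σ.sgn * k.im = (σ.sgn * σ.sgn) * ε := by simp [hk]; ring
      rw [this, σ.sgn_mul_self]
      linarith
    have hslit : -k ∈ Complex.slitPlane :=
      neg_mem_slitPlane_of_im fun h => by simp [h] at him
    -- Hölder continuity up to the cut, between l ± iε and l, is the approximation rate ε^γ w^γ
    -- required by `ae_eq_zero_of_boundary`.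
    obtain ⟨hkre, -, hH⟩ := h k l (by rwa [hnorm]) (by simpa using hr) him.le (by simp)
    rw [hnorm] at hH
    obtain ⟨C₁, a₁⟩ := admissibleKernel_sideKernel hs hγ0.le him.le hkre
    obtain ⟨C₂, a₂⟩ := admissibleKernel_sideKernel hs hγ0.le (σ := σ) (k := l) (by simp) (by simpa)
    set T := convOp s₁ γ (sideKernel σ k) - convOp s₁ γ (sideKernel σ l) with hT
    filter_upwards [a₁.coeFn_convOp F, a₂.coeFn_convOp F, Linf.ae_bound (T F),
      Lp.coeFn_sub (convOp s₁ γ (sideKernel σ k) F) (convOp s₁ γ (sideKernel σ l) F)] with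
      x e1 e2 e3 e4
    have e5 : T F = convOp s₁ γ (sideKernel σ k) F - convOp s₁ γ (sideKernel σ l) F := rfl
    rw [e5, e4, Pi.sub_apply, e1, e2, ← mul_sub, norm_weight_smul_le, ← e5] at e3
    rw [← weightedConv_kernel hs hslit,
      weightedConv_congr_ae (kernel_ae_eq_sideKernel him),
      show weightedConv s₁ (SpectralPoint.boundary l σ).G F x = weightedConv s₁ (sideKernel σ l) F x
        from weightedConv_congr_ae (boundaryKernel_ae_eq_sideKernel hl σ) ..]
    refine e3.trans ?_
    have e6 : ‖T F‖ ≤ C * ‖F‖ * ε ^ γ := by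
      calc ‖T F‖ ≤ ‖T‖ * ‖F‖ := T.le_opNorm F
        _ ≤ C * ε ^ γ * ‖F‖ := by gcongr
        _ = _ := by ring
    exact mul_le_mul_of_nonneg_right e6 (weight_rpow_pos x γ).le

end Homogeneous

/-! ### The integral equation as an operator equation -/

section Equation

variable {s s₁ : ℝ} {u : ℝ → ℝ}

theorem MemWeightedLp.memLp_of_nonneg (hs : 0 ≤ s) (hu : MemWeightedLp 2 s u) : MemLp u 2 := by
  have h : MemLp (fun x => weight x ^ s * u x) 2 := hu
  have hm : AEStronglyMeasurable u volume := by
    refine ((measurable_weight_rpow (-s)).aestronglyMeasurable.mul h.1).congr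
      (ae_of_all _ fun x => ?_)
    simp only [Pi.mul_apply]
    rw [← mul_assoc, ← Real.rpow_add (weight_pos x)]
    simp
  refine h.mono hm (ae_of_all _ fun x => ?_)
  rw [norm_mul, Real.norm_of_nonneg (weight_rpow_pos x s).le]
  exact le_mul_of_one_le_left (norm_nonneg _) (Real.one_le_rpow (one_le_weight x) hs)

/-- Multiplication by `w^s u`, from `L^∞` to `L²`. -/
def potentialOp (hu : MemWeightedLp 2 s u) : Linf →L[ℂ] L2 :=
  mulOp (v := fun x => weight x ^ s * u x) hu

/-- The powers of the weight balance: -s₁ + s - (s - s₁) = 0. -/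
theorem coeFn_potentialOp (hu : MemWeightedLp 2 s u) {m : ℝ → ℂ} {n : Linf}
    (hn : n =ᵐ[volume] fun x => ((weight x ^ (-(s - s₁)) : ℝ) : ℂ) * m x) :
    (fun y => (u y : ℂ) * m y) =ᵐ[volume]
      fun y => ((weight y ^ (-s₁) : ℝ) : ℂ) * potentialOp hu n y := by
  filter_upwards [coeFn_mulOp (v := fun x => weight x ^ s * u x) hu n, hn] with y h1 h2
  have h3 : weight y ^ (-s₁) * (weight y ^ s * weight y ^ (-(s - s₁))) = 1 := by
    rw [← Real.rpow_add (weight_pos y), ← Real.rpow_add (weight_pos y)]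
    ring_nf
    exact Real.rpow_zero _
  have h4 : ((weight y ^ (-s₁) : ℝ) : ℂ) *
      (((weight y ^ s : ℝ) : ℂ) * ((weight y ^ (-(s - s₁)) : ℝ) : ℂ)) = 1 := by
    exact_mod_cast h3
  rw [potentialOp, h1, h2]
  push_cast at h4 ⊢
  linear_combination (-(u y * m y : ℂ)) * h4

/-- A fixed point F of M A gives m = G_z * (w^{-s₁} F) with w^{-s₁} F = u m, a solution of the
homogeneous equation. Then m = 0, so F = 0, and compactness does the rest. -/
theorem isUnit_one_sub_potentialOp (hs₁ : 1 / 2 < s₁) (hs : s₁ < s) (hu : MemWeightedLp 2 s u)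
    {z : SpectralPoint} (hz : z ∈ spectralDomain u) :
    IsUnit (1 - potentialOp hu ∘L convOp s₁ (s - s₁) z.G) := by
  have hu2 : MemLp u 2 := MemWeightedLp.memLp_of_nonneg (by linarith) hu
  obtain ⟨C, hA⟩ := exists_admissibleKernel hs₁ (b := s - s₁) (by linarith) hu2 hz
  refine isUnit_one_sub_of_compact (hA.isCompactOperator _) fun F hF => ?_
  have h1 := coeFn_potentialOp (s₁ := s₁) hu (hA.coeFn_convOp F)
  have hF' : potentialOp hu (convOp s₁ (s - s₁) z.G F) = F := hF
  rw [hF'] at h1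
  have h2 := weightedConv_ae_eq_zero hs₁ hu2 hz (F := F) (h1.mono fun y hy => hy.symm)
  refine Lp.ext ?_
  filter_upwards [h1, h2, Lp.coeFn_zero ℂ 2 (volume : Measure ℝ)] with y e1 e2 e3
  rw [e2, Pi.zero_apply, mul_zero] at e1
  rw [e3, Pi.zero_apply]
  have : ((weight y ^ (-s₁) : ℝ) : ℂ) ≠ 0 := by exact_mod_cast (weight_rpow_pos y _).ne'
  exact (mul_eq_zero.1 e1.symm).resolve_left this

theorem convolution_eq_weightedConv (hu : MemWeightedLp 2 s u) {m : ℝ → ℂ} {n : Linf}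
    (hn : n =ᵐ[volume] fun x => ((weight x ^ (-(s - s₁)) : ℝ) : ℂ) * m x) (G : ℝ → ℂ) (x : ℝ) :
    convolution G (fun y => (u y : ℂ) * m y) (ContinuousLinearMap.mul ℂ ℂ) volume x =
      weightedConv s₁ G (potentialOp hu n) x := by
  rw [convolution, weightedConv, ← integral_sub_left_eq_self _ volume x]
  refine integral_congr_ae ?_
  filter_upwards [coeFn_potentialOp hu hn] with y hy
  simp only [ContinuousLinearMap.mul_apply', sub_sub_cancel]
  rw [hy]
  ring

theorem convolutionExists_of_admissibleKernel (hu : MemWeightedLp 2 s u) {m : ℝ → ℂ} {n : Linf}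
    (hn : n =ᵐ[volume] fun x => ((weight x ^ (-(s - s₁)) : ℝ) : ℂ) * m x) {G : ℝ → ℂ} {b C : ℝ}
    (hG : AdmissibleKernel s₁ b C G) :
    ConvolutionExists G (fun y => (u y : ℂ) * m y) (ContinuousLinearMap.mul ℂ ℂ) volume := by
  intro x
  have h1 : Integrable fun y => G (x - y) * ((u y : ℂ) * m y) := by
    refine (hG.integrable (potentialOp hu n) x).congr ?_
    filter_upwards [coeFn_potentialOp hu hn] with y hy
    rw [hy]
    ring
  have h2 := h1.comp_sub_left x
  simp only [sub_sub_cancel] at h2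
  exact h2

/-- Absolute convergence at every point is automatic for an admissible kernel, so only the almost
everywhere identity has content; division by the nonvanishing weight turns it into the operator
equation. -/
theorem solvesJost_iff (hu : MemWeightedLp 2 s u) {z : SpectralPoint} {C : ℝ}
    (hA : AdmissibleKernel s₁ (s - s₁) C z.G) {g m : ℝ → ℂ} {γ n : Linf}
    (hγ : γ =ᵐ[volume] fun x => ((weight x ^ (-(s - s₁)) : ℝ) : ℂ) * g x)
    (hn : n =ᵐ[volume] fun x => ((weight x ^ (-(s - s₁)) : ℝ) : ℂ) * m x) :
    SolvesJost u z g m ↔ n = γ + convOp s₁ (s - s₁) z.G (potentialOp hu n) := by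
  have hw : ∀ x, ((weight x ^ (-(s - s₁)) : ℝ) : ℂ) ≠ 0 := fun x => by
    exact_mod_cast (weight_rpow_pos x _).ne'
  have key : ∀ᵐ x, (n x = (γ + convOp s₁ (s - s₁) z.G (potentialOp hu n) : Linf) x ↔
      m x = g x + convolution z.G (fun y => (u y : ℂ) * m y)
        (ContinuousLinearMap.mul ℂ ℂ) volume x) := by
    filter_upwards [hγ, hn, hA.coeFn_convOp (potentialOp hu n),
      Lp.coeFn_add γ (convOp s₁ (s - s₁) z.G (potentialOp hu n))] with x h1 h2 h3 h4
    rw [h4, Pi.add_apply, h1, h2, h3, convolution_eq_weightedConv hu hn, ← mul_add]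
    exact mul_right_inj' (hw x)
  constructor
  · rintro ⟨-, h⟩
    refine Lp.ext ?_
    filter_upwards [key, h] with x h1 h2
    exact h1.2 h2
  · intro h
    refine ⟨convolutionExists_of_admissibleKernel hu hn hA, ?_⟩
    filter_upwards [key] with x h1
    exact h1.1 (congrArg (fun f : Linf => f x) h)

/-- Bounded data lead to bounded solutions. -/
theorem SolvesJost.memLp_top (hu : MemWeightedLp 2 s u) {z : SpectralPoint} {C : ℝ}
    (hA : AdmissibleKernel s₁ 0 C z.G) {g m : ℝ → ℂ} (hm : AEStronglyMeasurable m volume)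
    {n : Linf} (hn : n =ᵐ[volume] fun x => ((weight x ^ (-(s - s₁)) : ℝ) : ℂ) * m x)
    (hg : ∀ x, ‖g x‖ ≤ 1) (h : SolvesJost u z g m) : MemLp m ∞ := by
  refine memLp_top_of_bound hm (1 + C * ‖potentialOp hu n‖) ?_
  filter_upwards [h.2] with x hx
  rw [hx, convolution_eq_weightedConv hu hn]
  refine (norm_add_le _ _).trans (add_le_add (hg x) ?_)
  simpa using hA.norm_weightedConv_le (potentialOp hu n) x

end Equation

/-! ### Transfer to the weighted space -/

section Transfer

variable {b : ℝ}

theorem memWeightedLp_weight_mul (n : Linf) :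
    MemWeightedLp ∞ (-b) (fun x => ((weight x ^ b : ℝ) : ℂ) * n x) := by
  refine (memLp_congr_ae (ae_of_all _ fun x => ?_)).1 (Lp.memLp n)
  rw [Complex.real_smul, ← mul_assoc, ← Complex.ofReal_mul, ← Real.rpow_add (weight_pos x)]
  simp

/-- The class of `w^b n` in `L^∞_{-b}`. -/
def weightedClass (n : Linf) : WeightedLp ∞ (-b) :=
  ⟨AEEqFun.mk (fun x => ((weight x ^ b : ℝ) : ℂ) * n x)
    ((measurable_weight_rpow_ofReal b).aestronglyMeasurable.mul (Lp.aestronglyMeasurable n)),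
    MemWeightedLp.congr_ae (AEEqFun.coeFn_mk _ _).symm (memWeightedLp_weight_mul n)⟩

theorem coeFn_mulWeight (m : WeightedLp ∞ (-b)) : (WeightedLp.mulWeight ∞ (-b) m : ℝ → ℂ) =ᵐ[volume]
    fun x => ((weight x ^ (-b) : ℝ) : ℂ) * (m : ℝ →ₘ[volume] ℂ) x := by
  filter_upwards [(WeightedLp.memLp m).coeFn_toLp] with x hx
  rw [← Complex.real_smul]
  exact hx

theorem mulWeight_weightedClass (n : Linf) :
    WeightedLp.mulWeight ∞ (-b) (weightedClass n) = n := by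
  refine Lp.ext ?_
  have h := AEEqFun.coeFn_mk (fun x => ((weight x ^ b : ℝ) : ℂ) * n x)
    ((measurable_weight_rpow_ofReal b).aestronglyMeasurable.mul (Lp.aestronglyMeasurable n))
  filter_upwards [coeFn_mulWeight (b := b) (weightedClass n), h] with x h1 h2
  rw [h1]
  change _ * (AEEqFun.mk _ _ : ℝ →ₘ[volume] ℂ) x = _
  rw [h2, ← mul_assoc, ← Complex.ofReal_mul, ← Real.rpow_add (weight_pos x)]
  simp

theorem norm_mulWeight (m : WeightedLp ∞ (-b)) : ‖WeightedLp.mulWeight ∞ (-b) m‖ = ‖m‖ := rfl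

theorem norm_weightedClass (n : Linf) : ‖(weightedClass n : WeightedLp ∞ (-b))‖ = ‖n‖ := by
  rw [← norm_mulWeight, mulWeight_weightedClass]

theorem weightedClass_add (n n' : Linf) :
    (weightedClass (n + n') : WeightedLp ∞ (-b)) = weightedClass n + weightedClass n' := by
  refine WeightedLp.mulWeight_injective ∞ (-b) ?_
  rw [map_add, mulWeight_weightedClass, mulWeight_weightedClass, mulWeight_weightedClass]

theorem weightedClass_smul (c : ℂ) (n : Linf) :
    (weightedClass (c • n) : WeightedLp ∞ (-b)) = c • weightedClass n := by
  refine WeightedLp.mulWeight_injective ∞ (-b) ?_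
  rw [map_smul, mulWeight_weightedClass, mulWeight_weightedClass]

theorem weightedClass_sub (n n' : Linf) :
    (weightedClass (n - n') : WeightedLp ∞ (-b)) = weightedClass n - weightedClass n' := by
  refine WeightedLp.mulWeight_injective ∞ (-b) ?_
  rw [map_sub, mulWeight_weightedClass, mulWeight_weightedClass, mulWeight_weightedClass]

/-- Analyticity is preserved by additive and homogeneous contractions. -/
theorem AnalyticAt.contraction_comp {E Y X : Type*} [NormedAddCommGroup E] [NormedSpace ℂ E]
    [NormedAddCommGroup Y] [NormedSpace ℂ Y] [NormedAddCommGroup X] [NormedSpace ℂ X] {T : Y → X}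
    (hadd : ∀ x y, T (x + y) = T x + T y) (hsmul : ∀ (c : ℂ) x, T (c • x) = c • T x)
    (hT : ∀ x, ‖T x‖ ≤ ‖x‖) {f : E → Y} {z : E} (hf : AnalyticAt ℂ f z) :
    AnalyticAt ℂ (fun x => T (f x)) z := by
  let L : Y →L[ℂ] X := LinearMap.mkContinuous ⟨⟨T, hadd⟩, hsmul⟩ 1 fun x => by
    rw [one_mul]
    exact hT x
  exact (L.analyticAt _).comp hf

end Transfer

/-- Composition of an analytic map with a Hölder continuous curve. -/
theorem AnalyticAt.exists_holder_comp {E F : Type*} [NormedAddCommGroup E] [NormedSpace ℂ E]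
    [NormedAddCommGroup F] [NormedSpace ℂ F] {f : E → F} {p : ℂ → E} {S : Set ℂ} {k₀ : ℂ} {γ : ℝ}
    (hf : AnalyticAt ℂ f (p k₀)) (hγ : 0 < γ) (hk₀ : k₀ ∈ S) {r C : ℝ} (hr : 0 < r) (hC : 0 ≤ C)
    (hp : ∀ k ∈ S, ∀ k' ∈ S, ‖k - k₀‖ < r → ‖k' - k₀‖ < r →
      ‖p k - p k'‖ ≤ C * ‖k - k'‖ ^ γ) :
    ∃ r > 0, ∃ C : ℝ, ∀ k ∈ S, ∀ k' ∈ S, ‖k - k₀‖ < r → ‖k' - k₀‖ < r →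
      ‖f (p k) - f (p k')‖ ≤ C * ‖k - k'‖ ^ γ := by
  obtain ⟨ρ, hρ, D, hD, hfp⟩ := AnalyticAt.exists_holder hf
  have hlim : Tendsto (fun t : ℝ => C * t ^ γ) (𝓝[>] 0) (𝓝 0) := by
    have h := ((Real.continuous_rpow_const hγ.le).const_mul C).tendsto 0
    simp only [Real.zero_rpow hγ.ne', mul_zero] at h
    exact h.mono_left nhdsWithin_le_nhds
  -- For |k - k₀| < t the curve stays in the ball around p k₀ on which f is Lipschitz.
  obtain ⟨t, ht, ht0⟩ := ((hlim.eventually_lt_const hρ).and self_mem_nhdsWithin).exists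
  have ht0' : 0 < t := ht0
  have hball : ∀ k ∈ S, ‖k - k₀‖ < min r t → ‖p k - p k₀‖ < ρ := by
    intro k hk hkt
    rw [lt_min_iff] at hkt
    refine (hp k hk k₀ hk₀ hkt.1 (by simpa using hr)).trans_lt (lt_of_le_of_lt ?_ ht)
    gcongr
    exact hkt.2.le
  refine ⟨min r t, lt_min hr ht0', D * C, fun k hk k' hk' h h' => ?_⟩
  calc _ ≤ D * ‖p k - p k'‖ := hfp _ _ (hball k hk h) (hball k' hk' h')
    _ ≤ D * (C * ‖k - k'‖ ^ γ) := by
        gcongr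
        exact hp k hk k' hk' (h.trans_le (min_le_left _ _)) (h'.trans_le (min_le_left _ _))
    _ = _ := by ring

/-! ### The solutions -/

section Solutions

variable {s s₁ : ℝ} {u : ℝ → ℝ}

theorem norm_weightedClass_sub {b : ℝ} (n n' : Linf) :
    ‖(weightedClass n : WeightedLp ∞ (-b)) - weightedClass n'‖ = ‖n - n'‖ := by
  rw [← norm_weightedClass (b := b) (n - n'), weightedClass_sub]

/-- The solution `w^{-(s - s₁)} m` of `m = e^{ilx} + G_z * (u m)`. -/
def jostClass (hs : s₁ < s) (hu : MemWeightedLp 2 s u) (z : SpectralPoint) (l : ℝ) : Linf :=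
  fredholmSol (potentialOp hu)
    (convOp s₁ (s - s₁) z.G, planeWave (b := s - s₁) (sub_nonneg.2 hs.le) l)

theorem solvesJost_jostClass (hs₁ : 1 / 2 < s₁) (hs : s₁ < s) (hu : MemWeightedLp 2 s u)
    {z : SpectralPoint} (hz : z ∈ spectralDomain u) (l : ℝ) :
    SolvesJost u z (fun x => Complex.exp (Complex.I * l * x))
        ((weightedClass (jostClass hs hu z l) : WeightedLp ∞ (-(s - s₁))) : ℝ →ₘ[volume] ℂ) ∧
      MemLp ((weightedClass (jostClass hs hu z l) : WeightedLp ∞ (-(s - s₁))) :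
        ℝ →ₘ[volume] ℂ) ∞ volume ∧
      ∀ m : WeightedLp ∞ (-(s - s₁)),
        SolvesJost u z (fun x => Complex.exp (Complex.I * l * x)) (m : ℝ →ₘ[volume] ℂ) →
          m = weightedClass (jostClass hs hu z l) := by
  have hb : 0 ≤ s - s₁ := sub_nonneg.2 hs.le
  have hu2 : MemLp u 2 := MemWeightedLp.memLp_of_nonneg (by linarith) hu
  have hunit := isUnit_one_sub_potentialOp hs₁ hs hu hz
  obtain ⟨C, hA⟩ := exists_admissibleKernel hs₁ hb hu2 hz
  -- The kernel is also admissible with b = 0: its convolution with u m is bounded, which upgrades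
  -- the solution to L^∞.
  obtain ⟨C₀, hA₀⟩ := exists_admissibleKernel hs₁ le_rfl hu2 hz
  have hm := coeFn_mulWeight (b := s - s₁) (weightedClass (jostClass hs hu z l))
  rw [mulWeight_weightedClass] at hm
  have hsol := (solvesJost_iff hu hA (coeFn_planeWave hb l) hm).2 (fredholmSol_eq hunit)
  refine ⟨hsol, ?_, fun m hsolm => ?_⟩
  · exact hsol.memLp_top hu hA₀ (AEEqFun.aestronglyMeasurable _) hm
      (fun x => (norm_planeWave l x).le)
  · have h1 := (solvesJost_iff hu hA (coeFn_planeWave hb l) (coeFn_mulWeight m)).1 hsolm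
    refine WeightedLp.mulWeight_injective ∞ (-(s - s₁)) ?_
    rw [mulWeight_weightedClass]
    exact eq_fredholmSol hunit h1

theorem analyticAt_jostClass (hs₁ : 1 / 2 < s₁) (hs : s₁ < s) (hu : MemWeightedLp 2 s u) {k : ℂ}
    (hk : k ∈ laxResolventSet u) (l : ℝ) :
    AnalyticAt ℂ (fun k => jostClass hs hu (.interior k) l) k := by
  have hu2 : MemLp u 2 := MemWeightedLp.memLp_of_nonneg (by linarith) hu
  have hslit := neg_mem_slitPlane_of_mem_laxResolventSet hu2 hk
  have h1 : AnalyticAt ℂ (fun k => (convOp s₁ (s - s₁) (kernel k),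
      planeWave (b := s - s₁) (sub_nonneg.2 hs.le) l)) k :=
    (analyticAt_convOp_kernel (by linarith) (sub_nonneg.2 hs.le) hslit).prod analyticAt_const
  exact (analyticAt_fredholmSol (isUnit_one_sub_potentialOp hs₁ hs hu
    (z := .interior k) hk)).comp_of_eq h1 rfl

theorem exists_holder_jostClass_interior (hs₁ : 1 / 2 < s₁) (hs : s₁ < s)
    (hu : MemWeightedLp 2 s u) {γ : ℝ} (hγ1 : γ ≤ 1) {k : ℂ} (hk : k ∈ laxResolventSet u)
    (l : ℝ) : ∃ r > 0, ∃ C : ℝ, ∀ k₁ k₂ : ℂ, ‖k₁ - k‖ < r → ‖k₂ - k‖ < r →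
      ‖jostClass hs hu (.interior k₁) l - jostClass hs hu (.interior k₂) l‖ ≤
        C * ‖k₁ - k₂‖ ^ γ := by
  obtain ⟨r, hr, C, hC, h⟩ := AnalyticAt.exists_holder (analyticAt_jostClass hs₁ hs hu hk l)
  refine ⟨min r (1 / 2), by positivity, C, fun k₁ k₂ h₁ h₂ => ?_⟩
  rw [lt_min_iff] at h₁ h₂
  refine (h k₁ k₂ h₁.1 h₂.1).trans (mul_le_mul_of_nonneg_left ?_ hC)
  refine le_rpow_of_le_one (norm_nonneg _) ?_ hγ1
  have := norm_sub_le (k₁ - k) (k₂ - k)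
  rw [sub_sub_sub_cancel_right] at this
  linarith [h₁.2, h₂.2]

/-- The value of `jostClass` in terms of the kernel near a side of the cut. -/
def sideClass (hs : s₁ < s) (hu : MemWeightedLp 2 s u) (σ : Side) (k : ℂ) (l : ℝ) : Linf :=
  fredholmSol (potentialOp hu)
    (convOp s₁ (s - s₁) (sideKernel σ k), planeWave (b := s - s₁) (sub_nonneg.2 hs.le) l)

theorem jostClass_boundary (hs₁ : 1 / 2 < s₁) (hs : s₁ < s) (hu : MemWeightedLp 2 s u) {a : ℝ}
    (ha : 0 < a) (σ : Side) (l : ℝ) :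
    jostClass hs hu (.boundary a σ) l = sideClass hs hu σ a l := by
  obtain ⟨C, h⟩ := admissibleKernel_sideKernel hs₁ (sub_nonneg.2 hs.le) (σ := σ) (k := a) (by simp)
    (by simpa)
  unfold jostClass sideClass
  rw [h.convOp_congr_ae (boundaryKernel_ae_eq_sideKernel ha σ).symm]
  rfl

theorem jostClass_interior (hs₁ : 1 / 2 < s₁) (hs : s₁ < s) (hu : MemWeightedLp 2 s u) {k : ℂ}
    {σ : Side} (hk : 0 < σ.sgn * k.im) (hre : 0 < k.re) (l : ℝ) :
    jostClass hs hu (.interior k) l = sideClass hs hu σ k l := by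
  obtain ⟨C, h⟩ := admissibleKernel_sideKernel hs₁ (sub_nonneg.2 hs.le) hk.le hre
  unfold jostClass sideClass
  rw [h.convOp_congr_ae (kernel_ae_eq_sideKernel hk).symm]
  rfl

/-- The frequency q k of the plane wave may move with k: constant q serves m₁, and q = Re serves mₑ,
whose datum varies with the spectral parameter. The bound r ≤ a keeps nearby points in the right
half plane, where the side kernel represents the actual one. -/
theorem exists_holder_sideClass (hs₁ : 1 / 2 < s₁) (hs : s₁ < s) (hu : MemWeightedLp 2 s u)
    {γ : ℝ} (hγ : 0 < γ) (hγ1 : γ ≤ 1) (hγs : 1 / 2 < s₁ - γ) (hγb : γ ≤ s - s₁) {a : ℝ}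
    (ha : 0 < a) (σ : Side) {q : ℂ → ℝ} (hq : ∀ k k', |q k - q k'| ≤ ‖k - k'‖) :
    ∃ r > 0, r ≤ a ∧ ∃ C : ℝ, ∀ k ∈ {k : ℂ | 0 ≤ σ.sgn * k.im}, ∀ k' ∈ {k : ℂ | 0 ≤ σ.sgn * k.im},
      ‖k - a‖ < r → ‖k' - a‖ < r →
      ‖sideClass hs hu σ k (q k) - sideClass hs hu σ k' (q k')‖ ≤ C * ‖k - k'‖ ^ γ := by
  obtain ⟨r, hr, C, hC, h⟩ := exists_holder_convOp_sideKernel hγ.le hγ1 hγs hγb σ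
    (k₀ := (a : ℂ)) (by simpa)
  have hz : SpectralPoint.boundary a σ ∈ spectralDomain u := ha
  have hunit := isUnit_one_sub_potentialOp hs₁ hs hu hz
  obtain ⟨C₁, h₁⟩ := admissibleKernel_sideKernel hs₁ (sub_nonneg.2 hs.le) (σ := σ) (k := a)
    (by simp) (by simpa)
  have hG : convOp s₁ (s - s₁) (SpectralPoint.boundary a σ).G =
      convOp s₁ (s - s₁) (sideKernel σ a) :=
    (h₁.convOp_congr_ae (boundaryKernel_ae_eq_sideKernel ha σ).symm).symm
  rw [hG] at hunit
  set p : ℂ → (L2 →L[ℂ] Linf) × Linf := fun k => (convOp s₁ (s - s₁) (sideKernel σ k),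
    planeWave (b := s - s₁) (sub_nonneg.2 hs.le) (q k)) with hp
  have hpC : ∀ k ∈ {k : ℂ | 0 ≤ σ.sgn * k.im}, ∀ k' ∈ {k : ℂ | 0 ≤ σ.sgn * k.im},
      ‖k - a‖ < r → ‖k' - a‖ < r → ‖p k - p k'‖ ≤ max C 2 * ‖k - k'‖ ^ γ := by
    intro k hk k' hk' e e'
    rw [hp, Prod.mk_sub_mk, Prod.norm_mk]
    have h0 : 0 ≤ ‖k - k'‖ ^ γ := by positivity
    refine max_le ((h k k' e e' hk hk').2.2.trans
      (mul_le_mul_of_nonneg_right (le_max_left _ _) h0)) ?_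
    refine (norm_planeWave_sub_le hγ.le hγ1 (sub_nonneg.2 hs.le) hγb (q k) (q k')).trans ?_
    exact (mul_le_mul_of_nonneg_left (Real.rpow_le_rpow (abs_nonneg _) (hq k k') hγ.le)
      zero_le_two).trans (mul_le_mul_of_nonneg_right (le_max_right _ _) h0)
  obtain ⟨r', hr', C', h'⟩ := AnalyticAt.exists_holder_comp (p := p)
    (analyticAt_fredholmSol hunit) hγ (by simp) hr (hC.trans (le_max_left _ _)) hpC
  exact ⟨min r' a, by positivity, min_le_right _ _, C', fun k hk k' hk' e e' =>
    h' k hk k' hk' (e.trans_le (min_le_left _ _)) (e'.trans_le (min_le_left _ _))⟩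

theorem exists_holder_jostClass (hs₁ : 1 / 2 < s₁) (hs : s₁ < s) (hu : MemWeightedLp 2 s u)
    {γ : ℝ} (hγ : 0 < γ) (hγ1 : γ ≤ 1) (hγs : 1 / 2 < s₁ - γ) (hγb : γ ≤ s - s₁)
    {z : SpectralPoint} (hz : z ∈ spectralDomain u) (l : ℝ) :
    ∃ r > 0, ∃ C : ℝ, ∀ y ∈ z.near r, ∀ y' ∈ z.near r,
      ‖jostClass hs hu y l - jostClass hs hu y' l‖ ≤ C * ‖y.val - y'.val‖ ^ γ := by
  cases z with
  | interior k =>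
    obtain ⟨r, hr, C, h⟩ := exists_holder_jostClass_interior hs₁ hs hu hγ1 hz l
    refine ⟨r, hr, C, ?_⟩
    rintro y ⟨k₁, rfl, h₁⟩ y' ⟨k₂, rfl, h₂⟩
    exact h k₁ k₂ h₁ h₂
  | boundary a σ =>
    have ha : 0 < a := hz
    obtain ⟨r, hr, hra, C, h⟩ := exists_holder_sideClass hs₁ hs hu hγ hγ1 hγs hγb ha σ
      (q := fun _ => l) (by simp)
    -- Interior points on the side σ and boundary points are given by the same function on the
    -- closed half plane, so one estimate covers all mixed pairs.
    have hrepr : ∀ y ∈ (SpectralPoint.boundary a σ).near r,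
        jostClass hs hu y l = sideClass hs hu σ y.val l ∧ 0 ≤ σ.sgn * y.val.im ∧
          ‖y.val - a‖ < r := by
      rintro y (⟨k, rfl, him, hk⟩ | ⟨a', rfl, ha'⟩)
      · have hre : 0 < k.re := by
          have := ((Complex.abs_re_le_norm (k - a)).trans_lt hk).trans_le hra
          rw [Complex.sub_re, Complex.ofReal_re, abs_lt] at this
          linarith [this.1]
        exact ⟨jostClass_interior hs₁ hs hu him hre l, him.le, hk⟩
      · have hpos : 0 < a' := by
          have := ha'.trans_le hra
          rw [abs_lt] at this
          linarith [this.1]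
        refine ⟨jostClass_boundary hs₁ hs hu hpos σ l, by simp [SpectralPoint.val], ?_⟩
        rw [SpectralPoint.val, ← Complex.ofReal_sub, Complex.norm_real]
        exact ha'
    refine ⟨r, hr, C, fun y hy y' hy' => ?_⟩
    obtain ⟨e1, e2, e3⟩ := hrepr y hy
    obtain ⟨e1', e2', e3'⟩ := hrepr y' hy'
    rw [e1, e1']
    exact h _ e2 _ e2' e3 e3'

theorem exists_holder_jostClass_boundary (hs₁ : 1 / 2 < s₁) (hs : s₁ < s)
    (hu : MemWeightedLp 2 s u) {γ : ℝ} (hγ : 0 < γ) (hγ1 : γ ≤ 1) (hγs : 1 / 2 < s₁ - γ)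
    (hγb : γ ≤ s - s₁) (σ : Side) {l : ℝ} (hl : 0 < l) :
    ∃ r > 0, ∃ C : ℝ, ∀ a ∈ Ioo (l - r) (l + r) ∩ Ioi 0, ∀ b ∈ Ioo (l - r) (l + r) ∩ Ioi 0,
      ‖jostClass hs hu (.boundary a σ) a - jostClass hs hu (.boundary b σ) b‖ ≤
        C * |a - b| ^ γ := by
  obtain ⟨r, hr, -, C, h⟩ := exists_holder_sideClass hs₁ hs hu hγ hγ1 hγs hγb hl σ
    (q := Complex.re) (fun k k' => by
      rw [← Complex.sub_re]
      exact Complex.abs_re_le_norm _)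
  refine ⟨r, hr, C, fun a ha b hb => ?_⟩
  have hdist : ∀ a ∈ Ioo (l - r) (l + r), ‖(a : ℂ) - l‖ < r := fun a ha => by
    rw [← Complex.ofReal_sub, Complex.norm_real, Real.norm_eq_abs, abs_lt]
    constructor <;> linarith [ha.1, ha.2]
  have := h a (by simp) b (by simp) (hdist a ha.1) (hdist b hb.1)
  rw [← Complex.ofReal_sub, Complex.norm_real] at this
  rw [jostClass_boundary hs₁ hs hu ha.2, jostClass_boundary hs₁ hs hu hb.2]
  exact this

end Solutions

end BenjaminOno

end

/-! ### The main theorem -/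

theorem theorem3p5 (s s₁ : ℝ) (hs₁ : 1 / 2 < s₁) (hs : s₁ < s) (u : ℝ → ℝ)
    (hu : BenjaminOno.MemWeightedLp 2 s u) :
    ∃ (m₁ : BenjaminOno.SpectralPoint → BenjaminOno.WeightedLp ∞ (-(s - s₁)))
      (mₑ : BenjaminOno.Side → ℝ → BenjaminOno.WeightedLp ∞ (-(s - s₁)))
      (γ : ℝ),
      -- existence, boundedness and uniqueness of `m₁`
      (∀ z ∈ BenjaminOno.spectralDomain u,
        BenjaminOno.SolvesJost u z (fun _ => 1) (m₁ z : ℝ →ₘ[volume] ℂ) ∧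
        MemLp (m₁ z : ℝ →ₘ[volume] ℂ) ∞ volume ∧
        ∀ m : BenjaminOno.WeightedLp ∞ (-(s - s₁)),
          BenjaminOno.SolvesJost u z (fun _ => 1) (m : ℝ →ₘ[volume] ℂ) → m = m₁ z) ∧
      -- existence, boundedness and uniqueness of `mₑ`
      (∀ (σ : BenjaminOno.Side) (l : ℝ), 0 < l →
        BenjaminOno.SolvesJost u (.boundary l σ) (fun x => Complex.exp (Complex.I * l * x))
          (mₑ σ l : ℝ →ₘ[volume] ℂ) ∧
        MemLp (mₑ σ l : ℝ →ₘ[volume] ℂ) ∞ volume ∧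
        ∀ m : BenjaminOno.WeightedLp ∞ (-(s - s₁)),
          BenjaminOno.SolvesJost u (.boundary l σ) (fun x => Complex.exp (Complex.I * l * x))
            (m : ℝ →ₘ[volume] ℂ) → m = mₑ σ l) ∧
      -- analyticity of `k ↦ m₁(k)` on the resolvent set
      AnalyticOnNhd ℂ (fun k : ℂ => m₁ (.interior k)) (BenjaminOno.laxResolventSet u) ∧
      -- local Hölder continuity
      0 < γ ∧ γ < 1 ∧
      (∀ z ∈ BenjaminOno.spectralDomain u, ∃ r > 0, ∃ C : ℝ,
        ∀ y ∈ z.near r ∩ BenjaminOno.spectralDomain u,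
        ∀ y' ∈ z.near r ∩ BenjaminOno.spectralDomain u,
          ‖m₁ y - m₁ y'‖ ≤ C * ‖y.val - y'.val‖ ^ γ) ∧
      (∀ (σ : BenjaminOno.Side) (l : ℝ), 0 < l → ∃ r > 0, ∃ C : ℝ,
        ∀ a ∈ Ioo (l - r) (l + r) ∩ Ioi 0, ∀ b ∈ Ioo (l - r) (l + r) ∩ Ioi 0,
          ‖mₑ σ a - mₑ σ b‖ ≤ C * |a - b| ^ γ) := by
  have hb : 0 < s - s₁ := sub_pos.2 hs
  -- The bound s - s₁ absorbs the growth w^γ in the target, (s₁ - 1/2)/2 keeps w^{-(s₁-γ)} square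
  -- integrable, and 1/2 ensures γ < 1.
  set γ := min (s - s₁) (min ((s₁ - 1 / 2) / 2) (1 / 2)) with hγ
  have hγ0 : 0 < γ := lt_min hb (lt_min (by linarith) (by norm_num))
  have hγb : γ ≤ s - s₁ := min_le_left _ _
  have hγ1 : γ ≤ 1 / 2 := (min_le_right _ _).trans (min_le_right _ _)
  have hγs : 1 / 2 < s₁ - γ := by
    have : γ ≤ (s₁ - 1 / 2) / 2 := (min_le_right _ _).trans (min_le_left _ _)
    linarith
  -- The function m₁ is the solution whose plane wave has frequency 0, since e^{i0x} = 1.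
  refine ⟨fun z => BenjaminOno.weightedClass (BenjaminOno.jostClass hs hu z 0),
    fun σ l => BenjaminOno.weightedClass (BenjaminOno.jostClass hs hu (.boundary l σ) l), γ,
    fun z hz => ?_, fun σ l hl => BenjaminOno.solvesJost_jostClass hs₁ hs hu
      (z := .boundary l σ) hl l, fun k hk => ?_, hγ0, by linarith, fun z hz => ?_,
    fun σ l hl => ?_⟩
  · have h := BenjaminOno.solvesJost_jostClass hs₁ hs hu hz 0
    simpa only [Complex.ofReal_zero, mul_zero, zero_mul, Complex.exp_zero] using h
  · exact BenjaminOno.AnalyticAt.contraction_comp BenjaminOno.weightedClass_add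
      BenjaminOno.weightedClass_smul (fun n => (BenjaminOno.norm_weightedClass n).le)
      (BenjaminOno.analyticAt_jostClass hs₁ hs hu hk 0)
  · obtain ⟨r, hr, C, h⟩ := BenjaminOno.exists_holder_jostClass hs₁ hs hu hγ0 (by linarith) hγs
      hγb hz 0
    refine ⟨r, hr, C, fun y hy y' hy' => ?_⟩
    rw [BenjaminOno.norm_weightedClass_sub]
    exact h y hy.1 y' hy'.1
  · obtain ⟨r, hr, C, h⟩ := BenjaminOno.exists_holder_jostClass_boundary hs₁ hs hu hγ0
      (by linarith) hγs hγb σ hl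
    refine ⟨r, hr, C, fun a ha b hb => ?_⟩
    rw [BenjaminOno.norm_weightedClass_sub]
    exact h a ha b hb
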